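/- **Concrete sites.** A *concrete site* $(\mathbb C,J)$ is a small category $\mathbb C$ with a terminal object $\star$ and an initial object $0$ such that the functor $|{-}|=\mathbb C(\star,-)$ is faithful, together with, for each object $c$, a set $J(c)$ of families of maps into $c$ (covering families), such that: (C) if $\{f_i:c_i\to c\}\in J(c)$ and $h:d\to c$, there is $\{g_j\}\in J(d)$ such that every $h\circ g_j$ factors through some $f_i$; ($\star$) if $\{f_i\}\in J(c)$, then every point of $c$ factors through some $f_i$; (0) $\emptyset\in J(0)$; (M) $\{1_c\}\in J(c)$; (L) if $\{f_i:c_i\to c\}\in J(c)$ and $\{g_{ij}\}_j\in J(c_i)$ for each $i$, then $\{f_i\circ g_{ij}\}_{i,j}\in J(c)$. $\mathrm{Sh}(\mathbb C,J)$ is the category of sheaves of sets on $(\mathbb C,J)$. A sheaf $X$ is *concrete* if for each $c$ the elements of $X(c)$ are determined by their restrictions along the points of $c$. **Admissible monos.** A class $\mathcal M$ of monos of $\mathbb C$ is *admissible* if: it contains all isomorphisms and all maps $0\to c$; it is closed under composition; all pullbacks of $\mathcal M$-maps exist and are in $\mathcal M$; the presheaf $\Delta_{\mathcal M}(c)=\mathrm{Sub}_{\mathcal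 M}(c)$ of subobjects represented by $\mathcal M$-maps (acting by pullback) is a $J$-sheaf; the map from $\mathrm{Sub}_{\mathcal M}(c)$ to subsets of $|c|$ that sends a subobject to the set of points factoring through it is order-reflecting (hence injective) and its image is closed under unions of $\omega$-chains; and for each $\omega$-chain $(c_n\rightarrowtail c)_n$ in $\mathrm{Sub}_{\mathcal M}(c)$ with supremum $c_\infty\rightarrowtail c$, the closure under precomposition of the set of inclusions $\{c_n\rightarrowtail c_\infty\}$ contains a covering family of $c_\infty$. **Sheaf lifting and completeness.** For admissible $\mathcal M$, the lifting monad $L_{\mathcal M}$ on $\mathrm{Sh}(\mathbb C,J)$ is $L_{\mathcal M}(X)(c)=\coprod_{(c'\rightarrowtail c)\in \mathrm{Sub}_{\mathcal M}(c)}X(c')$, with restriction by pullback, unit given by total elements and multiplication by composing subobjects. It has a natural point $\bot:1\to L_{\mathcal M}X$ given by $0\rightarrowtail c$. Let $\omega$ be the colimit in $\mathrm{Sh}(\mathbb C,J)$ of $1\xrightarrow{\bot}L1\xrightarrow{L\bot}LL1\to\cdots$, $\bar\omega$ the limit of $1\xleftarrow{!}L1\xleftarrow{L!}LL1\leftarrow\cdots$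 (with $L=L_{\mathcal M}$), and $i:\omega\to\bar\omega$ the comparison map. A sheaf $X$ is *$L_{\mathcal M}$-complete* if for every sheaf $A$ every map $\omega\times A\to X$ factors uniquely through $i\times 1_A:\omega\times A\to\bar\omega\times A$. **$\omega$-concrete sheaves.** An *$\omega$-concrete sheaf* $X$ on $(\mathbb C,J)$ is an $\omega$cpo $|X|$ (a poset with suprema of increasing $\omega$-chains, not necessarily with a least element) with, for each $c$, a set $R^c_X$ of functions $|c|\to|X|$, such that $R^c_X$ contains the constant functions; $g\in R^c_X$ and $h:d\to c$ imply $g\circ|h|\in R^d_X$; if $\{f_i:c_i\to c\}\in J(c)$ and $g\circ|f_i|\in R^{c_i}_X$ for all $i$, then $g\in R^c_X$; and $R^c_X$ is closed under pointwise suprema of $\omega$-chains. Morphisms $X\to Y$ are $\omega$-continuous functions $\alpha:|X|\to|Y|$ with $\alpha\circ g\in R^c_Y$ for all $g\in R^c_X$. They form a category $\omega\mathsf{Conc}(\mathbb C,J)$. For admissible $\mathcal M$, the lifting monad $L_{\mathcal M}$ on it has $|L_{\mathcal M}X|=|X|\uplus\{\bot\}$ with $\bot$ least, and $g\in R^c_{L_{\mathcal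 M}X}$ iff there is $m:c'\rightarrowtail c$ in $\mathcal M$ with $g^{-1}(|X|)=\mathrm{Im}|m|$ and $g\circ|m|\in R^{c'}_X$; its unit and multiplication are those of the maybe monad. **The combined site.** Let $V=\omega+1$. The category $\mathbb C+\mathbb V_0$ has the objects of $\mathbb C$ and one more object $V$. Its maps are functions between sets of points, where $|V|=\omega+1$: between objects of $\mathbb C$, the functions $|h|$ for $h$ in $\mathbb C$; from $V$ to $V$, the $\omega$-continuous functions; between $V$ and an object of $\mathbb C$, in either direction, the constant functions (including the empty function out of the empty set). The covering families $J\cup J_V$ are those of $J$ on the objects of $\mathbb C$, and only $\{1_V\}$ on $V$. The class $\mathcal M\cup\mathcal M_V$ consists of $\mathcal M$, the maps $x\mapsto x+n$ on $V$ $(n\in\mathbb N)$, and the maps $0\to V$ for the initial objects $0$ of $\mathbb C$. **Proposition.** Let $(\mathbb C,J)$ be a concrete site with a class $\mathcal M$ of admissible monos. Then $\omega\mathsf{Conc}(\mathbb C,J)$ has all small products and small coproducts and is cartesian closed, $(\mathbb C+\mathbb V_0,J\cup J_V)$ is a concrete site with class of admissible monos $\mathcal M\cup\mathcal M_V$, and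 there is a functor $$F:\omega\mathsf{Conc}(\mathbb C,J)\longrightarrow\mathrm{Sh}(\mathbb C+\mathbb V_0,J\cup J_V)$$ that is full and faithful, preserves small products, small coproducts and exponentials (the canonical comparison maps are isomorphisms), and commutes with the lifting monads: there is a natural isomorphism $F L_{\mathcal M}\cong L_{\mathcal M\cup\mathcal M_V}F$ compatible with the units and the multiplications. Moreover, for every $\omega$-concrete sheaf $X$, $FX$ is a concrete, $L_{\mathcal M\cup\mathcal M_V}$-complete sheaf. -/

import Mathlib

open CategoryTheory Limits Opposite

universe u

noncomputable section

namespace OmegaSheaf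

section Partiality

variable {C : Type u} [SmallCategory C]

/-- A class of monomorphisms containing the isomorphisms, closed under composition, all of whose
pullbacks exist and are again in the class. -/
class StableMonos (M : MorphismProperty C) : Prop where
  mono : ∀ {c d : C} (m : c ⟶ d), M m → Mono m
  iso : ∀ {c d : C} (m : c ⟶ d), IsIso m → M m
  comp : ∀ {b c d : C} (m : b ⟶ c) (n : c ⟶ d), M m → M n → M (m ≫ n)
  hasPullback : ∀ {b c d : C} (m : b ⟶ d) (f : c ⟶ d), M m → HasPullback m f
  pullback : ∀ {a b c d : C} {k : a ⟶ b} {n : a ⟶ c} {m : b ⟶ d} {f : c ⟶ d},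
    IsPullback k n m f → M m → M n

/-- `Sub_M(c)`: the subobjects of `c` that have a representative in `M` (as `M` contains
the isomorphisms and is closed under composition, the chosen representative is then in `M`). -/
structure MSub (M : MorphismProperty C) (c : C) : Type u where
  sub : Subobject c
  mem : M sub.arrow

/-- The object `c'` of an `M`-subobject `c' ↣ c`. -/
abbrev MSub.obj {M : MorphismProperty C} {c : C} (P : MSub M c) : C := (P.sub : C)

/-- The map of an `M`-subobject `c' ↣ c`. -/
abbrev MSub.arrow {M : MorphismProperty C} {c : C} (P : MSub M c) : P.obj ⟶ c := P.sub.arrow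

/-- A map factors through an `M`-subobject. -/
abbrev MSub.Factors {M : MorphismProperty C} {c d : C} (P : MSub M c) (g : d ⟶ c) : Prop :=
  P.sub.Factors g

/-- The factorization of a map through an `M`-subobject. -/
abbrev MSub.factorThru {M : MorphismProperty C} {c d : C} (P : MSub M c) (g : d ⟶ c)
    (h : P.Factors g) : d ⟶ P.obj := P.sub.factorThru g h

variable {M : MorphismProperty C}

theorem MSub.ext' {c : C} {P Q : MSub M c}
    (h : ∀ {d : C} (g : d ⟶ c), P.Factors g ↔ Q.Factors g) : P = Q := by
  obtain ⟨P, hP⟩ := P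
  obtain ⟨Q, hQ⟩ := Q
  obtain rfl : P = Q :=
    le_antisymm (Subobject.le_of_factors ((h _).1 (Subobject.factors_self _)))
      (Subobject.le_of_factors ((h _).2 (Subobject.factors_self _)))
  rfl

variable (M) in
/-- The elements of `L_M(X)(c)`: an `M`-subobject `c' ↣ c` and an element of `X(c')`. -/
structure LiftElt (X : Cᵒᵖ ⥤ Type u) (c : C) : Type u where
  dom : MSub M c
  val : X.obj (op dom.obj)

namespace LiftElt

variable {X Y Z : Cᵒᵖ ⥤ Type u}

/-- The value of a partial element along a map that factors through its domain. -/
def ev {c d : C} (s : LiftElt M X c) (g : d ⟶ c) (h : s.dom.Factors g) : X.obj (op d) :=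
  X.map (s.dom.factorThru g h).op s.val

theorem ext' {c : C} {s t : LiftElt M X c}
    (h : ∀ {d : C} (g : d ⟶ c), s.dom.Factors g ↔ t.dom.Factors g)
    (h' : ∀ {d : C} (g : d ⟶ c) (hs : s.dom.Factors g) (ht : t.dom.Factors g),
      s.ev g hs = t.ev g ht) : s = t := by
  obtain ⟨P, x⟩ := s
  obtain ⟨Q, y⟩ := t
  obtain rfl : P = Q := MSub.ext' h
  have := h' P.arrow (Subobject.factors_self _) (Subobject.factors_self _)
  simpa [ev, Subobject.factorThru_self] using this

theorem ev_comp {c d e : C} (s : LiftElt M X c) (g : d ⟶ c) (k : e ⟶ d)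
    (h : s.dom.Factors g) (h' : s.dom.Factors (k ≫ g)) :
    s.ev (k ≫ g) h' = X.map k.op (s.ev g h) := by
  have : s.dom.factorThru (k ≫ g) h' = k ≫ s.dom.factorThru g h :=
    (Subobject.factorThru_right k g h).symm
  rw [ev, this, op_comp, Functor.map_comp, types_comp_apply]
  rfl

theorem ev_congr {c d : C} (s : LiftElt M X c) {g g' : d ⟶ c} (e : g = g')
    (h : s.dom.Factors g) : s.ev g h = s.ev g' (e ▸ h) := by
  subst e; rfl

/-- The action of a map of presheaves on partial elements. -/
def map (α : X ⟶ Y) {c : C} (s : LiftElt M X c) : LiftElt M Y c where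
  dom := s.dom
  val := α.app _ s.val

@[simp]
theorem map_dom (α : X ⟶ Y) {c : C} (s : LiftElt M X c) : (map α s).dom = s.dom := rfl

theorem map_ev (α : X ⟶ Y) {c d : C} (s : LiftElt M X c) (g : d ⟶ c)
    (h : s.dom.Factors g) (h' : (map α s).dom.Factors g) :
    (map α s).ev g h' = α.app _ (s.ev g h) :=
  (NatTrans.naturality_apply α (s.dom.factorThru g h).op s.val).symm

end LiftElt

variable [StableMonos M]

/-- The `M`-subobject represented by a map in `M`. -/
def MSub.mk' {c d : C} (m : d ⟶ c) (hm : M m) : MSub M c :=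
  haveI := StableMonos.mono m hm
  ⟨Subobject.mk m, by
    rw [← Subobject.underlyingIso_hom_comp_eq_mk]
    exact StableMonos.comp _ _ (StableMonos.iso _ inferInstance) hm⟩

/-- The canonical isomorphism between the domain of `m` and that of the subobject it represents. -/
def MSub.mk'Iso {c d : C} (m : d ⟶ c) (hm : M m) : (MSub.mk' m hm).obj ≅ d :=
  haveI := StableMonos.mono m hm
  Subobject.underlyingIso m

theorem MSub.mk'Iso_comp {c d : C} (m : d ⟶ c) (hm : M m) :
    (MSub.mk'Iso m hm).hom ≫ m = (MSub.mk' m hm).arrow :=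
  haveI := StableMonos.mono m hm
  Subobject.underlyingIso_hom_comp_eq_mk m

theorem MSub.mk'_factors {c d e : C} (m : d ⟶ c) (hm : M m) (g : e ⟶ c) :
    (MSub.mk' m hm).Factors g ↔ ∃ k : e ⟶ d, k ≫ m = g :=
  haveI := StableMonos.mono m hm
  Subobject.mk_factors_iff m g

theorem MSub.factorThru_mk' {c d e : C} (m : d ⟶ c) (hm : M m) (k : e ⟶ d)
    (h : (MSub.mk' m hm).Factors (k ≫ m)) :
    (MSub.mk' m hm).factorThru (k ≫ m) h ≫ (MSub.mk'Iso m hm).hom = k := by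
  have := StableMonos.mono m hm
  rw [← cancel_mono m, Category.assoc, MSub.mk'Iso_comp, Subobject.factorThru_arrow]

/-- Pullback of `M`-subobjects. -/
def MSub.pull {c d : C} (f : d ⟶ c) (P : MSub M c) : MSub M d :=
  haveI := StableMonos.hasPullback P.arrow f P.mem
  MSub.mk' (pullback.snd P.arrow f) (StableMonos.pullback (IsPullback.of_hasPullback _ _) P.mem)

@[simp]
theorem MSub.pull_factors {c d e : C} (f : d ⟶ c) (P : MSub M c) (g : e ⟶ d) :
    (MSub.pull f P).Factors g ↔ P.Factors (g ≫ f) := by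
  have := StableMonos.hasPullback P.arrow f P.mem
  rw [MSub.pull, MSub.mk'_factors]
  constructor
  · rintro ⟨k, rfl⟩
    rw [Category.assoc, ← pullback.condition, ← Category.assoc]
    exact Subobject.factors_comp_arrow _
  · intro h
    exact ⟨pullback.lift (P.factorThru _ h) g (Subobject.factorThru_arrow _ _ _),
      pullback.lift_snd _ _ _⟩

variable (M) in
/-- The presheaf `Δ_M` of `M`-subobjects. -/
def dominance : Cᵒᵖ ⥤ Type u where
  obj c := MSub M c.unop
  map f := TypeCat.ofHom (MSub.pull f.unop)
  map_id c := by
    ext P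
    refine MSub.ext' fun g => ?_
    simp
  map_comp f g := by
    ext P
    refine MSub.ext' fun g => ?_
    simp

/-- `M` is a class of pre-admissible monos for the site `(C, J)`: moreover `Δ_M` is a sheaf. -/
class PreAdmissible (J : GrothendieckTopology C) (M : MorphismProperty C) : Prop
    extends StableMonos M where
  isSheaf : Presieve.IsSheaf J (dominance M)

namespace LiftElt

variable {X Y Z : Cᵒᵖ ⥤ Type u}

/-- Restriction of partial elements. -/
def res {c d : C} (f : d ⟶ c) (s : LiftElt M X c) : LiftElt M X d where
  dom := MSub.pull f s.dom
  val := s.ev ((MSub.pull f s.dom).arrow ≫ f)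
    ((MSub.pull_factors f s.dom _).1 (Subobject.factors_self _))

@[simp]
theorem res_dom {c d : C} (f : d ⟶ c) (s : LiftElt M X c) :
    (res f s).dom = MSub.pull f s.dom := rfl

theorem res_ev {c d e : C} (f : d ⟶ c) (s : LiftElt M X c) (g : e ⟶ d)
    (h : (res f s).dom.Factors g) :
    (res f s).ev g h = s.ev (g ≫ f) ((MSub.pull_factors f s.dom g).1 h) := by
  have : (g ≫ f) = (MSub.pull f s.dom).factorThru g h ≫ (MSub.pull f s.dom).arrow ≫ f :=
    ((Category.assoc _ _ _).symm.trans (by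
      rw [Subobject.factorThru_arrow (MSub.pull f s.dom).sub g h])).symm
  rw [s.ev_congr this, ev_comp]
  rfl

/-- The partial element with a given domain `m` in `M` and a given value. -/
def mk' {c d : C} (m : d ⟶ c) (hm : M m) (x : X.obj (op d)) : LiftElt M X c where
  dom := MSub.mk' m hm
  val := X.map (MSub.mk'Iso m hm).hom.op x

theorem mk'_factors {c d e : C} (m : d ⟶ c) (hm : M m) (x : X.obj (op d)) (g : e ⟶ c) :
    (mk' m hm x).dom.Factors g ↔ ∃ k : e ⟶ d, k ≫ m = g := MSub.mk'_factors m hm g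

theorem mk'_ev {c d e : C} (m : d ⟶ c) (hm : M m) (x : X.obj (op d)) (k : e ⟶ d)
    (h : (mk' m hm x).dom.Factors (k ≫ m)) : (mk' m hm x).ev (k ≫ m) h = X.map k.op x := by
  have := MSub.factorThru_mk' m hm k h
  conv_rhs => rw [← this, op_comp, Functor.map_comp, types_comp_apply]
  rfl

/-- The unit: total elements are partial elements with full domain. -/
def unit {c : C} (x : X.obj (op c)) : LiftElt M X c :=
  mk' (𝟙 c) (StableMonos.iso _ inferInstance) x

theorem unit_factors {c d : C} (x : X.obj (op c)) (g : d ⟶ c) :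
    (unit (M := M) x).dom.Factors g :=
  (mk'_factors _ _ _ _).2 ⟨g, Category.comp_id g⟩

theorem unit_ev {c d : C} (x : X.obj (op c)) (g : d ⟶ c)
    (h : (unit (M := M) x).dom.Factors g) : (unit (M := M) x).ev g h = X.map g.op x := by
  rw [ev_congr _ (Category.comp_id g).symm]
  exact mk'_ev _ _ _ _ _

end LiftElt

variable (M) in
/-- The presheaf `L_M(X)`, with `L_M(X)(c) = ∐ X(c')`, the coproduct being taken over the
`M`-subobjects `c' ↣ c`. -/
def liftPresheaf (X : Cᵒᵖ ⥤ Type u) : Cᵒᵖ ⥤ Type u where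
  obj c := LiftElt M X c.unop
  map f := TypeCat.ofHom (LiftElt.res f.unop)
  map_id c := by
    ext s
    refine LiftElt.ext' (fun g => by simp) (fun g hs ht => ?_)
    exact (LiftElt.res_ev _ s g hs).trans (s.ev_congr (by simp) _)
  map_comp f g := by
    ext s
    refine LiftElt.ext' (fun g => by simp) (fun k hs ht => ?_)
    refine (LiftElt.res_ev _ s k hs).trans ?_
    refine Eq.trans ?_ (LiftElt.res_ev g.unop (LiftElt.res f.unop s) k ht).symm
    rw [LiftElt.res_ev]
    exact s.ev_congr (by simp) _

/-- Composition of a partial element of `X` with an `M`-subobject containing its domain. -/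
def LiftElt.extend {X : Cᵒᵖ ⥤ Type u} {c : C} (P : MSub M c) (t : LiftElt M X P.obj) :
    LiftElt M X c :=
  mk' (t.dom.arrow ≫ P.arrow) (StableMonos.comp _ _ t.dom.mem P.mem) t.val

theorem LiftElt.extend_factors {X : Cᵒᵖ ⥤ Type u} {c d : C} (P : MSub M c)
    (t : LiftElt M X P.obj) (g : d ⟶ c) :
    (extend P t).dom.Factors g ↔ ∃ h : P.Factors g, t.dom.Factors (P.factorThru g h) := by
  rw [extend, mk'_factors]
  constructor
  · rintro ⟨k, rfl⟩
    have h : P.Factors (k ≫ t.dom.arrow ≫ P.arrow) := by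
      rw [← Category.assoc]; exact Subobject.factors_comp_arrow _
    refine ⟨h, ?_⟩
    have e : P.factorThru (k ≫ t.dom.arrow ≫ P.arrow) h = k ≫ t.dom.arrow := by
      rw [← cancel_mono P.arrow, Subobject.factorThru_arrow, Category.assoc]
    rw [e]
    exact Subobject.factors_comp_arrow _
  · rintro ⟨h, h'⟩
    refine ⟨t.dom.factorThru _ h', ?_⟩
    rw [← Category.assoc, Subobject.factorThru_arrow, Subobject.factorThru_arrow]

theorem LiftElt.extend_ev {X : Cᵒᵖ ⥤ Type u} {c d : C} (P : MSub M c)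
    (t : LiftElt M X P.obj) (g : d ⟶ c) (h : P.Factors g) (h' : t.dom.Factors (P.factorThru g h))
    (h'' : (extend P t).dom.Factors g) : (extend P t).ev g h'' = t.ev (P.factorThru g h) h' := by
  have e : g = t.dom.factorThru _ h' ≫ t.dom.arrow ≫ P.arrow := by
    rw [← Category.assoc, Subobject.factorThru_arrow, Subobject.factorThru_arrow]
  rw [ev_congr _ e]
  exact mk'_ev _ _ _ _ _

/-- The multiplication of `L_M`: compose the two domains of a partial partial element. -/
def LiftElt.join {X : Cᵒᵖ ⥤ Type u} {c : C} (s : LiftElt M (liftPresheaf M X) c) :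
    LiftElt M X c :=
  extend s.dom s.val

/-- An element of `L_M(L_M(X))(c)`, evaluated along a map that factors through its domain. -/
def LiftElt.evLift {X : Cᵒᵖ ⥤ Type u} {c d : C} (s : LiftElt M (liftPresheaf M X) c)
    (g : d ⟶ c) (h : s.dom.Factors g) : LiftElt M X d := s.ev g h

theorem LiftElt.evLift_eq {X : Cᵒᵖ ⥤ Type u} {c d : C} (s : LiftElt M (liftPresheaf M X) c)
    (g : d ⟶ c) (h : s.dom.Factors g) :
    s.evLift g h = LiftElt.res (X := X) (s.dom.factorThru g h) s.val := rfl

theorem LiftElt.evLift_congr {X : Cᵒᵖ ⥤ Type u} {c d : C} (s : LiftElt M (liftPresheaf M X) c)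
    {g g' : d ⟶ c} (e : g = g') (h : s.dom.Factors g) :
    s.evLift g h = s.evLift g' (e ▸ h) := ev_congr s e h

theorem LiftElt.join_factors {X : Cᵒᵖ ⥤ Type u} {c d : C}
    (s : LiftElt M (liftPresheaf M X) c) (g : d ⟶ c) :
    s.join.dom.Factors g ↔ ∃ h : s.dom.Factors g, (s.evLift g h).dom.Factors (𝟙 d) := by
  refine (extend_factors (X := X) s.dom s.val g).trans ?_
  refine exists_congr fun h => ?_
  rw [evLift_eq]
  refine Iff.trans ?_ (MSub.pull_factors _ (LiftElt.dom (X := X) s.val) _).symm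
  rw [Category.id_comp]

theorem LiftElt.join_ev {X : Cᵒᵖ ⥤ Type u} {c d : C}
    (s : LiftElt M (liftPresheaf M X) c) (g : d ⟶ c) (h : s.dom.Factors g)
    (h' : (s.evLift g h).dom.Factors (𝟙 d)) (h'' : s.join.dom.Factors g) :
    s.join.ev g h'' = (s.evLift g h).ev (𝟙 d) h' := by
  have e := res_ev (X := X) (s.dom.factorThru g h) s.val (𝟙 d) h'
  refine Eq.trans ?_ e.symm
  have k : LiftElt.dom (X := X) s.val |>.Factors (s.dom.factorThru g h) := by
    rw [← Category.id_comp (s.dom.factorThru g h)]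
    exact (MSub.pull_factors _ _ _).1 h'
  refine (extend_ev (X := X) s.dom s.val g h k h'').trans ?_
  exact ev_congr _ (by simp) _

theorem LiftElt.map_res {X Y : Cᵒᵖ ⥤ Type u} (α : X ⟶ Y) {c d : C} (f : d ⟶ c)
    (s : LiftElt M X c) : map α (res f s) = res f (map α s) := by
  refine ext' (fun g => Iff.rfl) (fun g hs ht => ?_)
  rw [map_ev α (res f s) g hs hs, res_ev f s g hs, res_ev]
  exact (map_ev _ _ _ _ _).symm

theorem LiftElt.map_unit {X Y : Cᵒᵖ ⥤ Type u} (α : X ⟶ Y) {c : C} (x : X.obj (op c)) :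
    map α (unit (M := M) x) = unit (α.app _ x) := by
  refine ext' (fun g => iff_of_true (unit_factors x g) (unit_factors (α.app _ x) g))
    (fun g hs ht => ?_)
  rw [map_ev α _ g (unit_factors x g) hs, unit_ev, unit_ev]
  exact NatTrans.naturality_apply α g.op x

theorem LiftElt.unit_res {X : Cᵒᵖ ⥤ Type u} {c d : C} (f : d ⟶ c) (x : X.obj (op c)) :
    unit (M := M) (X.map f.op x) = res f (unit x) := by
  refine ext' (fun g => iff_of_true (unit_factors _ _)
    ((MSub.pull_factors _ _ _).2 (unit_factors _ _))) (fun g hs ht => ?_)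
  rw [unit_ev, res_ev, unit_ev, op_comp, Functor.map_comp, types_comp_apply]

theorem LiftElt.join_res {X : Cᵒᵖ ⥤ Type u} {c d : C} (f : d ⟶ c)
    (s : LiftElt M (liftPresheaf M X) c) : (res f s).join = res f s.join := by
  have key : ∀ {e : C} (g : e ⟶ d) (h : (res f s).dom.Factors g) (h' : s.dom.Factors (g ≫ f)),
      (res f s).evLift g h = s.evLift (g ≫ f) h' := fun g h h' => res_ev f s g h
  refine ext' (fun g => ?_) (fun g hs ht => ?_)
  · rw [res_dom, MSub.pull_factors, join_factors, join_factors]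
    constructor
    · rintro ⟨h, h'⟩
      have h2 := (MSub.pull_factors _ _ _).1 h
      exact ⟨h2, key g h h2 ▸ h'⟩
    · rintro ⟨h, h'⟩
      have h2 : (res f s).dom.Factors g := (MSub.pull_factors _ _ _).2 h
      exact ⟨h2, (key g h2 h).symm ▸ h'⟩
  · obtain ⟨h, h'⟩ := (join_factors _ _).1 hs
    rw [res_ev, join_ev _ g h h']
    have h2 := (MSub.pull_factors _ _ _).1 h
    have e := key g h h2
    generalize evLift (res f s) g h = w at e h'
    subst e
    exact (join_ev _ _ h2 h' _).symm

/-- `L_M` on maps of presheaves. -/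
def liftPresheafMap {X Y : Cᵒᵖ ⥤ Type u} (α : X ⟶ Y) : liftPresheaf M X ⟶ liftPresheaf M Y where
  app c := TypeCat.ofHom (LiftElt.map α)
  naturality c d f := by
    ext s
    exact LiftElt.map_res α f.unop s

theorem LiftElt.join_map {X Y : Cᵒᵖ ⥤ Type u} (α : X ⟶ Y) {c : C}
    (s : LiftElt M (liftPresheaf M X) c) :
    join (map (liftPresheafMap α) s) = map α (join s) := by
  have key : ∀ {e : C} (g : e ⟶ c) (h : s.dom.Factors g),
      evLift (map (liftPresheafMap α) s) g h = map α (s.evLift g h) :=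
    fun g h => map_ev (liftPresheafMap α) s g h h
  refine ext' (fun g => ?_) (fun g hs ht => ?_)
  · rw [map_dom, join_factors, join_factors]
    refine exists_congr fun h => ?_
    rw [key g h, map_dom]
  · obtain ⟨h, h'⟩ := (join_factors _ _).1 hs
    have h0 : s.dom.Factors g := h
    rw [join_ev _ g h h', map_ev α s.join g ht ht]
    have e := key g h0
    generalize evLift (map (liftPresheafMap α) s) g h = w at e h'
    subst e
    rw [map_ev α (s.evLift g h0) (𝟙 _) h' h', join_ev s g h0 h' ht]

variable (M) in
/-- The unit of `L_M`, on presheaves. -/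
def liftPresheafUnit (X : Cᵒᵖ ⥤ Type u) : X ⟶ liftPresheaf M X where
  app c := TypeCat.ofHom LiftElt.unit
  naturality c d f := by
    ext x
    exact LiftElt.unit_res f.unop x

variable (M) in
/-- The multiplication of `L_M`, on presheaves. -/
def liftPresheafMul (X : Cᵒᵖ ⥤ Type u) :
    liftPresheaf M (liftPresheaf M X) ⟶ liftPresheaf M X where
  app c := TypeCat.ofHom LiftElt.join
  naturality c d f := by
    ext s
    exact LiftElt.join_res f.unop s

theorem lift_left_unit {X : Cᵒᵖ ⥤ Type u} {c : C} (s : LiftElt M X c) :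
    LiftElt.join (LiftElt.unit (X := liftPresheaf M X) s) = s := by
  have key : ∀ {d : C} (g : d ⟶ c)
      (h : (LiftElt.unit (M := M) (X := liftPresheaf M X) s).dom.Factors g),
      (LiftElt.unit (X := liftPresheaf M X) s).evLift g h = LiftElt.res g s :=
    fun g h => LiftElt.unit_ev (X := liftPresheaf M X) s g h
  refine LiftElt.ext' (fun g => ?_) (fun g hs ht => ?_)
  · rw [LiftElt.join_factors]
    simp only [key, LiftElt.res_dom, MSub.pull_factors, Category.id_comp, exists_prop]
    exact and_iff_right (LiftElt.unit_factors (X := liftPresheaf M X) s g)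
  · obtain ⟨h, h'⟩ := (LiftElt.join_factors _ _).1 hs
    rw [LiftElt.join_ev _ g h h']
    have e := key g h
    generalize LiftElt.evLift _ g h = w at e h'
    subst e
    rw [LiftElt.res_ev]
    exact LiftElt.ev_congr _ (by simp) _

theorem lift_right_unit {X : Cᵒᵖ ⥤ Type u} {c : C} (s : LiftElt M X c) :
    LiftElt.join (LiftElt.map (liftPresheafUnit M X) s) = s := by
  have key : ∀ {d : C} (g : d ⟶ c) (h : s.dom.Factors g),
      (LiftElt.map (liftPresheafUnit M X) s).evLift g h = LiftElt.unit (s.ev g h) :=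
    fun g h => LiftElt.map_ev (liftPresheafUnit M X) s g h h
  refine LiftElt.ext' (fun g => ?_) (fun g hs ht => ?_)
  · rw [LiftElt.join_factors]
    constructor
    · rintro ⟨h, -⟩
      exact h
    · intro h
      refine ⟨h, ?_⟩
      rw [key g h]
      exact LiftElt.unit_factors _ _
  · obtain ⟨h, h'⟩ := (LiftElt.join_factors _ _).1 hs
    rw [LiftElt.join_ev _ g h h']
    have e := key g h
    generalize LiftElt.evLift _ g h = w at e h'
    subst e
    rw [LiftElt.unit_ev]
    simp

theorem lift_assoc {X : Cᵒᵖ ⥤ Type u} {c : C}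
    (s : LiftElt M (liftPresheaf M (liftPresheaf M X)) c) :
    LiftElt.join (LiftElt.map (liftPresheafMul M X) s) = LiftElt.join (LiftElt.join s) := by
  have key : ∀ {d : C} (g : d ⟶ c) (h : s.dom.Factors g),
      (LiftElt.map (liftPresheafMul M X) s).evLift g h = LiftElt.join (s.evLift g h) :=
    fun g h => LiftElt.map_ev (liftPresheafMul M X) s g h h
  have key' : ∀ {d : C} (g : d ⟶ c) (h : s.dom.Factors g)
      (h' : (s.evLift g h).dom.Factors (𝟙 d)) (h'' : s.join.dom.Factors g),
      s.join.evLift g h'' = (s.evLift g h).evLift (𝟙 d) h' :=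
    fun g h h' h'' => LiftElt.join_ev s g h h' h''
  refine LiftElt.ext' (fun g => ?_) (fun g hs ht => ?_)
  · rw [LiftElt.join_factors, LiftElt.join_factors]
    constructor
    · rintro ⟨h, h'⟩
      rw [key g h, LiftElt.join_factors] at h'
      obtain ⟨h1, h2⟩ := h'
      refine ⟨(LiftElt.join_factors _ _).2 ⟨h, h1⟩, ?_⟩
      rw [key' g h h1]
      exact h2
    · rintro ⟨h, h'⟩
      obtain ⟨h1, h2⟩ := (LiftElt.join_factors _ _).1 h
      refine ⟨h1, ?_⟩
      rw [key g h1, LiftElt.join_factors]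
      refine ⟨h2, ?_⟩
      rw [key' g h1 h2] at h'
      exact h'
  · obtain ⟨h, h'⟩ := (LiftElt.join_factors _ _).1 hs
    obtain ⟨k, k'⟩ := (LiftElt.join_factors _ _).1 ht
    rw [LiftElt.join_ev _ g h h', LiftElt.join_ev _ g k k']
    obtain ⟨h1, h2⟩ := (LiftElt.join_factors _ _).1 k
    have e := key g h1
    have e' := key' g h1 h2 k
    generalize LiftElt.evLift s.join g k = w' at e' k'
    generalize LiftElt.evLift (LiftElt.map (liftPresheafMul M X) s) g h = w at e h'
    subst e e'
    exact LiftElt.join_ev _ _ _ _ _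

end Partiality

section PartialitySheaf

variable {C : Type u} [SmallCategory C] {M : MorphismProperty C} {J : GrothendieckTopology C}

theorem liftPresheaf_isSheaf [hM : PreAdmissible J M] (X : Cᵒᵖ ⥤ Type u)
    (hX : Presieve.IsSheaf J X) : Presieve.IsSheaf J (liftPresheaf M X) := by
  intro c T hT s hs
  rw [Presieve.compatible_iff_sieveCompatible] at hs
  let s' : ∀ {d : C} (f : d ⟶ c), T f → LiftElt M X d := fun f hf => s f hf
  have hs' : ∀ {d e : C} (f : d ⟶ c) (g : e ⟶ d) (hf : T f),
      s' (g ≫ f) (T.downward_closed hf g) = LiftElt.res g (s' f hf) :=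
    fun f g hf => hs f g hf
  -- the domain
  let D : Presieve.FamilyOfElements (dominance M) T.arrows := fun d f hf => (s' f hf).dom
  have hD : D.Compatible := by
    rw [Presieve.compatible_iff_sieveCompatible]
    intro d e f g hf
    exact congrArg LiftElt.dom (hs' f g hf)
  obtain ⟨P, hP, hPu⟩ := hM.isSheaf T hT D hD
  change MSub M c at P
  have hP' : ∀ {d : C} (f : d ⟶ c) (hf : T f), MSub.pull f P = (s' f hf).dom :=
    fun f hf => hP f hf
  have one : ∀ {d : C} (g : d ⟶ P.obj) (hf : T (g ≫ P.arrow)),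
      (s' (g ≫ P.arrow) hf).dom.Factors (𝟙 d) := by
    intro d g hf
    rw [← hP', MSub.pull_factors, Category.id_comp]
    exact Subobject.factors_comp_arrow _
  -- the value
  have hT' : T.pullback P.arrow ∈ J P.obj := J.pullback_stable _ hT
  let v : Presieve.FamilyOfElements X (T.pullback P.arrow).arrows :=
    fun d g hg => (s' (g ≫ P.arrow) hg).ev (𝟙 d) (one g hg)
  have hv : v.Compatible := by
    rw [Presieve.compatible_iff_sieveCompatible]
    intro d e f g hf
    have h1 : (g ≫ f) ≫ P.arrow = g ≫ f ≫ P.arrow := Category.assoc _ _ _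
    have h2 := hs' (f ≫ P.arrow) g hf
    have h3 : ∀ (k : e ⟶ c) (hk : T k) (h : (s' k hk).dom.Factors (𝟙 e)),
        k = g ≫ f ≫ P.arrow → (s' k hk).ev (𝟙 e) h =
          X.map g.op ((s' (f ≫ P.arrow) hf).ev (𝟙 d) (one f hf)) := by
      rintro k hk h rfl
      generalize s' (g ≫ f ≫ P.arrow) hk = w at h2 h
      subst h2
      rw [LiftElt.res_ev, ← LiftElt.ev_comp _ _ _ _ (by
        rw [Category.comp_id, ← Category.id_comp g]; exact (MSub.pull_factors _ _ _).1 h)]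
      exact LiftElt.ev_congr _ (by simp) _
    exact h3 _ _ _ h1
  obtain ⟨x, hx, hxu⟩ := hX _ hT' v hv
  refine ⟨(⟨P, x⟩ : LiftElt M X c), ?_, ?_⟩
  · intro d f hf
    change LiftElt.res f (⟨P, x⟩ : LiftElt M X c) = s' f hf
    refine LiftElt.ext' (fun g => ?_) (fun g hg ht => ?_)
    · rw [← hP' f hf]; rfl
    · rw [LiftElt.res_ev]
      have h : P.Factors (g ≫ f) := (MSub.pull_factors _ _ _).1 hg
      have e : P.factorThru (g ≫ f) h ≫ P.arrow = g ≫ f := Subobject.factorThru_arrow _ _ _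
      have hT2 : T (P.factorThru (g ≫ f) h ≫ P.arrow) := by
        rw [e]; exact T.downward_closed hf g
      have := hx (P.factorThru (g ≫ f) h) hT2
      refine Eq.trans this ?_
      have h2 := hs' f g hf
      have h3 : ∀ {e : C} (g : e ⟶ d) (k : e ⟶ c) (hk : T k) (h : (s' k hk).dom.Factors (𝟙 e))
          (hg : (s' f hf).dom.Factors g),
          k = g ≫ f → (s' k hk).ev (𝟙 e) h = (s' f hf).ev g hg := by
        rintro e g k hk h hg rfl
        have h2 := hs' f g hf
        generalize s' (g ≫ f) hk = w at h2 h
        subst h2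
        rw [LiftElt.res_ev]
        exact LiftElt.ev_congr _ (by simp) _
      exact h3 _ _ _ _ _ e
  · intro t ht
    change LiftElt M X c at t
    have ht' : ∀ {d : C} (f : d ⟶ c) (hf : T f), LiftElt.res f t = s' f hf :=
      fun f hf => ht f hf
    obtain ⟨Q, y⟩ := t
    obtain rfl : Q = P := hPu Q fun d f hf => congrArg LiftElt.dom (ht' f hf)
    have : y = x := by
      refine hxu y fun d g hg => ?_
      have h1 := ht' (g ≫ Q.arrow) hg
      have h2 := one g hg
      change _ = (s' (g ≫ Q.arrow) hg).ev (𝟙 d) h2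
      generalize s' (g ≫ Q.arrow) hg = w at h1 h2
      subst h1
      rw [LiftElt.res_ev, LiftElt.ev_congr _ (Category.id_comp _)]
      change _ = X.map (Q.factorThru (g ≫ Q.arrow) _).op y
      have h4 : Q.factorThru (g ≫ Q.arrow) (Subobject.factors_comp_arrow _) = g := by
        rw [← cancel_mono Q.arrow, Subobject.factorThru_arrow]
      rw [h4]
    rw [this]

variable (J M) in
/-- The lifting monad `L_M` on the category of sheaves on `(C, J)`. -/
def sheafLift [PreAdmissible J M] : Monad (Sheaf J (Type u)) where
  obj X := ⟨liftPresheaf M X.obj, (isSheaf_iff_isSheaf_of_type J _).2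
    (liftPresheaf_isSheaf X.obj ((isSheaf_iff_isSheaf_of_type J _).1 X.property))⟩
  map α := ⟨liftPresheafMap α.hom⟩
  map_id X := by
    ext c s
    rfl
  map_comp f g := by
    ext c s
    rfl
  η :=
    { app X := ⟨liftPresheafUnit M X.obj⟩
      naturality X Y α := by
        ext c x
        exact (LiftElt.map_unit α.hom x).symm }
  μ :=
    { app X := ⟨liftPresheafMul M X.obj⟩
      naturality X Y α := by
        ext c s
        exact LiftElt.join_map α.hom s }
  assoc X := by
    ext c s
    exact lift_assoc s
  left_unit X := by
    ext c s
    exact lift_left_unit s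
  right_unit X := by
    ext c s
    exact lift_right_unit s

end PartialitySheaf

section Bottom

variable {C : Type u} [SmallCategory C] {M : MorphismProperty C} {J : GrothendieckTopology C}
variable {z : C}

/-- A sheaf has exactly one element over an object that is covered by the empty family. -/
theorem existsUnique_of_empty_cover {X : Cᵒᵖ ⥤ Type u} (hX : Presieve.IsSheaf J X)
    (hzJ : (⊥ : Sieve z) ∈ J z) : ∃! _x : X.obj (op z), True := by
  obtain ⟨x, -, hu⟩ := hX ⊥ hzJ (fun _ _ h => h.elim) (fun _ _ _ _ _ _ _ h => h.elim)
  exact ⟨x, trivial, fun y _ => hu y fun _ _ h => h.elim⟩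

variable [PreAdmissible J M]

/-- The element `(0 ↣ c, *)` of `L_M(X)(c)`, where `*` is the unique element of `X(0)`. -/
def botElt (hz : IsInitial z) (hzJ : (⊥ : Sieve z) ∈ J z) (hzM : ∀ c, M (hz.to c))
    (X : Sheaf J (Type u)) (c : C) : LiftElt M X.obj c :=
  LiftElt.mk' (hz.to c) (hzM c)
    (existsUnique_of_empty_cover ((isSheaf_iff_isSheaf_of_type J _).1 X.property) hzJ).choose

theorem botElt_factors (hz : IsInitial z) (hzJ : (⊥ : Sieve z) ∈ J z) (hzM : ∀ c, M (hz.to c))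
    (X : Sheaf J (Type u)) {c d : C} (g : d ⟶ c) :
    (botElt hz hzJ hzM X c).dom.Factors g ↔ Nonempty (d ⟶ z) := by
  rw [botElt, LiftElt.mk'_factors]
  refine ⟨fun ⟨k, _⟩ => ⟨k⟩, fun ⟨k⟩ => ⟨k, ?_⟩⟩
  have hd : (⊥ : Sieve d) ∈ J d := by
    have := J.pullback_stable k hzJ
    rwa [Sieve.pullback_bot] at this
  obtain ⟨P, -, hP⟩ := existsUnique_of_empty_cover (PreAdmissible.isSheaf (J := J) (M := M)) hd
  have e : MSub.mk' (hz.to d) (hzM d) = MSub.mk' (𝟙 d) (StableMonos.iso _ inferInstance) :=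
    (hP _ trivial).trans (hP _ trivial).symm
  obtain ⟨l, hl⟩ := (MSub.mk'_factors (hz.to d) (hzM d) (𝟙 d)).1
    (e ▸ (MSub.mk'_factors _ _ _).2 ⟨𝟙 d, by simp⟩)
  have : l = k := by
    have h1 : k ≫ hz.to d ≫ k = k := by rw [hz.hom_ext (hz.to d ≫ k) (𝟙 z), Category.comp_id]
    have h2 : l ≫ hz.to d ≫ k = k := by rw [← Category.assoc, hl, Category.id_comp]
    have h3 : hz.to d ≫ k = 𝟙 z := hz.hom_ext _ _
    rw [← h2, h3, Category.comp_id]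
  subst this
  rw [hz.hom_ext (hz.to c) (hz.to d ≫ g), ← Category.assoc, hl, Category.id_comp]

theorem botElt_unique (hz : IsInitial z) (hzJ : (⊥ : Sieve z) ∈ J z) (hzM : ∀ c, M (hz.to c))
    (X : Sheaf J (Type u)) {c : C} (s : LiftElt M X.obj c)
    (hs : ∀ {d : C} (g : d ⟶ c), s.dom.Factors g ↔ Nonempty (d ⟶ z)) :
    s = botElt hz hzJ hzM X c := by
  refine LiftElt.ext' (fun g => (hs g).trans (botElt_factors hz hzJ hzM X g).symm)
    (fun {d} g h1 h2 => ?_)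
  obtain ⟨k⟩ := (hs g).1 h1
  have hd : (⊥ : Sieve d) ∈ J d := by
    have := J.pullback_stable k hzJ
    rwa [Sieve.pullback_bot] at this
  obtain ⟨x, -, hx⟩ := existsUnique_of_empty_cover
    ((isSheaf_iff_isSheaf_of_type J _).1 X.property) hd
  exact (hx _ trivial).trans (hx _ trivial).symm

open MonoidalCategory CartesianMonoidalCategory in
variable (M) in
/-- The natural transformation `⊥ : 1 ⟶ L_M` that picks out the nowhere defined elements. -/
def sheafBot (hz : IsInitial z) (hzJ : (⊥ : Sieve z) ∈ J z) (hzM : ∀ c, M (hz.to c)) :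
    (Functor.const (Sheaf J (Type u))).obj (𝟙_ (Sheaf J (Type u))) ⟶
      (sheafLift M J).toFunctor where
  app X := ⟨
    { app c := TypeCat.ofHom fun _ => botElt hz hzJ hzM X c.unop
      naturality c d f := by
        ext _
        refine (botElt_unique hz hzJ hzM X
          (LiftElt.res f.unop (botElt hz hzJ hzM X c.unop)) fun g => ?_).symm
        rw [LiftElt.res_dom, MSub.pull_factors, botElt_factors] }⟩
  naturality X Y α := by
    ext c _
    refine (botElt_unique hz hzJ hzM Y
      (LiftElt.map α.hom (botElt hz hzJ hzM X c.unop)) fun g => ?_).symm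
    rw [LiftElt.map_dom, botElt_factors]

end Bottom

section Completeness

open MonoidalCategory CartesianMonoidalCategory

variable {D : Type*} [Category* D] [CartesianMonoidalCategory D] {L : D ⥤ D}
  (bot : (Functor.const D).obj (𝟙_ D) ⟶ L)

variable (L) in
/-- The objects `1, L1, LL1, …`. -/
def stage : ℕ → D
  | 0 => 𝟙_ D
  | n + 1 => L.obj (stage n)

/-- The maps of the sequence `1 ⟶ L1 ⟶ LL1 ⟶ …`: `⊥_1`, `L(⊥_1)`, `LL(⊥_1)`, …. -/
def stageUp : ∀ n, stage L n ⟶ stage L (n + 1)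
  | 0 => bot.app (𝟙_ D)
  | n + 1 => L.map (stageUp n)

variable (L) in
/-- The maps of the sequence `1 ⟵ L1 ⟵ LL1 ⟵ …`: `!`, `L!`, `LL!`, …. -/
def stageDown : ∀ n, stage L (n + 1) ⟶ stage L n
  | 0 => toUnit _
  | n + 1 => L.map (stageDown n)

/-- The object `ω`: the colimit of `1 ⟶ L1 ⟶ LL1 ⟶ …`. -/
abbrev omegaObj [HasColimitsOfShape ℕ D] : D := colimit (Functor.ofSequence (stageUp bot))

variable (L) in
/-- The object `ω̄`: the limit of `1 ⟵ L1 ⟵ LL1 ⟵ …`. -/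
abbrev omegaBarObj [HasLimitsOfShape ℕᵒᵖ D] : D := limit (Functor.ofOpSequence (stageDown L))

/-- The composites `L^n 1 ⟶ L^m 1` of the maps in the two sequences. -/
def stageMap : ∀ n m, stage L n ⟶ stage L m
  | 0, 0 => 𝟙 _
  | 0, m + 1 => bot.app (stage L m)
  | _ + 1, 0 => toUnit _
  | n + 1, m + 1 => L.map (stageMap n m)

theorem stageUp_stageMap : ∀ n m, stageUp bot n ≫ stageMap bot (n + 1) m = stageMap bot n m
  | 0, 0 => toUnit_unique _ _
  | _ + 1, 0 => toUnit_unique _ _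
  | 0, m + 1 => by
    have := bot.naturality (stageMap bot 0 m)
    simp only [Functor.const_obj_obj, Functor.const_obj_map, Category.id_comp] at this
    exact this.symm
  | n + 1, m + 1 => (L.map_comp _ _).symm.trans (congrArg L.map (stageUp_stageMap n m))

theorem stageMap_stageDown : ∀ n m, stageMap bot n (m + 1) ≫ stageDown L m = stageMap bot n m
  | 0, 0 => toUnit_unique _ _
  | _ + 1, 0 => toUnit_unique _ _
  | 0, m + 1 => by
    have := bot.naturality (stageDown L m)
    simp only [Functor.const_obj_obj, Functor.const_obj_map, Category.id_comp] at this
    exact this.symm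
  | n + 1, m + 1 => (L.map_comp _ _).symm.trans (congrArg L.map (stageMap_stageDown n m))

/-- The maps `L^n 1 ⟶ ω̄`. -/
def stageToOmegaBar [HasLimitsOfShape ℕᵒᵖ D] (n : ℕ) : stage L n ⟶ omegaBarObj L :=
  limit.lift (Functor.ofOpSequence (stageDown L))
    { pt := stage L n
      π := NatTrans.ofOpSequence (fun m => stageMap bot n m) (fun m => by
        refine (Category.id_comp _).trans ?_
        rw [Functor.ofOpSequence_map_homOfLE_succ]
        exact (stageMap_stageDown bot n m).symm) }

theorem stageUp_stageToOmegaBar [HasLimitsOfShape ℕᵒᵖ D] (n : ℕ) :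
    stageUp bot n ≫ stageToOmegaBar bot (n + 1) = stageToOmegaBar bot n := by
  refine limit.hom_ext fun m => ?_
  rw [Category.assoc, stageToOmegaBar, stageToOmegaBar, limit.lift_π, limit.lift_π]
  exact stageUp_stageMap bot n m.unop

/-- The comparison map `i : ω ⟶ ω̄`. -/
def omegaComparison [HasColimitsOfShape ℕ D] [HasLimitsOfShape ℕᵒᵖ D] :
    omegaObj bot ⟶ omegaBarObj L :=
  colimit.desc (Functor.ofSequence (stageUp bot))
    { pt := omegaBarObj L
      ι := NatTrans.ofSequence (fun n => stageToOmegaBar bot n) (fun n => by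
        rw [Functor.ofSequence_map_homOfLE_succ]
        exact (stageUp_stageToOmegaBar bot n).trans (Category.comp_id _).symm) }

/-- An object `X` is `L`-complete if it is right orthogonal to `i × A : ω × A ⟶ ω̄ × A` for
every object `A`. -/
def IsComplete [HasColimitsOfShape ℕ D] [HasLimitsOfShape ℕᵒᵖ D] (X : D) : Prop :=
  ∀ (A : D) (f : omegaObj bot ⊗ A ⟶ X),
    ∃! g : omegaBarObj L ⊗ A ⟶ X, (omegaComparison bot ▷ A) ≫ g = f

end Completeness

open OmegaCompletePartialOrder

/-- A concrete site: a small category with a terminal object `star` and an initial object `zero`,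
such that `C(star, -)` is faithful, together with a coverage `J` (the pullback axiom (C) for covering
families is part of `Coverage`) such that covering families contain all points (axiom (⋆)),
the initial object is covered by the empty family (axiom (0)), identities are covering (axiom (M)),
and covering families can be composed (axiom (L)). -/
structure ConcreteSite (C : Type u) [SmallCategory C] where
  star : C
  isTerminal : IsTerminal star
  zero : C
  isInitial : IsInitial zero
  faithful : ∀ {c d : C} (f g : c ⟶ d), (∀ x : star ⟶ c, x ≫ f = x ≫ g) → f = g
  J : Coverage C
  covers_points : ∀ {c : C} (T : Presieve c), T ∈ J c → ∀ x : star ⟶ c,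
    ∃ (d : C) (f : d ⟶ c) (y : star ⟶ d), T f ∧ y ≫ f = x
  empty_mem : (⊥ : Presieve zero) ∈ J zero
  id_mem : ∀ c : C, Presieve.singleton (𝟙 c) ∈ J c
  bind_mem : ∀ {c : C} (T : Presieve c) (R : ∀ ⦃d : C⦄ ⦃f : d ⟶ c⦄, T f → Presieve d),
    T ∈ J c → (∀ ⦃d : C⦄ ⦃f : d ⟶ c⦄ (hf : T f), R hf ∈ J d) → T.bind R ∈ J c

namespace ConcreteSite

variable {C : Type u} [SmallCategory C] (S : ConcreteSite C)

/-- The set of points `|c|`. -/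
abbrev Pts (c : C) : Type u := S.star ⟶ c

/-- The Grothendieck topology generated by the coverage. It has the same sheaves as the coverage,
see `CategoryTheory.Presieve.isSheaf_coverage`. -/
abbrev topology : GrothendieckTopology C := S.J.toGrothendieck

/-- The category of sheaves on a concrete site. -/
abbrev Sh := Sheaf S.topology (Type u)

theorem empty_mem_topology : (⊥ : Sieve S.zero) ∈ S.topology S.zero := by
  have := Coverage.Saturate.of (K := S.J) _ _ S.empty_mem
  rwa [show Sieve.generate (⊥ : Presieve S.zero) = ⊥ from Sieve.generate_bot] at this

/-- A sheaf is concrete if its elements over `c` are determined by their restrictions along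
the points of `c`. -/
def IsConcrete (X : S.Sh) : Prop :=
  ∀ c : C, Function.Injective
    (fun (s : X.obj.obj (op c)) (x : S.Pts c) => (X.obj.map x.op s : X.obj.obj (op S.star)))

/-- A class of admissible monos: a class of pre-admissible monos containing all maps `0 ⟶ c`,
such that the map from `Sub_M(c)` to subsets of `|c|` is order-reflecting (hence injective),
its image is closed under suprema of `ω`-chains, and for each increasing chain
`c_n ↣ c` with supremum `c_∞ ↣ c` the closure under precomposition of the set of the inclusions
`c_n ↣ c_∞` contains a covering family of `c_∞`. -/
class IsAdmissible (M : MorphismProperty C) : Prop extends PreAdmissible S.topology M where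
  zero_mem : ∀ c : C, M (S.isInitial.to c)
  le_of_points : ∀ {c : C} (P Q : MSub M c),
    (∀ x : S.Pts c, P.Factors x → Q.Factors x) → P.sub ≤ Q.sub
  exists_sup : ∀ {c : C} (P : ℕ → MSub M c), (∀ n, (P n).sub ≤ (P (n + 1)).sub) →
    ∃ Q : MSub M c, ∀ x : S.Pts c, Q.Factors x ↔ ∃ n, (P n).Factors x
  sup_cover : ∀ {c : C} (P : ℕ → MSub M c), (∀ n, (P n).sub ≤ (P (n + 1)).sub) →
    ∀ Q : MSub M c, (∀ x : S.Pts c, Q.Factors x ↔ ∃ n, (P n).Factors x) →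
      ∃ T ∈ S.J Q.obj, ∀ ⦃d : C⦄ ⦃f : d ⟶ Q.obj⦄, T f → ∃ n, (P n).Factors (f ≫ Q.arrow)

section

variable (M : MorphismProperty C) [S.IsAdmissible M]

/-- The lifting monad `L_M` on sheaves. -/
abbrev lift : Monad S.Sh := sheafLift M S.topology

/-- The point `⊥ : 1 ⟶ L_M` of the lifting monad. -/
abbrev bot := sheafBot (J := S.topology) M S.isInitial S.empty_mem_topology
  (IsAdmissible.zero_mem (S := S))

/-- `L_M`-complete sheaves. -/
abbrev IsLComplete (X : S.Sh) : Prop := IsComplete (S.bot M) X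

end

/-- The objects of the category `C + V₀`: those of `C` and the vertical natural numbers
`V = ω + 1`. The terminal and the initial object of `V₀` are identified with those of `C`. -/
inductive Comb (S : ConcreteSite C) : Type u
  | of (c : C) : Comb S
  | vert : Comb S

variable {S}

/-- The points of the objects of `C + V₀`. -/
def Comb.Pt : S.Comb → Type u
  | .of c => S.Pts c
  | .vert => ULift.{u} ℕ∞

/-- The functions on points that are maps of `C + V₀`: between objects of `C`, those given by maps
of `C`; from `V` to `V`, the continuous ones; otherwise, the constant ones. -/
def Comb.IsMap : ∀ a b : S.Comb, (a.Pt → b.Pt) → Prop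
  | .of c, .of d, f => ∃ h : c ⟶ d, ∀ x : S.Pts c, f x = x ≫ h
  | .vert, .vert, f => ωScottContinuous fun n : ℕ∞ => (f (ULift.up n)).down
  | .of _, .vert, f => ∃ y, ∀ x, f x = y
  | .vert, .of _, f => ∃ y, ∀ x, f x = y

theorem Comb.isMap_const (a b : S.Comb) (y : b.Pt) : Comb.IsMap a b fun _ => y := by
  cases a <;> cases b
  · refine ⟨S.isTerminal.from _ ≫ y, fun x => ?_⟩
    refine Eq.trans ?_ (Category.assoc _ _ _)
    rw [S.isTerminal.hom_ext (x ≫ _) (𝟙 _)]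
    exact (Category.id_comp _).symm
  · exact ⟨y, fun _ => rfl⟩
  · exact ⟨y, fun _ => rfl⟩
  · exact ωScottContinuous.const

theorem Comb.isMap_id (a : S.Comb) : Comb.IsMap a a fun x => x := by
  cases a
  · exact ⟨𝟙 _, fun x => (Category.comp_id x).symm⟩
  · exact ωScottContinuous.id

theorem Comb.isMap_comp {a b c : S.Comb} {f : a.Pt → b.Pt} {g : b.Pt → c.Pt}
    (hf : Comb.IsMap a b f) (hg : Comb.IsMap b c g) : Comb.IsMap a c fun x => g (f x) := by
  have h1 : (∃ y, ∀ x, f x = y) → Comb.IsMap a c fun x => g (f x) := by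
    rintro ⟨y, hy⟩
    simp only [hy]
    exact isMap_const _ _ _
  have h2 : (∃ y, ∀ x, g x = y) → Comb.IsMap a c fun x => g (f x) := by
    rintro ⟨y, hy⟩
    simp only [hy]
    exact isMap_const _ _ _
  rcases a with a | _ <;> rcases b with b | _ <;> rcases c with c | _
  · obtain ⟨h, hh⟩ := hf
    obtain ⟨k, hk⟩ := hg
    refine ⟨h ≫ k, fun x => ?_⟩
    change g (f x) = _
    rw [hh x, hk (x ≫ h)]
    exact Category.assoc _ _ _
  · exact h2 hg
  · exact h1 hf
  · exact h1 hf
  · exact h1 hf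
  · exact h1 hf
  · exact h2 hg
  · exact ωScottContinuous.comp (α := ℕ∞) (β := ℕ∞) (γ := ℕ∞)
      (g := fun n : ℕ∞ => (g (ULift.up n)).down) (f := fun n : ℕ∞ => (f (ULift.up n)).down) hg hf

instance : SmallCategory S.Comb where
  Hom a b := {f : a.Pt → b.Pt // Comb.IsMap a b f}
  id a := ⟨fun x => x, Comb.isMap_id a⟩
  comp f g := ⟨fun x => g.1 (f.1 x), Comb.isMap_comp f.2 g.2⟩

variable (S)

/-- The embedding of `C` in `C + V₀`. -/
def incl : C ⥤ S.Comb where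
  obj := Comb.of
  map h := ⟨fun x => x ≫ h, h, fun _ => rfl⟩
  map_id _ := Subtype.ext (funext fun x => Category.comp_id x)
  map_comp f g := Subtype.ext (funext fun x => (Category.assoc x f g).symm)

@[ext]
theorem Comb.hom_ext {S : ConcreteSite C} {a b : S.Comb} {f g : a ⟶ b}
    (h : ∀ x, f.1 x = g.1 x) : f = g := Subtype.ext (funext h)

/-- The constant maps of `C + V₀`. -/
def constMap {S : ConcreteSite C} (a : S.Comb) {b : S.Comb} (y : b.Pt) : a ⟶ b :=
  ⟨fun _ => y, Comb.isMap_const a b y⟩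

theorem isEmpty_pts_zero : IsEmpty (S.Pts S.zero) :=
  ⟨fun x => by obtain ⟨_, _, _, h, _⟩ := S.covers_points ⊥ S.empty_mem x; exact h⟩

/-- The covering families of `J ∪ J_V` on `C + V₀`: the objects of `C` have the covering families
of `J` (by axioms (M) and (0), these contain the families of `J_V` on the terminal and the initial
object), and `V` is covered by its identity. -/
def combCoverings : ∀ a : S.Comb, Set (Presieve a)
  | .of c => {T | ∃ R ∈ S.J c, T = R.map S.incl}
  | .vert => {Presieve.singleton (𝟙 _)}

theorem combCoverings_id (a : S.Comb) : Presieve.singleton (𝟙 a) ∈ S.combCoverings a := by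
  cases a with
  | of c => exact ⟨_, S.id_mem c, ((Presieve.map_singleton (F := S.incl) (𝟙 c)).trans
      (by rw [S.incl.map_id]; rfl)).symm⟩
  | vert => rfl

theorem combCoverings_points {a : S.Comb} {T : Presieve a} (hT : T ∈ S.combCoverings a)
    (x : a.Pt) : ∃ (b : S.Comb) (f : b ⟶ a) (y : b.Pt), T f ∧ f.1 y = x := by
  cases a with
  | of c =>
    obtain ⟨R, hR, rfl⟩ := hT
    obtain ⟨d, f, y, hf, hy⟩ := S.covers_points R hR x
    exact ⟨.of d, S.incl.map f, y, Presieve.map_map hf, hy⟩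
  | vert =>
    obtain rfl := hT
    exact ⟨_, 𝟙 _, x, ⟨⟩, rfl⟩

/-- The coverage `J ∪ J_V` on `C + V₀`. -/
def combCoverage : Coverage S.Comb where
  coverings := S.combCoverings
  pullback a b f T hT := by
    have const : (∃ y, ∀ x, f.1 x = y) → ∃ R ∈ S.combCoverings b, R.FactorsThruAlong T f := by
      rintro ⟨y, hy⟩
      obtain ⟨e, g, z, hg, hz⟩ := S.combCoverings_points hT y
      refine ⟨_, S.combCoverings_id b, ?_⟩
      rintro _ _ ⟨⟩
      refine ⟨e, constMap b z, g, hg, Comb.hom_ext fun x => ?_⟩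
      exact hz.trans (hy x).symm
    rcases a with c | _ <;> rcases b with d | _
    · obtain ⟨R, hR, rfl⟩ := hT
      obtain ⟨f, h, hf⟩ := f
      obtain ⟨Q, hQ, hQR⟩ := S.J.pullback h R hR
      refine ⟨Q.map S.incl, ⟨Q, hQ, rfl⟩, ?_⟩
      rintro _ _ ⟨hu⟩
      obtain ⟨e, i, k, hk, hik⟩ := hQR hu
      refine ⟨.of e, S.incl.map i, S.incl.map k, Presieve.map_map hk, ?_⟩
      refine (S.incl.map_comp i k).symm.trans ?_
      rw [hik, S.incl.map_comp]
      exact Comb.hom_ext fun x => (hf _).symm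
    · exact const f.2
    · exact const f.2
    · obtain rfl := hT
      refine ⟨_, S.combCoverings_id .vert, ?_⟩
      rintro _ _ ⟨⟩
      exact ⟨_, f, _, ⟨⟩, by simp⟩

/-- The concrete site `(C + V₀, J ∪ J_V)`. -/
def comb : ConcreteSite S.Comb where
  star := .of S.star
  isTerminal := IsTerminal.ofUniqueHom (fun a => constMap a (𝟙 S.star))
    (fun a m => Comb.hom_ext fun x => S.isTerminal.hom_ext _ _)
  zero := .of S.zero
  isInitial := IsInitial.ofUniqueHom
    (fun a => match a with
      | .of c => S.incl.map (S.isInitial.to c)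
      | .vert => constMap _ (ULift.up 0))
    (fun a m => Comb.hom_ext fun x => (S.isEmpty_pts_zero.false x).elim)
  faithful {a b} f g h := Comb.hom_ext fun x =>
    congrFun (congrArg Subtype.val (h (constMap _ x))) (𝟙 S.star)
  J := S.combCoverage
  covers_points {a} T hT x := by
    obtain ⟨b, f, y, hf, hy⟩ := S.combCoverings_points hT (x.1 (𝟙 S.star))
    refine ⟨b, f, constMap _ y, hf, Comb.hom_ext fun w => ?_⟩
    rw [S.isTerminal.hom_ext w (𝟙 S.star)]
    exact hy
  empty_mem := by
    refine ⟨⊥, S.empty_mem, ?_⟩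
    refine le_antisymm bot_le ?_
    rintro _ _ ⟨h⟩
    exact h
  id_mem := S.combCoverings_id
  bind_mem {a} T R hT hR := by
    cases a with
    | of c =>
      obtain ⟨Q, hQ, rfl⟩ := hT
      have key : ∀ (d : C) (f : d ⟶ c) (hf : Q f),
          ∃ P ∈ S.J d, R (Presieve.map_map (F := S.incl) hf) = P.map S.incl :=
        fun d f hf => hR (Presieve.map_map hf)
      choose P hP hPR using key
      refine ⟨Q.bind fun d f hf => P d f hf, S.bind_mem Q _ hQ fun d f hf => hP d f hf, ?_⟩
      refine le_antisymm ?_ ?_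
      · rintro b _ ⟨d, g, h, ⟨hh⟩, hg, rfl⟩
        rw [hPR _ _ hh] at hg
        obtain ⟨hu⟩ := hg
        have := Presieve.map_map (F := S.incl) (R := Q.bind fun d f hf => P d f hf)
          ⟨_, _, _, hh, hu, rfl⟩
        rw [S.incl.map_comp] at this
        exact this
      · rintro b _ ⟨d, g, h, hh, hg, rfl⟩
        rw [S.incl.map_comp]
        refine ⟨_, _, _, Presieve.map_map hh, ?_, rfl⟩
        rw [hPR _ _ hh]
        exact Presieve.map_map hg
    | vert =>
      obtain rfl := hT
      have h : R ⟨⟩ = Presieve.singleton (𝟙 _) := hR ⟨⟩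
      change _ = _
      refine le_antisymm ?_ ?_
      · rintro b _ ⟨d, g, h, ⟨⟩, hg, rfl⟩
        rw [h] at hg
        obtain ⟨⟩ := hg
        rw [Category.comp_id]
        exact ⟨⟩
      · rintro b _ ⟨⟩
        refine ⟨_, 𝟙 _, 𝟙 _, ⟨⟩, ?_, Category.comp_id _⟩
        rw [h]
        exact ⟨⟩

/-- The class `M ∪ M_V` of maps of `C + V₀`: the maps in `M` between objects of `C`, and the maps
`n + (-) : V ⟶ V` and `0 ⟶ V` (for each initial object `0` of `C`). -/
def combMonos (M : MorphismProperty C) : MorphismProperty S.Comb := fun a b f =>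
  match a, b, f with
  | .of _, .of _, f => ∃ m, M m ∧ f = S.incl.map m
  | .vert, .vert, f => ∃ n : ℕ, ∀ x : ℕ∞, f.1 (ULift.up x) = ULift.up (x + n)
  | .of c, .vert, _ => Nonempty (IsInitial c)
  | .vert, .of _, _ => False

end ConcreteSite

section WithBot

variable {α : Type u} [OmegaCompletePartialOrder α]

theorem exists_shift (c : Chain (WithBot α)) (h : ∃ n, c n ≠ ⊥) :
    ∃ (n : ℕ) (d : Chain α), ∀ k, c (n + k) = (d k : WithBot α) := by
  obtain ⟨n, hn⟩ := h
  have hk : ∀ k, c (n + k) ≠ ⊥ := fun k e =>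
    hn (le_bot_iff.1 (e ▸ c.monotone (Nat.le_add_right n k)))
  refine ⟨n, ⟨⟨fun k => (c (n + k)).unbot (hk k), fun i j hij => ?_⟩⟩, fun k => ?_⟩
  · rw [← WithBot.coe_le_coe, WithBot.coe_unbot, WithBot.coe_unbot]
    exact c.monotone (Nat.add_le_add_left hij n)
  · exact (WithBot.coe_unbot _ _).symm

open Classical in
/-- The `ω`cpo `α ⊎ {⊥}`. -/
instance : OmegaCompletePartialOrder (WithBot α) where
  ωSup c := if h : ∃ n, c n ≠ ⊥ then
    ((ωSup (exists_shift c h).choose_spec.choose : α) : WithBot α) else ⊥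
  le_ωSup c i := by
    split_ifs with h
    · have hs := (exists_shift c h).choose_spec.choose_spec
      refine (c.monotone (Nat.le_add_left i _)).trans ((hs i).le.trans ?_)
      exact WithBot.coe_le_coe.2 (le_ωSup _ i)
    · push Not at h
      exact (h i).le
  ωSup_le c x hx := by
    split_ifs with h
    · have hs := (exists_shift c h).choose_spec.choose_spec
      have hx' := fun k => (hs k) ▸ hx ((exists_shift c h).choose + k)
      cases x with
      | bot => exact absurd (hx' 0) (WithBot.not_coe_le_bot _)
      | coe x => exact WithBot.coe_le_coe.2 (ωSup_le _ _ fun k => WithBot.coe_le_coe.1 (hx' k))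
    · exact bot_le

theorem withBot_ωSup_coe (c : Chain (WithBot α)) (n : ℕ) (d : Chain α)
    (h : ∀ k, c (n + k) = (d k : WithBot α)) : ωSup c = ((ωSup d : α) : WithBot α) := by
  apply le_antisymm
  · refine ωSup_le _ _ fun k => ?_
    exact (c.monotone (Nat.le_add_left k n)).trans
      ((h k).le.trans (WithBot.coe_le_coe.2 (le_ωSup d k)))
  · have h0 : (d 0 : WithBot α) ≤ ωSup c := (h 0) ▸ le_ωSup c (n + 0)
    obtain ⟨y, hy⟩ := WithBot.ne_bot_iff_exists.1
      (fun e => WithBot.not_coe_le_bot (d 0) (e ▸ h0) : ωSup c ≠ ⊥)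
    rw [← hy, WithBot.coe_le_coe]
    refine ωSup_le _ _ fun k => WithBot.coe_le_coe.1 ?_
    rw [hy, ← h k]
    exact le_ωSup c _

theorem withBot_ωSup_ne_bot (c : Chain (WithBot α)) : ωSup c ≠ ⊥ ↔ ∃ n, c n ≠ ⊥ := by
  constructor
  · intro h
    by_contra hn
    push Not at hn
    exact h (le_bot_iff.1 (ωSup_le _ _ fun i => (hn i).le))
  · rintro ⟨n, hn⟩ h
    exact hn (le_bot_iff.1 (h ▸ le_ωSup c n))

theorem withBot_continuous {β : Type u} [OmegaCompletePartialOrder β] {f : WithBot α → β}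
    (hf : ωScottContinuous fun x : α => f x) (hb : ∀ x : α, f ⊥ ≤ f x) :
    ωScottContinuous f := by
  have hm : Monotone f := by
    intro x y hxy
    cases x with
    | bot => cases y with
      | bot => exact le_rfl
      | coe y => exact hb y
    | coe x => cases y with
      | bot => exact absurd hxy (WithBot.not_coe_le_bot _)
      | coe y => exact hf.monotone (WithBot.coe_le_coe.1 hxy)
  refine ωScottContinuous.of_monotone_map_ωSup ⟨hm, fun c => ?_⟩
  refine le_antisymm ?_ (ωSup_le _ _ fun i => hm (le_ωSup c i))
  by_cases h : ∃ n, c n ≠ ⊥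
  · obtain ⟨n, d, hd⟩ := exists_shift c h
    rw [withBot_ωSup_coe c n d hd]
    refine (hf.map_ωSup d).le.trans (ωSup_le _ _ fun k => ?_)
    refine le_trans ?_ (le_ωSup _ (n + k))
    exact (congrArg f (hd k)).ge
  · have h' : ωSup c = ⊥ := by
      by_contra h'
      exact h ((withBot_ωSup_ne_bot c).1 h')
    push Not at h
    rw [h']
    exact (congrArg f (h 0)).ge.trans (le_ωSup (c.map ⟨f, hm⟩) 0)

theorem withBot_coe_continuous : ωScottContinuous fun x : α => (x : WithBot α) :=
  ωScottContinuous.of_monotone_map_ωSup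
    ⟨fun _ _ h => WithBot.coe_le_coe.2 h, fun c =>
      (withBot_ωSup_coe (c.map ⟨_, fun _ _ h => WithBot.coe_le_coe.2 h⟩) 0 c
        (fun k => by rw [Nat.zero_add]; rfl)).symm⟩

end WithBot

/-- A concrete sheaf on a concrete site: a set `|X|` with, for each object `c`, a set `R^c_X` of
functions `|c| → |X|`, such that the constant functions are in `R^c_X`, and the relations are
closed under precomposition with maps of the site and under gluing along covering families. -/
structure ConcreteSheaf {C : Type u} [SmallCategory C] (S : ConcreteSite C) where
  carrier : Type u
  R : ∀ c : C, Set (S.Pts c → carrier)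
  const_mem : ∀ (c : C) (x : carrier), (fun _ => x) ∈ R c
  comp_mem : ∀ {c d : C} (h : d ⟶ c) {g : S.Pts c → carrier}, g ∈ R c →
    (fun x => g (x ≫ h)) ∈ R d
  glue_mem : ∀ {c : C} (T : Presieve c), T ∈ S.J c → ∀ g : S.Pts c → carrier,
    (∀ ⦃d : C⦄ ⦃f : d ⟶ c⦄, T f → (fun x => g (x ≫ f)) ∈ R d) → g ∈ R c

/-- An `ω`-concrete sheaf: a concrete sheaf `X` with an `ω`cpo structure on `|X|` such that each
`R^c_X` is closed under pointwise suprema of `ω`-chains. -/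
structure OmegaConc {C : Type u} [SmallCategory C] (S : ConcreteSite C) extends
    ConcreteSheaf S where
  [cpo : OmegaCompletePartialOrder carrier]
  sup_mem : ∀ {c : C} (s : Chain (S.Pts c → carrier)), (∀ n, s n ∈ R c) → ωSup s ∈ R c

namespace OmegaConc

variable {C : Type u} [SmallCategory C] {S : ConcreteSite C}

attribute [instance] cpo

/-- Morphisms of `ω`-concrete sheaves: continuous functions that preserve the relations. -/
structure Hom (X Y : OmegaConc S) : Type u where
  toFun : X.carrier → Y.carrier
  continuous : ωScottContinuous toFun
  map_mem : ∀ {c : C} {g : S.Pts c → X.carrier}, g ∈ X.R c → (fun x => toFun (g x)) ∈ Y.R c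

instance : Category (OmegaConc S) where
  Hom := Hom
  id X := ⟨fun x => x, ωScottContinuous.id, fun h => h⟩
  comp f g := ⟨fun x => g.toFun (f.toFun x), g.continuous.comp f.continuous,
    fun h => g.map_mem (f.map_mem h)⟩

@[ext]
theorem hom_ext {X Y : OmegaConc S} {f g : X ⟶ Y} (h : ∀ x, f.toFun x = g.toFun x) : f = g := by
  obtain ⟨f, _, _⟩ := f
  obtain ⟨g, _, _⟩ := g
  obtain rfl : f = g := funext h
  rfl

theorem ωSup_apply {ι : Type u} {α : Type u} [OmegaCompletePartialOrder α] (s : Chain (ι → α))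
    (x : ι) : ωSup s x = ωSup (s.map (Pi.evalOrderHom x)) := rfl

/-- The terminal `ω`-concrete sheaf. -/
def unit (S : ConcreteSite C) : OmegaConc S where
  carrier := PUnit
  cpo := { ωSup := fun _ => PUnit.unit, le_ωSup := fun _ _ => le_rfl, ωSup_le := fun _ _ _ => le_rfl }
  R _ := Set.univ
  const_mem _ _ := trivial
  comp_mem _ _ _ := trivial
  glue_mem _ _ _ _ := trivial
  sup_mem _ _ := trivial

/-- The product of two `ω`-concrete sheaves. -/
def prod (X Y : OmegaConc S) : OmegaConc S where
  carrier := X.carrier × Y.carrier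
  R c := {g | (fun x => (g x).1) ∈ X.R c ∧ (fun x => (g x).2) ∈ Y.R c}
  const_mem c x := ⟨X.const_mem c x.1, Y.const_mem c x.2⟩
  comp_mem h _ hg := ⟨X.comp_mem h hg.1, Y.comp_mem h hg.2⟩
  glue_mem T hT _ h := ⟨X.glue_mem T hT _ fun _ _ hf => (h hf).1,
    Y.glue_mem T hT _ fun _ _ hf => (h hf).2⟩
  sup_mem s hs := ⟨X.sup_mem (s.map ⟨fun g x => (g x).1, fun _ _ h x => (h x).1⟩)
      fun n => (hs n).1,
    Y.sup_mem (s.map ⟨fun g x => (g x).2, fun _ _ h x => (h x).2⟩) fun n => (hs n).2⟩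

section

variable {α β γ : Type u} [OmegaCompletePartialOrder α] [OmegaCompletePartialOrder β]
  [OmegaCompletePartialOrder γ]

theorem continuous_fst : ωScottContinuous fun p : α × β => p.1 :=
  ωScottContinuous.of_monotone_map_ωSup ⟨fun _ _ h => h.1, fun _ => rfl⟩

theorem continuous_snd : ωScottContinuous fun p : α × β => p.2 :=
  ωScottContinuous.of_monotone_map_ωSup ⟨fun _ _ h => h.2, fun _ => rfl⟩

theorem continuous_pair {f : γ → α} {g : γ → β} (hf : ωScottContinuous f)
    (hg : ωScottContinuous g) : ωScottContinuous fun x => (f x, g x) :=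
  ωScottContinuous.of_monotone_map_ωSup ⟨fun _ _ h => ⟨hf.monotone h, hg.monotone h⟩,
    fun c => Prod.ext (hf.map_ωSup c) (hg.map_ωSup c)⟩

/-- A pointwise supremum of continuous functions is continuous. -/
theorem continuous_ωSup (s : Chain (α → β)) (hs : ∀ n, ωScottContinuous (s n)) :
    ωScottContinuous (ωSup s) := by
  have hm : Monotone (ωSup s) := fun x y h => ωSup_le_ωSup_of_le fun n =>
    ⟨n, (hs n).monotone h⟩
  refine ωScottContinuous.of_monotone_map_ωSup ⟨hm, fun c => le_antisymm ?_
    (ωSup_le _ _ fun i => hm (le_ωSup c i))⟩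
  refine ωSup_le _ _ fun n => ?_
  change s n (ωSup c) ≤ _
  rw [(hs n).map_ωSup]
  refine ωSup_le _ _ fun i => ?_
  exact (le_ωSup s n (c i)).trans (le_ωSup (c.map ⟨ωSup s, hm⟩) i)

end

/-- The cartesian structure of the category of `ω`-concrete sheaves. -/
instance : CartesianMonoidalCategory (OmegaConc S) :=
  .ofChosenFiniteProducts
    ⟨asEmptyCone (unit S), IsTerminal.ofUniqueHom
      (fun _ => ⟨fun _ => PUnit.unit,
        ωScottContinuous.of_monotone_map_ωSup ⟨fun _ _ _ => le_rfl, fun _ => rfl⟩,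
        fun _ => trivial⟩) (fun _ _ => rfl)⟩
    (fun X Y => ⟨BinaryFan.mk (P := prod X Y)
      ⟨fun p => p.1, continuous_fst, fun h => h.1⟩ ⟨fun p => p.2, continuous_snd, fun h => h.2⟩,
      BinaryFan.isLimitMk
        (fun s => ⟨fun x => (s.fst.toFun x, s.snd.toFun x),
            continuous_pair s.fst.continuous s.snd.continuous,
          fun h => ⟨s.fst.map_mem h, s.snd.map_mem h⟩⟩)
        (fun _ => rfl) (fun _ => rfl)
        (fun _ _ h1 h2 => hom_ext fun x => Prod.ext
          (congrFun (congrArg Hom.toFun h1) x) (congrFun (congrArg Hom.toFun h2) x))⟩)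

instance (X Y : OmegaConc S) : PartialOrder (Hom X Y) :=
  PartialOrder.lift Hom.toFun (fun _ _ h => hom_ext (congrFun h))

/-- The pointwise supremum of a chain of morphisms. -/
def homSup {X Y : OmegaConc S} (s : Chain (Hom X Y)) : Hom X Y where
  toFun := ωSup (s.map ⟨Hom.toFun, fun _ _ h => h⟩)
  continuous := continuous_ωSup _ fun n => (s n).continuous
  map_mem {_ g} hg := Y.sup_mem (s.map ⟨fun f x => f.toFun (g x), fun _ _ h x => h (g x)⟩)
    fun n => (s n).map_mem hg

instance (X Y : OmegaConc S) : OmegaCompletePartialOrder (Hom X Y) where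
  ωSup := homSup
  le_ωSup c i := le_ωSup (c.map ⟨Hom.toFun, fun _ _ h => h⟩) i
  ωSup_le c x h := ωSup_le (c.map ⟨Hom.toFun, fun _ _ h => h⟩) x.toFun h

/-- The exponential of two `ω`-concrete sheaves. -/
def exp (X Y : OmegaConc S) : OmegaConc S where
  carrier := Hom X Y
  R c := {f | ∀ {d : C} (h : d ⟶ c) (g : S.Pts d → X.carrier), g ∈ X.R d →
    (fun x => (f (x ≫ h)).toFun (g x)) ∈ Y.R d}
  const_mem c f d h g hg := f.map_mem hg
  comp_mem h f hf e k g hg := by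
    have := hf (k ≫ h) g hg
    simpa only [Category.assoc] using! this
  glue_mem {c} T hT f hf d h g hg := by
    obtain ⟨Q, hQ, hQT⟩ := S.J.pullback h T hT
    refine Y.glue_mem Q hQ _ fun e k hk => ?_
    obtain ⟨b, i, l, hl, hil⟩ := hQT hk
    have := hf hl i _ (X.comp_mem k hg)
    simpa only [Category.assoc, hil] using! this
  sup_mem s hs _ h g hg := Y.sup_mem
    (s.map ⟨fun f x => (f (x ≫ h)).toFun (g x), fun _ _ l x => l _ _⟩) fun n => hs n h g hg

section

variable {X Y Z : OmegaConc S}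

/-- Currying. -/
def curry (f : Hom (prod X Y) Z) : Hom Y (exp X Z) where
  toFun y :=
    { toFun := fun x => f.toFun (x, y)
      continuous := f.continuous.comp (continuous_pair ωScottContinuous.id ωScottContinuous.const)
      map_mem := fun h => f.map_mem ⟨h, Y.const_mem _ y⟩ }
  continuous := by
    refine ωScottContinuous.of_monotone_map_ωSup
      ⟨fun a b h x => f.continuous.monotone (Prod.mk_le_mk.2 ⟨le_rfl, h⟩), fun c => ?_⟩
    refine hom_ext fun x => ?_
    have : ωScottContinuous fun y => f.toFun (x, y) :=
      f.continuous.comp (continuous_pair ωScottContinuous.const ωScottContinuous.id)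
    exact this.map_ωSup c
  map_mem hg _ h k hk := f.map_mem ⟨hk, Y.comp_mem h hg⟩

/-- Uncurrying. -/
def uncurry (f : Hom Y (exp X Z)) : Hom (prod X Y) Z where
  toFun p := (f.toFun p.2).toFun p.1
  continuous := by
    have hm : Monotone fun p : (prod X Y).carrier => (f.toFun p.2).toFun p.1 := fun p q h =>
      ((f.toFun p.2).continuous.monotone h.1).trans (f.continuous.monotone h.2 q.1)
    refine ωScottContinuous.of_monotone_map_ωSup ⟨hm, fun c => le_antisymm ?_
      (ωSup_le _ _ fun i => hm (le_ωSup c i))⟩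
    change (f.toFun (ωSup (c.map OrderHom.snd))).toFun (ωSup (c.map OrderHom.fst)) ≤ _
    rw [f.continuous.map_ωSup]
    refine ωSup_le _ _ fun n => ?_
    change (f.toFun (c n).2).toFun _ ≤ _
    rw [(f.toFun (c n).2).continuous.map_ωSup]
    refine ωSup_le _ _ fun i => ?_
    refine le_trans ?_ (le_ωSup _ (max n i))
    exact ((f.toFun (c n).2).continuous.monotone (c.monotone (le_max_right n i)).1).trans
      (f.continuous.monotone (c.monotone (le_max_left n i)).2 _)
  map_mem {c g} hg := by
    have := f.map_mem hg.2 (𝟙 c) (fun x => (g x).1) hg.1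
    simpa only [Category.comp_id] using! this

end

open MonoidalCategory in
/-- The category of `ω`-concrete sheaves is cartesian closed. -/
instance : MonoidalClosed (OmegaConc S) where
  closed X :=
    { rightAdj :=
        { obj := exp X
          map f :=
            { toFun := fun h => h ≫ f
              continuous := by
                refine ωScottContinuous.of_monotone_map_ωSup
                  ⟨fun a b h x => f.continuous.monotone (h x), fun c => hom_ext fun x => ?_⟩
                exact f.continuous.map_ωSup
                  (c.map ⟨fun h => h.toFun x, fun _ _ h => h x⟩)
              map_mem := fun hg _ h k hk => f.map_mem (hg h k hk) } }
      adj := Adjunction.mkOfHomEquiv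
        { homEquiv := fun Y Z =>
            { toFun := fun f => curry (X := X) (Y := Y) f
              invFun := fun f => uncurry (X := X) (Y := Y) f
              left_inv := fun _ => rfl
              right_inv := fun _ => rfl } } }

end OmegaConc

namespace OmegaConc

variable {C : Type u} [SmallCategory C] {S : ConcreteSite C} (M : MorphismProperty C)

/-- The relations of `L_M(X)`: a function `|c| → |X| ⊎ {⊥}` is in `R^c` if there is a map
`c' ↣ c` in `M` whose points are the ones where the function is not `⊥`, and the restriction of
the function to `c'` is in the relation of `X`. -/
def liftR (X : OmegaConc S) (c : C) : Set (S.Pts c → WithBot X.carrier) :=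
  {g | ∃ (c' : C) (m : c' ⟶ c), M m ∧ (∀ x : S.Pts c, g x ≠ ⊥ ↔ ∃ y : S.Pts c', y ≫ m = x) ∧
    ∃ g' ∈ X.R c', ∀ y : S.Pts c', g (y ≫ m) = (g' y : WithBot X.carrier)}

variable {M} {X Y : OmegaConc S}

theorem liftR_mk {c : C} {g : S.Pts c → WithBot X.carrier} (P : MSub M c)
    (hP : ∀ x : S.Pts c, P.Factors x ↔ g x ≠ ⊥) (g' : S.Pts P.obj → X.carrier)
    (hg' : g' ∈ X.R P.obj) (h : ∀ y, g (y ≫ P.arrow) = (g' y : WithBot X.carrier)) :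
    g ∈ liftR M X c := by
  refine ⟨_, P.arrow, P.mem, fun x => (hP x).symm.trans ⟨fun hx => ?_, ?_⟩, g', hg', h⟩
  · exact ⟨P.factorThru x hx, Subobject.factorThru_arrow _ _ _⟩
  · rintro ⟨y, rfl⟩
    exact Subobject.factors_comp_arrow _

theorem liftR_map (f : Hom X Y) {c : C} {g : S.Pts c → WithBot X.carrier}
    (hg : g ∈ liftR M X c) : (fun x => WithBot.map f.toFun (g x)) ∈ liftR M Y c := by
  obtain ⟨c', m, hm, h, g', hg', h'⟩ := hg
  refine ⟨c', m, hm, fun x => ?_, _, f.map_mem hg', fun y => ?_⟩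
  · rw [← h x, ne_eq, ne_eq, WithBot.map_eq_bot_iff]
  · change WithBot.map f.toFun (g (y ≫ m)) = _
    rw [h' y, WithBot.map_coe]

variable [S.IsAdmissible M]

theorem liftR_dom {c : C} {g : S.Pts c → WithBot X.carrier} (hg : g ∈ liftR M X c) :
    ∃ P : MSub M c, ∀ x : S.Pts c, P.Factors x ↔ g x ≠ ⊥ := by
  obtain ⟨c', m, hm, h, -⟩ := hg
  exact ⟨MSub.mk' m hm, fun x => (MSub.mk'_factors m hm x).trans (h x).symm⟩

theorem liftR_total {c d : C} {g : S.Pts c → WithBot X.carrier} (hg : g ∈ liftR M X c)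
    (h : d ⟶ c) (hh : ∀ x : S.Pts d, g (x ≫ h) ≠ ⊥) :
    ∃ k ∈ X.R d, ∀ x : S.Pts d, g (x ≫ h) = (k x : WithBot X.carrier) := by
  obtain ⟨c', m, hm, h1, g', hg', h2⟩ := hg
  have h3 : (MSub.mk' (M := M) (𝟙 d) (StableMonos.iso _ inferInstance)).sub ≤
      (MSub.pull h (MSub.mk' m hm)).sub := by
    refine ConcreteSite.IsAdmissible.le_of_points (S := S) _ _ fun x _ => ?_
    rw [MSub.pull_factors, MSub.mk'_factors]
    exact (h1 _).1 (hh x)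
  have h4 : (MSub.mk' m hm).Factors h := by
    have := Subobject.factors_of_le (𝟙 d) h3 ((MSub.mk'_factors _ _ _).2 ⟨𝟙 d, by simp⟩)
    have h5 := (MSub.pull_factors h (MSub.mk' m hm) (𝟙 d)).1 this
    rwa [Category.id_comp] at h5
  obtain ⟨k, rfl⟩ := (MSub.mk'_factors _ _ _).1 h4
  refine ⟨_, X.comp_mem k hg', fun x => ?_⟩
  rw [← h2, Category.assoc]

theorem liftR_coe {c : C} {g : S.Pts c → X.carrier} (hg : g ∈ X.R c) :
    (fun x => (g x : WithBot X.carrier)) ∈ liftR M X c :=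
  ⟨c, 𝟙 c, StableMonos.iso _ inferInstance,
    fun x => iff_of_true (WithBot.coe_ne_bot) ⟨x, Category.comp_id x⟩, g, hg,
    fun y => by rw [Category.comp_id]⟩

theorem liftR_glue {c : C} (T : Presieve c) (hT : T ∈ S.J c) (g : S.Pts c → WithBot X.carrier)
    (h : ∀ ⦃d : C⦄ ⦃f : d ⟶ c⦄, T f → (fun x => g (x ≫ f)) ∈ liftR M X d) :
    g ∈ liftR M X c := by
  have h1 := fun (d : C) (f : d ⟶ c) (hf : T f) => liftR_dom (h hf)
  choose D hD using h1
  have hs := (Presieve.isSheaf_coverage S.J (dominance M)).1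
    (PreAdmissible.isSheaf (J := S.topology)) T hT
  let F : Presieve.FamilyOfElements (dominance M) T := fun d f hf => D d f hf
  have hF : F.Compatible := by
    intro d₁ d₂ e g₁ g₂ f₁ f₂ hf₁ hf₂ e
    change MSub.pull g₁ (D d₁ f₁ hf₁) = MSub.pull g₂ (D d₂ f₂ hf₂)
    have key : ∀ x : S.Pts _, (MSub.pull g₁ (D d₁ f₁ hf₁)).Factors x ↔
        (MSub.pull g₂ (D d₂ f₂ hf₂)).Factors x := by
      intro x
      rw [MSub.pull_factors, MSub.pull_factors, hD, hD, Category.assoc, Category.assoc, e]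
    have h2 := le_antisymm (ConcreteSite.IsAdmissible.le_of_points (S := S) _ _
      fun x => (key x).1) (ConcreteSite.IsAdmissible.le_of_points (S := S) _ _ fun x => (key x).2)
    exact MSub.ext' fun y => by rw [MSub.Factors, MSub.Factors, h2]
  obtain ⟨P, hP, -⟩ := hs F hF
  change MSub M c at P
  have hP' : ∀ {d : C} (f : d ⟶ c) (hf : T f), MSub.pull f P = D d f hf := fun f hf => hP f hf
  have hPg : ∀ x : S.Pts c, P.Factors x ↔ g x ≠ ⊥ := by
    intro x
    obtain ⟨d, f, y, hf, rfl⟩ := S.covers_points T hT x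
    rw [← hD d f hf, ← hP' f hf, MSub.pull_factors]
  have hne : ∀ y : S.Pts P.obj, g (y ≫ P.arrow) ≠ ⊥ := fun y =>
    (hPg _).1 (Subobject.factors_comp_arrow _)
  refine liftR_mk P hPg (fun y => (g (y ≫ P.arrow)).unbot (hne y)) ?_
    (fun y => (WithBot.coe_unbot _ _).symm)
  obtain ⟨Q, hQ, hQT⟩ := S.J.pullback P.arrow T hT
  refine X.glue_mem Q hQ _ fun e k hk => ?_
  obtain ⟨b, i, l, hl, hil⟩ := hQT hk
  have e1 : ∀ x : S.Pts e, (x ≫ i) ≫ l = (x ≫ k) ≫ P.arrow := fun x => by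
    rw [Category.assoc, hil, Category.assoc]
  obtain ⟨r, hr, hr'⟩ := liftR_total (h hl) i fun x => by rw [e1]; exact hne _
  convert hr using 2 with x
  rw [WithBot.unbot_eq_iff, ← hr' x]
  rw [e1]

theorem liftR_sup {c : C} (s : Chain (S.Pts c → WithBot X.carrier))
    (hs : ∀ n, s n ∈ liftR M X c) : ωSup s ∈ liftR M X c := by
  choose D hD using fun n => liftR_dom (hs n)
  have hne : ∀ (x : S.Pts c) {n k : ℕ}, n ≤ k → s n x ≠ ⊥ → s k x ≠ ⊥ := fun x n k hnk h e =>
    h (le_bot_iff.1 (e ▸ s.monotone hnk x))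
  have hmono : ∀ n, (D n).sub ≤ (D (n + 1)).sub := fun n =>
    ConcreteSite.IsAdmissible.le_of_points (S := S) _ _ fun x hx =>
      (hD (n + 1) x).2 (hne x (Nat.le_succ n) ((hD n x).1 hx))
  obtain ⟨Q, hQ⟩ := ConcreteSite.IsAdmissible.exists_sup (S := S) D hmono
  have hQs : ∀ x : S.Pts c, Q.Factors x ↔ ωSup s x ≠ ⊥ := fun x =>
    (hQ x).trans ((exists_congr fun n => hD n x).trans
      (withBot_ωSup_ne_bot (s.map (Pi.evalOrderHom x))).symm)
  have hne' : ∀ y : S.Pts Q.obj, ωSup s (y ≫ Q.arrow) ≠ ⊥ := fun y =>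
    (hQs _).1 (Subobject.factors_comp_arrow _)
  refine liftR_mk Q hQs (fun y => (ωSup s (y ≫ Q.arrow)).unbot (hne' y)) ?_
    (fun y => (WithBot.coe_unbot _ _).symm)
  obtain ⟨T, hT, hT'⟩ := ConcreteSite.IsAdmissible.sup_cover (S := S) D hmono Q hQ
  refine X.glue_mem T hT _ fun d f hf => ?_
  obtain ⟨n, hn⟩ := hT' hf
  have hn' : ∀ (k : ℕ) (x : S.Pts d), s (n + k) (x ≫ f ≫ Q.arrow) ≠ ⊥ := fun k x =>
    hne _ (Nat.le_add_right n k) ((hD n _).1 (Subobject.factors_of_factors_right x hn))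
  choose r hr hr' using fun k => liftR_total (hs (n + k)) (f ≫ Q.arrow) (hn' k)
  have hrm : Monotone r := fun i j hij x => by
    rw [← WithBot.coe_le_coe, ← hr', ← hr']
    exact s.monotone (Nat.add_le_add_left hij n) _
  convert X.sup_mem ⟨r, hrm⟩ hr using 2 with x
  rw [WithBot.unbot_eq_iff]
  refine Eq.trans ?_ (withBot_ωSup_coe (s.map (Pi.evalOrderHom (x ≫ f ≫ Q.arrow))) n _
    fun k => hr' k x)
  rw [Category.assoc]
  rfl

variable (M) in
/-- The `ω`-concrete sheaf `L_M(X)`, with underlying `ω`cpo `|X| ⊎ {⊥}`. -/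
def liftObj (X : OmegaConc S) : OmegaConc S where
  carrier := WithBot X.carrier
  R := liftR M X
  const_mem c x := by
    cases x with
    | bot =>
      have h0 := S.isEmpty_pts_zero
      exact ⟨S.zero, S.isInitial.to c, ConcreteSite.IsAdmissible.zero_mem c,
        fun x => iff_of_false (fun h => h rfl) fun ⟨y, _⟩ => h0.false y,
        fun y => (h0.false y).elim, X.glue_mem ⊥ S.empty_mem _ fun _ _ h => h.elim,
        fun y => (h0.false y).elim⟩
    | coe x => exact liftR_coe (X.const_mem c x)
  comp_mem {c d} h g hg := by
    obtain ⟨P, hP⟩ := liftR_dom hg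
    have hP' : ∀ x : S.Pts d, (MSub.pull h P).Factors x ↔ g (x ≫ h) ≠ ⊥ := fun x =>
      (MSub.pull_factors h P x).trans (hP _)
    obtain ⟨k, hk, hk'⟩ := liftR_total hg ((MSub.pull h P).arrow ≫ h) fun y => by
      rw [← Category.assoc]
      exact (hP' _).1 (Subobject.factors_comp_arrow _)
    exact liftR_mk _ hP' k hk fun y => by rw [← hk' y, Category.assoc]
  glue_mem := liftR_glue
  sup_mem := liftR_sup

theorem withBot_map_continuous {α β : Type u} [OmegaCompletePartialOrder α]
    [OmegaCompletePartialOrder β] {f : α → β} (hf : ωScottContinuous f) :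
    ωScottContinuous (WithBot.map f) :=
  withBot_continuous (withBot_coe_continuous.comp hf) fun _ => bot_le

/-- The multiplication `(α ⊎ {⊥}) ⊎ {⊥} → α ⊎ {⊥}`. -/
def joinFun (α : Type u) : WithBot (WithBot α) → WithBot α := fun x => x.unbotD ⊥

theorem joinFun_continuous {α : Type u} [OmegaCompletePartialOrder α] :
    ωScottContinuous (joinFun α) :=
  withBot_continuous (f := joinFun α) ωScottContinuous.id fun _ => bot_le

theorem liftR_join {c : C} {g : S.Pts c → WithBot (WithBot X.carrier)}
    (hg : g ∈ liftR M (liftObj M X) c) : (fun x => joinFun X.carrier (g x)) ∈ liftR M X c := by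
  obtain ⟨c', m, hm, h, g', ⟨c'', m', hm', k, g'', hg'', k'⟩, h'⟩ := hg
  change S.Pts c' → WithBot X.carrier at g'
  change ∀ y, g (y ≫ m) = ((g' y : WithBot X.carrier) : WithBot (WithBot X.carrier)) at h'
  have e : ∀ y, joinFun X.carrier (g (y ≫ m)) = g' y := fun y => by rw [h' y]; rfl
  refine ⟨c'', m' ≫ m, StableMonos.comp _ _ hm' hm, fun x => ⟨fun hx => ?_, ?_⟩, g'', hg'',
    fun y => ?_⟩
  · change joinFun X.carrier (g x) ≠ ⊥ at hx
    obtain ⟨y, rfl⟩ := (h x).1 fun e => hx (by rw [e]; rfl)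
    rw [e y] at hx
    obtain ⟨z, rfl⟩ := (k y).1 hx
    exact ⟨z, (Category.assoc _ _ _).symm⟩
  · rintro ⟨z, rfl⟩
    change joinFun X.carrier (g _) ≠ ⊥
    rw [← Category.assoc, e, k' z]
    exact WithBot.coe_ne_bot
  · change joinFun X.carrier (g _) = _
    rw [← Category.assoc, e, k' y]

variable (M S) in
/-- The lifting monad `L_M` on `ω`-concrete sheaves. -/
def lift : Monad (OmegaConc S) where
  obj X := liftObj M X
  map f := ⟨WithBot.map f.toFun, withBot_map_continuous f.continuous, liftR_map f⟩
  map_id X := hom_ext fun x => congrFun WithBot.map_id (x : WithBot X.carrier)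
  map_comp f g := hom_ext fun x => (WithBot.map_map g.toFun f.toFun x).symm
  η :=
    { app X := (⟨fun x => (x : WithBot X.carrier), withBot_coe_continuous, liftR_coe⟩ :
        Hom X (liftObj M X))
      naturality _ _ _ := rfl }
  μ :=
    { app X := ⟨joinFun X.carrier, joinFun_continuous, liftR_join⟩
      naturality X Y f := hom_ext fun (x : WithBot (WithBot X.carrier)) => by
        cases x <;> rfl }
  assoc X := hom_ext fun (x : WithBot (WithBot (WithBot X.carrier))) => by
    cases x <;> rfl
  left_unit X := rfl
  right_unit X := hom_ext fun (x : WithBot X.carrier) => by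
    cases x <;> rfl

end OmegaConc

/-- The category of sheaves is cartesian closed. -/
instance {C : Type u} [SmallCategory C] (S : ConcreteSite C) :
    @MonoidalClosed S.Sh _ (@SemiCartesianMonoidalCategory.toMonoidalCategory S.Sh _ _) :=
  inferInstanceAs (MonoidalClosed (Sheaf S.topology (Type u)))

/-- A functor `F` commutes with the monads `T` and `T'`: there is a natural isomorphism
`F T ≅ T' F` that is compatible with the units and the multiplications. -/
def CommutesWithMonads {A B : Type*} [Category* A] [Category* B] (F : A ⥤ B) (T : Monad A)
    (T' : Monad B) : Prop :=
  ∃ e : T.toFunctor ⋙ F ≅ F ⋙ T'.toFunctor,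
    (∀ X : A, F.map (T.η.app X) ≫ e.hom.app X = T'.η.app (F.obj X)) ∧
    (∀ X : A, F.map (T.μ.app X) ≫ e.hom.app X =
      e.hom.app (T.obj X) ≫ T'.map (e.hom.app X) ≫ T'.μ.app (F.obj X))

end OmegaSheaf

end

/-!
A concrete sheaf is a set with, for each object `c`, a set of functions on the points of `c`, and a
map from any sheaf `Z` into it is a function on the global elements of `Z`. The sheaf `F X` on the
combined site is given in this way by the relations of `X` on the objects of `C` and by the
`ω`-continuous functions `ω + 1 → |X|` on `V`. A function that composes with continuous functions
out of `ω + 1` to continuous ones is continuous, so `F` is full and faithful, and limits,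
coproducts and exponentials are computed on underlying sets. A map in `M` is determined by the set
of points that factor through it; on `V` these sets are `∅` and the tails `{n, n + 1, …}`, which
are the domains of definition of continuous partial functions, so `F` commutes with lifting.

For completeness, the `n`-fold partial elements over `V` with domains shrinking by one point at
each level form a generic element of `ω̄` over `V`. Every global element of `ω̄` is the value of the
generic element at a point of `V`, and those at the finite points come from `ω`. So a map
`ω̄ × A → F X` is determined by its composite with `i × 1`, by continuity along `V`, and a map
`ω × A → F X` extends to the supremum of its composites with `ω̄ × A → L^n 1 × A → ω × A`.
-/

noncomputable section

namespace OmegaSheaf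

open OmegaCompletePartialOrder

/-! ### Continuous functions on `ω + 1` -/

section FiniteValues

variable {α β : Type*} [OmegaCompletePartialOrder α] [OmegaCompletePartialOrder β]

/-- The chain `f 0 ≤ f 1 ≤ …` of the values of a monotone function at the finite numbers; its
supremum is what a continuous function takes at `⊤`. -/
def finiteValues (f : ℕ∞ → α) (hf : Monotone f) : Chain α :=
  ⟨fun n => f n, fun _ _ h => hf (Nat.cast_le.2 h)⟩

theorem enat_eq_zero_or_exists_eq_add_one (k : ℕ∞) : k = 0 ∨ ∃ j, k = j + 1 :=
  (eq_or_ne k 0).imp_right fun h => le_iff_exists_add'.1 (Order.one_le_iff_ne_zero.2 h)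

theorem ωSup_finiteValues_id : ωSup (finiteValues (id : ℕ∞ → ℕ∞) monotone_id) = ⊤ :=
  ENat.eq_top_iff_forall_ge.2 (le_ωSup (finiteValues id monotone_id))

theorem ωSup_enat_eq_top_or_mem_range (c : Chain ℕ∞) : ωSup c = ⊤ ∨ ωSup c ∈ Set.range c :=
  or_iff_not_imp_left.2 fun h =>
    (ENat.exists_eq_iSup_of_lt_top (f := c) (lt_top_iff_ne_top.2 h))

theorem ωScottContinuous_enat_iff {f : ℕ∞ → α} (hf : Monotone f) :
    ωScottContinuous f ↔ f ⊤ ≤ ωSup (finiteValues f hf) := by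
  refine ⟨fun h => ?_, fun h => .of_monotone_map_ωSup ⟨hf, fun c => le_antisymm ?_
    (ωSup_le _ _ fun i => hf (le_ωSup c i))⟩⟩
  · rw [← ωSup_finiteValues_id]
    exact (h.map_ωSup _).le
  · rcases ωSup_enat_eq_top_or_mem_range c with htop | ⟨i, hi⟩
    · rw [htop]
      refine h.trans (ωSup_le _ _ fun n => ?_)
      obtain ⟨i, hi⟩ : ∃ i, (n : ℕ∞) < c i :=
        lt_iSup_iff.1 ((ENat.natCast_lt_top n).trans_eq htop.symm)
      exact le_ωSup_of_le i (hf hi.le)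
    · exact hi ▸ le_ωSup (c.map ⟨f, hf⟩) i

theorem ωScottContinuous_enat_ext {f g : ℕ∞ → α} (hf : ωScottContinuous f)
    (hg : ωScottContinuous g) (h : ∀ n : ℕ, f n = g n) : f = g := by
  have map_top {f : ℕ∞ → α} (hf : ωScottContinuous f) :
      f ⊤ = ωSup (finiteValues f hf.monotone) :=
    ((ωScottContinuous_enat_iff hf.monotone).1 hf).antisymm
      (ωSup_le _ _ fun _ => hf.monotone le_top)
  ext x
  induction x with
  | top => exact (map_top hf).trans ((congrArg ωSup (Chain.ext (funext h))).trans (map_top hg).symm)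
  | coe n => exact h n

theorem ωSup_prop_iff (c : Chain Prop) : ωSup c ↔ ∃ n, c n :=
  ⟨ωSup_le c _ fun n h => ⟨n, h⟩, fun ⟨n, h⟩ => le_ωSup c n h⟩

theorem ωScottContinuous_mem_enat_iff {U : Set ℕ∞} :
    ωScottContinuous (fun x : ℕ∞ => x ∈ U) ↔ U = ∅ ∨ ∃ n : ℕ, U = Set.Ici (n : ℕ∞) := by
  classical
  constructor
  · refine fun hU => or_iff_not_imp_left.2 fun hne => ?_
    obtain ⟨x, hx⟩ := Set.nonempty_iff_ne_empty.2 hne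
    have hfin : ∃ n : ℕ, (n : ℕ∞) ∈ U := (ωSup_prop_iff _).1
      ((ωScottContinuous_enat_iff hU.monotone).1 hU (hU.monotone (le_top (a := x)) hx))
    refine ⟨Nat.find hfin, Set.ext fun y => ⟨fun hy => ?_, fun hy =>
      hU.monotone hy (Nat.find_spec hfin)⟩⟩
    induction y with
    | top => exact Set.mem_Ici.2 le_top
    | coe y => exact Set.mem_Ici.2 (Nat.cast_le.2 (Nat.find_min' hfin hy))
  · rintro (rfl | ⟨n, rfl⟩)
    · exact ωScottContinuous.const
    · have hmono : Monotone fun x : ℕ∞ => x ∈ Set.Ici (n : ℕ∞) := fun _ _ h hx =>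
        Set.mem_Ici.2 ((Set.mem_Ici.1 hx).trans h)
      exact (ωScottContinuous_enat_iff hmono).2 fun _ =>
        (ωSup_prop_iff _).2 ⟨n, Set.self_mem_Ici (a := (n : ℕ∞))⟩

theorem ωScottContinuous_enat_enat_iff {f : ℕ∞ → ℕ∞} (hf : Monotone f) :
    ωScottContinuous f ↔ ∀ k : ℕ, k ≤ f ⊤ → ∃ n : ℕ, k ≤ f n := by
  refine (ωScottContinuous_enat_iff hf).trans ⟨fun h k hk => ?_, fun h =>
    ENat.forall_natCast_le_iff_le.1 fun k hk => ?_⟩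
  · rcases ωSup_enat_eq_top_or_mem_range (finiteValues f hf) with htop | ⟨n, hn⟩
    · obtain ⟨n, hn⟩ : ∃ n : ℕ, (k : ℕ∞) < f n :=
        lt_iSup_iff.1 ((ENat.natCast_lt_top k).trans_eq htop.symm)
      exact ⟨n, hn.le⟩
    · exact ⟨n, (hk.trans h).trans_eq hn.symm⟩
  · obtain ⟨n, hn⟩ := h k hk
    exact le_ωSup_of_le n hn

/-- The extension of a chain to `ω + 1` by its supremum. -/
def extendChain (s : Chain α) : ℕ∞ → α := ENat.recTopCoe (ωSup s) s

theorem extendChain_continuous (s : Chain α) : ωScottContinuous (extendChain s) := by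
  have hs : Monotone (extendChain s) := by
    intro x y h
    induction y with
    | top => induction x with
      | top => exact le_rfl
      | coe x => exact le_ωSup s x
    | coe y =>
      lift x to ℕ using ne_top_of_le_ne_top (ENat.natCast_ne_top y) h
      exact s.monotone (Nat.cast_le.1 h)
  exact (ωScottContinuous_enat_iff hs).2 (ωSup_le _ _ (le_ωSup (finiteValues _ hs)))

theorem ωScottContinuous_of_comp_enat {g : α → β}
    (h : ∀ f : ℕ∞ → α, ωScottContinuous f → ωScottContinuous fun n => g (f n)) :
    ωScottContinuous g := by
  refine .of_monotone_map_ωSup ⟨fun x y hxy => ?_, fun s => ?_⟩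
  · exact (h _ (extendChain_continuous ⟨fun n => if n = 0 then x else y,
      monotone_nat_of_le_succ fun n => by split_ifs <;> simp_all⟩)).monotone
      (Nat.cast_le.2 zero_le_one : ((0 : ℕ) : ℕ∞) ≤ (1 : ℕ))
  · have hs := h _ (extendChain_continuous s)
    exact le_antisymm ((ωScottContinuous_enat_iff hs.monotone).1 hs)
      (ωSup_le _ _ fun n => hs.monotone (le_top (a := (n : ℕ∞))))

theorem ωScottContinuous_enat_add (n : ℕ) : ωScottContinuous fun x : ℕ∞ => x + n :=
  (ωScottContinuous_enat_enat_iff fun _ _ h => add_le_add_left h _).2 fun k _ =>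
    ⟨k, le_self_add⟩

theorem ωScottContinuous_enat_sub (n : ℕ) : ωScottContinuous fun x : ℕ∞ => x - n :=
  (ωScottContinuous_enat_enat_iff fun _ _ h => tsub_le_tsub_right h _).2 fun k _ =>
    ⟨k + n, by rw [← ENat.natCast_sub, Nat.add_sub_cancel]⟩

end FiniteValues

/-! ### Admissible classes in terms of points -/

section PointSets

variable {C : Type u} [SmallCategory C] (S : ConcreteSite C) {M : MorphismProperty C}

namespace MSub

/-- The set of points of an `M`-subobject. -/
def points {c : C} (P : MSub M c) : Set (S.Pts c) := {x | P.Factors x}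

variable {S}

theorem mem_points_iff {c : C} (P : MSub M c) (x : S.Pts c) :
    x ∈ P.points S ↔ ∃ y : S.Pts P.obj, y ≫ P.arrow = x :=
  ⟨fun h => ⟨P.factorThru x h, Subobject.factorThru_arrow _ _ _⟩,
    fun ⟨_, hy⟩ => hy ▸ Subobject.factors_comp_arrow _⟩

theorem points_mono {c : C} {P Q : MSub M c} (h : P.sub ≤ Q.sub) : P.points S ⊆ Q.points S :=
  fun x => Subobject.factors_of_le x h

variable [StableMonos M]

theorem mem_points_mk' {c d : C} (m : d ⟶ c) (hm : M m) (x : S.Pts c) :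
    x ∈ (mk' m hm).points S ↔ ∃ y, y ≫ m = x :=
  mk'_factors m hm x

theorem points_pull {c d : C} (f : d ⟶ c) (P : MSub M c) :
    (pull f P).points S = {x | x ≫ f ∈ P.points S} :=
  Set.ext fun x => pull_factors f P x

end MSub

namespace ConcreteSite

/-- A map `m` is an embedding if a map factors through `m` as soon as all its points do. -/
def IsEmbedding {c d : C} (m : d ⟶ c) : Prop :=
  ∀ ⦃e : C⦄ (g : e ⟶ c), (∀ x : S.Pts e, ∃ y : S.Pts d, y ≫ m = x ≫ g) → ∃ k, k ≫ m = g

variable (M) in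
/-- A set of points is open if it consists of the points that factor through some map in `M`. -/
def IsOpenPts {c : C} (U : Set (S.Pts c)) : Prop :=
  ∃ (d : C) (m : d ⟶ c), M m ∧ ∀ x, x ∈ U ↔ ∃ y : S.Pts d, y ≫ m = x

end ConcreteSite

variable {S}

theorem MSub.isOpenPts_points {c : C} (P : MSub M c) : S.IsOpenPts M (P.points S) :=
  ⟨P.obj, P.arrow, P.mem, P.mem_points_iff⟩

theorem ConcreteSite.IsOpenPts.exists_points_eq [StableMonos M] {c : C} {U : Set (S.Pts c)}
    (hU : S.IsOpenPts M U) : ∃ P : MSub M c, P.points S = U := by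
  obtain ⟨d, m, hm, h⟩ := hU
  exact ⟨.mk' m hm, Set.ext fun x => (MSub.mem_points_mk' m hm x).trans (h x).symm⟩

end PointSets

namespace ConcreteSite

section Criteria

variable {C : Type u} [SmallCategory C] {S : ConcreteSite C} {M : MorphismProperty C}

theorem factors_iff_of_isEmbedding {c d : C} {P : MSub M c} (hP : S.IsEmbedding P.arrow)
    (g : d ⟶ c) : P.Factors g ↔ ∀ x : S.Pts d, x ≫ g ∈ P.points S := by
  refine ⟨fun h x => Subobject.factors_of_factors_right x h, fun h => ?_⟩
  obtain ⟨k, rfl⟩ := hP g fun x => (P.mem_points_iff _).1 (h x)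
  exact Subobject.factors_comp_arrow _

theorem le_iff_points_subset {c : C} {P Q : MSub M c} (hQ : S.IsEmbedding Q.arrow) :
    P.sub ≤ Q.sub ↔ P.points S ⊆ Q.points S :=
  ⟨MSub.points_mono, fun h => Subobject.le_of_factors ((factors_iff_of_isEmbedding hQ _).2
    fun x => h ((P.mem_points_iff _).2 ⟨x, rfl⟩))⟩

theorem exists_isPullback_of_isOpenPts_preimage (injective : ∀ ⦃a b : C⦄ (m : a ⟶ b), M m →
      Function.Injective fun x : S.Pts a => x ≫ m)
    (embedding : ∀ ⦃a b : C⦄ (m : a ⟶ b), M m → S.IsEmbedding m)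
    {a b c : C} {m : a ⟶ b} (hm : M m) (f : c ⟶ b)
    (hf : S.IsOpenPts M {x : S.Pts c | ∃ y : S.Pts a, y ≫ m = x ≫ f}) :
    ∃ (p : C) (k : p ⟶ a) (n : p ⟶ c), M n ∧ IsPullback k n m f := by
  obtain ⟨p, n, hn, h⟩ := hf
  have mono {a b : C} {m : a ⟶ b} (hm : M m) : Mono m := ⟨fun g g' e =>
    S.faithful _ _ fun x => injective m hm (by simp only [Category.assoc, e])⟩
  have := mono hm
  have := mono hn
  obtain ⟨k, hk⟩ := embedding m hm (n ≫ f) fun x => by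
    obtain ⟨y, hy⟩ := (h (x ≫ n)).2 ⟨x, rfl⟩
    exact ⟨y, hy.trans (Category.assoc _ _ _)⟩
  choose l hl using fun s : PullbackCone m f => embedding n hn s.snd fun x =>
    (h _).1 ⟨x ≫ s.fst, by rw [Category.assoc, s.condition, Category.assoc]⟩
  refine ⟨p, k, n, hn, ⟨hk⟩, ⟨PullbackCone.IsLimit.mk _ l (fun s => ?_) hl fun s l' _ hl' => ?_⟩⟩
  · rw [← cancel_mono m, Category.assoc, hk, reassoc_of% hl s, s.condition]
  · rw [← cancel_mono n, hl s, hl']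

theorem stableMonos_of_points (iso : ∀ ⦃a b : C⦄ (m : a ⟶ b), IsIso m → M m)
    (comp : ∀ ⦃a b c : C⦄ (m : a ⟶ b) (n : b ⟶ c), M m → M n → M (m ≫ n))
    (injective : ∀ ⦃a b : C⦄ (m : a ⟶ b), M m → Function.Injective fun x : S.Pts a => x ≫ m)
    (embedding : ∀ ⦃a b : C⦄ (m : a ⟶ b), M m → S.IsEmbedding m)
    (preimage : ∀ ⦃a b : C⦄ (U : Set (S.Pts a)), S.IsOpenPts M U → ∀ f : b ⟶ a,
      S.IsOpenPts M {x | x ≫ f ∈ U}) : StableMonos M := by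
  have pullback {a b c : C} (m : a ⟶ b) (hm : M m) (f : c ⟶ b) :=
    exists_isPullback_of_isOpenPts_preimage injective embedding hm f
      (preimage _ ⟨a, m, hm, fun _ => Iff.rfl⟩ f)
  refine ⟨fun m hm => ⟨fun g g' e => S.faithful _ _ fun x => injective m hm ?_⟩, @iso, @comp,
    fun m f hm => ?_, fun {_ _ _ _ _ n m f} h hm => ?_⟩
  · simp only [Category.assoc, e]
  · obtain ⟨_, _, _, _, h⟩ := pullback m hm f
    exact h.hasPullback
  · obtain ⟨_, _, n', hn', h'⟩ := pullback m hm f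
    rw [← IsPullback.isoIsPullback_hom_snd _ _ h h']
    exact comp _ _ (iso _ inferInstance) hn'

theorem points_injective (embedding : ∀ ⦃a b : C⦄ (m : a ⟶ b), M m → S.IsEmbedding m) {c : C} :
    Function.Injective fun P : MSub M c => P.points S := fun P Q h => MSub.ext' fun g => by
  rw [factors_iff_of_isEmbedding (embedding _ P.mem), factors_iff_of_isEmbedding
    (embedding _ Q.mem), show P.points S = Q.points S from h]

theorem preAdmissible_of_points [StableMonos M]
    (embedding : ∀ ⦃a b : C⦄ (m : a ⟶ b), M m → S.IsEmbedding m)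
    (of_cover : ∀ ⦃a : C⦄ (U : Set (S.Pts a)) (T : Presieve a), T ∈ S.J a →
      (∀ ⦃b : C⦄ ⦃f : b ⟶ a⦄, T f → S.IsOpenPts M {x | x ≫ f ∈ U}) → S.IsOpenPts M U) :
    PreAdmissible S.topology M where
  isSheaf := (Presieve.isSheaf_coverage S.J _).2 fun {a} T hT s hs => by
    change ∀ ⦃b : C⦄ (f : b ⟶ a), T f → MSub M b at s
    let U : Set (S.Pts a) :=
      {x | ∃ (b : C) (f : b ⟶ a) (hf : T f) (y : S.Pts b), y ≫ f = x ∧ y ∈ (s f hf).points S}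
    have hU {b : C} (f : b ⟶ a) (hf : T f) : {x | x ≫ f ∈ U} = (s f hf).points S := by
      refine Set.ext fun y => ⟨?_, fun hy => ⟨b, f, hf, y, rfl, hy⟩⟩
      rintro ⟨b', f', hf', y', e, hy'⟩
      have hpull : (s f' hf').pull y' = (s f hf).pull y := hs _ _ hf' hf e
      have hmem := (Set.ext_iff.1 (congrArg (MSub.points S) hpull) (𝟙 S.star)).1
      simpa only [MSub.points_pull, Set.mem_ofPred_eq, Category.id_comp, hy', true_imp_iff]
        using hmem
    obtain ⟨P, hP⟩ := (of_cover U T hT fun b f hf =>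
      (hU f hf).symm ▸ (s f hf).isOpenPts_points).exists_points_eq
    refine ⟨P, fun b f hf => points_injective embedding ?_,
      fun Q hQ => points_injective embedding ?_⟩
    · exact (MSub.points_pull f P).trans (hP ▸ hU f hf)
    · refine Set.ext fun x => ?_
      obtain ⟨b, f, y, hf, rfl⟩ := S.covers_points T hT x
      have hQf : Q.pull f = s f hf := hQ f hf
      have := (Q.points_pull (S := S) f).symm.trans ((congrArg _ hQf).trans (hU f hf).symm)
      exact (Set.ext_iff.1 this y).trans (Set.ext_iff.1 hP (y ≫ f)).symm

end Criteria

theorem isAdmissible_of_points {C : Type u} [SmallCategory C] {S : ConcreteSite C}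
    {M : MorphismProperty C} [PreAdmissible S.topology M]
    (embedding : ∀ ⦃a b : C⦄ (m : a ⟶ b), M m → S.IsEmbedding m)
    (zero_mem : ∀ c : C, M (S.isInitial.to c))
    (iUnion : ∀ ⦃c : C⦄ (U : ℕ → Set (S.Pts c)), Monotone U → (∀ n, S.IsOpenPts M (U n)) →
      S.IsOpenPts M (⋃ n, U n))
    (exists_cover : ∀ ⦃c d : C⦄ (m : d ⟶ c), M m → ∀ U : ℕ → Set (S.Pts c), Monotone U →
      (∀ n, S.IsOpenPts M (U n)) → (∀ x, x ∈ ⋃ n, U n ↔ ∃ y, y ≫ m = x) →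
      ∃ T ∈ S.J d, ∀ ⦃e : C⦄ ⦃f : e ⟶ d⦄, T f → ∃ n, ∀ x, (x ≫ f) ≫ m ∈ U n) :
    S.IsAdmissible M where
  zero_mem := zero_mem
  le_of_points P Q h := (le_iff_points_subset (embedding _ Q.mem)).2 h
  exists_sup P hP := by
    obtain ⟨Q, hQ⟩ := (iUnion (fun n => (P n).points S)
      (monotone_nat_of_le_succ fun n => MSub.points_mono (hP n))
      fun n => (P n).isOpenPts_points).exists_points_eq
    exact ⟨Q, fun x => (Set.ext_iff.1 hQ x).trans Set.mem_iUnion⟩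
  sup_cover P hP Q hQ := by
    obtain ⟨T, hT, h⟩ := exists_cover Q.arrow Q.mem (fun n => (P n).points S)
      (monotone_nat_of_le_succ fun n => MSub.points_mono (hP n))
      (fun n => (P n).isOpenPts_points)
      fun x => Set.mem_iUnion.trans ((hQ x).symm.trans (Q.mem_points_iff x))
    refine ⟨T, hT, fun d f hf => ?_⟩
    obtain ⟨n, hn⟩ := h hf
    exact ⟨n, (factors_iff_of_isEmbedding (embedding _ (P n).mem) _).2 fun x =>
      Category.assoc x f Q.arrow ▸ hn x⟩

section Admissible

variable {C : Type u} [SmallCategory C] {S : ConcreteSite C} {M : MorphismProperty C}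
  [S.IsAdmissible M]

theorem IsAdmissible.isEmbedding {c d : C} {m : d ⟶ c} (hm : M m) : S.IsEmbedding m := by
  intro e g h
  have hle : (MSub.mk' (M := M) (𝟙 e) (StableMonos.iso _ inferInstance)).sub ≤
      (MSub.pull g (MSub.mk' m hm)).sub := le_of_points (S := S) _ _ fun x _ => by
    rw [MSub.pull_factors, MSub.mk'_factors]
    exact h x
  have hid := Subobject.factors_of_le (𝟙 e) hle ((MSub.mk'_factors _ _ _).2 ⟨𝟙 e, by simp⟩)
  exact (MSub.mk'_factors _ _ _).1 (Category.id_comp g ▸ (MSub.pull_factors g _ (𝟙 e)).1 hid)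

theorem nonempty_hom_zero (M : MorphismProperty C) [S.IsAdmissible M] {c : C}
    (hc : IsEmpty (S.Pts c)) : Nonempty (c ⟶ S.zero) := by
  obtain ⟨k, -⟩ := IsAdmissible.isEmbedding (IsAdmissible.zero_mem (S := S) (M := M) c) (𝟙 c)
    fun x => hc.elim x
  exact ⟨k⟩

theorem nonempty_isInitial_iff (M : MorphismProperty C) [S.IsAdmissible M] {c : C} :
    Nonempty (IsInitial c) ↔ IsEmpty (S.Pts c) := by
  refine ⟨fun ⟨h⟩ => ⟨fun x => S.isEmpty_pts_zero.false (x ≫ h.to _)⟩, fun hc => ?_⟩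
  obtain ⟨k⟩ := nonempty_hom_zero M hc
  exact ⟨S.isInitial.ofIso ⟨S.isInitial.to c, k, S.isInitial.hom_ext _ _,
    S.faithful _ _ fun x => hc.elim x⟩⟩

theorem IsOpenPts.preimage {c d : C} {U : Set (S.Pts c)} (hU : S.IsOpenPts M U) (f : d ⟶ c) :
    S.IsOpenPts M {x | x ≫ f ∈ U} := by
  obtain ⟨P, rfl⟩ := hU.exists_points_eq
  exact MSub.points_pull (S := S) f P ▸ (P.pull f).isOpenPts_points

theorem isOpenPts_of_cover {c : C} {U : Set (S.Pts c)} (T : Presieve c) (hT : T ∈ S.J c)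
    (h : ∀ ⦃d : C⦄ ⦃f : d ⟶ c⦄, T f → S.IsOpenPts M {x | x ≫ f ∈ U}) : S.IsOpenPts M U := by
  choose s hs using fun (d : C) (f : d ⟶ c) (hf : T f) => (h hf).exists_points_eq
  obtain ⟨P, hP, -⟩ := (Presieve.isSheaf_coverage S.J _).1
    (PreAdmissible.isSheaf (J := S.topology) (M := M)) T hT s
    fun d d' e g g' f f' hf hf' w => points_injective (M := M)
      (fun _ _ _ => IsAdmissible.isEmbedding) (Set.ext fun x => by
        change x ∈ ((s d f hf).pull g).points S ↔ x ∈ ((s d' f' hf').pull g').points S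
        simp only [MSub.points_pull, hs, Set.mem_ofPred_eq, Category.assoc, w])
  convert P.isOpenPts_points (S := S)
  refine Set.ext fun x => ?_
  obtain ⟨d, f, y, hf, rfl⟩ := S.covers_points T hT x
  have hPf : P.pull f = s d f hf := hP f hf
  have := (P.points_pull (S := S) f).symm.trans ((congrArg _ hPf).trans (hs d f hf))
  exact (Set.ext_iff.1 this y).symm

theorem isOpenPts_iUnion {c : C} {U : ℕ → Set (S.Pts c)} (hmono : Monotone U)
    (hU : ∀ n, S.IsOpenPts M (U n)) : S.IsOpenPts M (⋃ n, U n) := by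
  choose P hP using fun n => (hU n).exists_points_eq
  obtain ⟨Q, hQ⟩ := IsAdmissible.exists_sup (S := S) P fun n =>
    (le_iff_points_subset (IsAdmissible.isEmbedding (P _).mem)).2 (by
      rw [hP, hP]; exact hmono n.le_succ)
  convert Q.isOpenPts_points (S := S)
  exact Set.ext fun x => Set.mem_iUnion.trans
    ((exists_congr fun n => (Set.ext_iff.1 (hP n) x).symm).trans (hQ x).symm)

theorem exists_cover_of_iUnion {c d : C} {m : d ⟶ c} (hm : M m) {U : ℕ → Set (S.Pts c)}
    (hmono : Monotone U) (hU : ∀ n, S.IsOpenPts M (U n))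
    (h : ∀ x, x ∈ ⋃ n, U n ↔ ∃ y : S.Pts d, y ≫ m = x) :
    ∃ T ∈ S.J d, ∀ ⦃e : C⦄ ⦃f : e ⟶ d⦄, T f → ∃ n, ∀ x, (x ≫ f) ≫ m ∈ U n := by
  choose P hP using fun n => (hU n).exists_points_eq
  obtain ⟨T, hT, hT'⟩ := IsAdmissible.sup_cover (S := S) P (fun n =>
    (le_iff_points_subset (IsAdmissible.isEmbedding (P _).mem)).2 (by
      rw [hP, hP]; exact hmono n.le_succ)) (MSub.mk' m hm) fun x =>
    (MSub.mem_points_mk' m hm x).trans ((h x).symm.trans (Set.mem_iUnion.trans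
      (exists_congr fun n => (Set.ext_iff.1 (hP n) x).symm)))
  obtain ⟨R, hR, hR'⟩ := S.J.pullback (MSub.mk'Iso m hm).inv T hT
  refine ⟨R, hR, fun e f hf => ?_⟩
  obtain ⟨e', i, l, hl, w⟩ := hR' hf
  obtain ⟨n, hn⟩ := hT' hl
  refine ⟨n, fun x => hP n ▸ ?_⟩
  have hx : (x ≫ f) ≫ m = (x ≫ i) ≫ l ≫ (MSub.mk' m hm).arrow := by
    rw [← MSub.mk'Iso_comp, Category.assoc x i, reassoc_of% w]
    simp
  exact hx ▸ Subobject.factors_of_factors_right (x ≫ i) hn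

end Admissible

end ConcreteSite

/-! ### The combined site -/

namespace ConcreteSite

section IsConst

variable {C : Type u} [SmallCategory C] (S : ConcreteSite C)

/-- A map is constant if it factors through the terminal object. -/
def IsConst {c d : C} (f : c ⟶ d) : Prop := ∃ y : S.Pts d, f = S.isTerminal.from c ≫ y

variable {S}

theorem pts_comp_from {c d : C} (x : S.Pts c) (y : S.Pts d) : x ≫ S.isTerminal.from c ≫ y = y := by
  rw [← Category.assoc, S.isTerminal.hom_ext (x ≫ _) (𝟙 _), Category.id_comp]

theorem IsConst.subsingleton_pts {c d : C} {f : c ⟶ d} [IsIso f] (hf : S.IsConst f) :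
    Subsingleton (S.Pts d) := by
  obtain ⟨y, hy⟩ := hf
  have h (x : S.Pts d) : x = y := by
    calc x = (x ≫ inv f) ≫ f := by simp
      _ = y := (congrArg _ hy).trans (pts_comp_from _ _)
  exact ⟨fun x x' => (h x).trans (h x').symm⟩

end IsConst

section Comb

variable {C : Type u} [SmallCategory C] {S : ConcreteSite C}

/-- The points of an object of `C`, seen as an object of `C + V₀`. -/
def ofPts (c : C) : S.Pts c ≃ S.comb.Pts (.of c) where
  toFun x := S.incl.map x
  invFun x := x.1 (𝟙 S.star)
  left_inv x := Category.id_comp x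
  right_inv x := Comb.hom_ext fun y => by
    rw [S.isTerminal.hom_ext y (𝟙 S.star)]
    exact Category.id_comp _

variable (S) in
/-- The points of `V = ω + 1`. -/
def vertPts : ℕ∞ ≃ S.comb.Pts .vert where
  toFun n := constMap _ (ULift.up n)
  invFun x := (x.1 (𝟙 S.star)).down
  left_inv _ := rfl
  right_inv x := Comb.hom_ext fun y => by
    rw [S.isTerminal.hom_ext y (𝟙 S.star)]
    rfl

theorem ofPts_comp_incl {c d : C} (x : S.Pts c) (f : c ⟶ d) :
    ofPts c x ≫ S.incl.map f = ofPts d (x ≫ f) :=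
  (S.incl.map_comp x f).symm

theorem ofPts_comp_incl_eq_iff {c d : C} {x : S.Pts c} {f : c ⟶ d} {y : S.Pts d} :
    ofPts c x ≫ S.incl.map f = ofPts d y ↔ x ≫ f = y :=
  (iff_of_eq (congrArg (· = ofPts d y) (ofPts_comp_incl x f))).trans (ofPts d).injective.eq_iff

theorem exists_comp_incl_eq_iff {c d : C} {f : c ⟶ d} {y : S.Pts d} :
    (∃ x, x ≫ S.incl.map f = ofPts d y) ↔ ∃ x, x ≫ f = y :=
  (ofPts c).surjective.exists.trans (exists_congr fun _ => ofPts_comp_incl_eq_iff)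

theorem preimage_ofPts_comp_incl {c d : C} (f : c ⟶ d) (U : Set (S.comb.Pts (.of d))) :
    ofPts c ⁻¹' {x | x ≫ S.incl.map f ∈ U} = {x | x ≫ f ∈ ofPts d ⁻¹' U} :=
  Set.ext fun x => iff_of_eq (congrArg (· ∈ U) (ofPts_comp_incl x f))

instance : S.incl.Full where
  map_surjective f := ⟨f.2.choose, Comb.hom_ext fun x => (f.2.choose_spec x).symm⟩

instance : S.incl.Faithful where
  map_injective {_ _} f g h := S.faithful f g fun x => (ofPts _).injective (by
    rw [← ofPts_comp_incl, ← ofPts_comp_incl, h])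

/-- The map `V ⟶ V` given by a continuous function. -/
def vertMap (f : ℕ∞ → ℕ∞) (hf : ωScottContinuous f) : (Comb.vert : S.Comb) ⟶ .vert :=
  ⟨fun x => ULift.up (f x.down), hf⟩

theorem vertPts_comp_vertMap (f : ℕ∞ → ℕ∞) (hf : ωScottContinuous f) (n : ℕ∞) :
    S.vertPts n ≫ vertMap f hf = S.vertPts (f n) :=
  rfl

theorem exists_eq_vertMap (f : (Comb.vert : S.Comb) ⟶ .vert) : ∃ g hg, f = vertMap g hg :=
  ⟨_, f.2, rfl⟩

theorem isConst_of_vert {c : C} (f : (Comb.of c : S.Comb) ⟶ .vert) : S.comb.IsConst f := by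
  obtain ⟨y, hy⟩ := f.2
  exact ⟨S.vertPts y.down, Comb.hom_ext hy⟩

theorem isConst_vert_of {c : C} (f : (Comb.vert : S.Comb) ⟶ .of c) : S.comb.IsConst f := by
  obtain ⟨y, hy⟩ := f.2
  exact ⟨constMap _ y, Comb.hom_ext hy⟩

/-- The map `x ↦ x + n` on `V`. -/
def vertAdd (n : ℕ) : (Comb.vert : S.Comb) ⟶ .vert := vertMap _ (ωScottContinuous_enat_add n)

theorem vertPts_comp_vertAdd_eq_iff {n : ℕ} {x y : ℕ∞} :
    S.vertPts x ≫ vertAdd n = S.vertPts y ↔ y = x + n :=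
  (S.vertPts.injective.eq_iff (a := x + n)).trans eq_comm

variable {M : MorphismProperty C}

theorem combMonos_incl_iff {c d : C} {m : c ⟶ d} : S.combMonos M (S.incl.map m) ↔ M m :=
  ⟨fun ⟨_, hm', h⟩ => S.incl.map_injective h ▸ hm', fun hm => ⟨m, hm, rfl⟩⟩

theorem combMonos_vert_iff {m : (Comb.vert : S.Comb) ⟶ .vert} :
    S.combMonos M m ↔ ∃ n, m = vertAdd n :=
  exists_congr fun _ => ⟨fun h => Comb.hom_ext fun x => h x.down, fun h _ => h ▸ rfl⟩

theorem combMonos_iso {a b : S.Comb} (hM : ∀ ⦃c d : C⦄ (m : c ⟶ d), IsIso m → M m) (m : a ⟶ b)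
    [IsIso m] : S.combMonos M m := by
  have not_isConst {a : S.Comb} (f : a ⟶ .vert) [IsIso f] : ¬ S.comb.IsConst f := fun h =>
    have := h.subsingleton_pts
    ENat.zero_ne_top (S.vertPts.injective (Subsingleton.elim _ _))
  rcases a with c | _ <;> rcases b with d | _
  · obtain ⟨m, rfl⟩ := S.incl.map_surjective m
    have : IsIso (S.incl.map m) := ‹_›
    exact combMonos_incl_iff.2 (hM m (isIso_of_reflects_iso m S.incl))
  · exact (not_isConst m (isConst_of_vert m)).elim
  · exact (not_isConst (inv m) (isConst_of_vert (inv m))).elim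
  · obtain ⟨f, hf, hfm⟩ := exists_eq_vertMap m
    obtain ⟨g, hg, hgm⟩ := exists_eq_vertMap (inv m)
    have left (x : ℕ∞) : g (f x) = x := S.vertPts.injective (by
      rw [← vertPts_comp_vertMap g hg, ← vertPts_comp_vertMap f hf, ← hfm, ← hgm]; simp)
    have right (x : ℕ∞) : f (g x) = x := S.vertPts.injective (by
      rw [← vertPts_comp_vertMap f hf, ← vertPts_comp_vertMap g hg, ← hfm, ← hgm]; simp)
    let e : ℕ∞ ≃o ℕ∞ := ⟨⟨f, g, left, right⟩, fun {_ _} =>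
      ⟨fun h => by simpa only [Equiv.coe_fn_mk, left] using hg.monotone h, fun h => hf.monotone h⟩⟩
    have he : e = OrderIso.refl ℕ∞ := Subsingleton.elim _ _
    refine combMonos_vert_iff.2 ⟨0, hfm.trans (Comb.hom_ext fun x => congrArg ULift.up ?_)⟩
    exact (DFunLike.congr_fun he x.down).trans (add_zero x.down).symm

theorem isOpenPts_of_iff {c : C} {U : Set (S.comb.Pts (.of c))} :
    S.comb.IsOpenPts (S.combMonos M) U ↔ S.IsOpenPts M (ofPts c ⁻¹' U) := by
  constructor
  · rintro ⟨_ | _, m, hm, h⟩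
    · obtain ⟨m, hm, rfl⟩ := hm
      exact ⟨_, m, hm, fun x => (h _).trans exists_comp_incl_eq_iff⟩
    · exact hm.elim
  · rintro ⟨d, m, hm, h⟩
    exact ⟨.of d, S.incl.map m, combMonos_incl_iff.2 hm, (ofPts c).surjective.forall.2 fun x =>
      (h x).trans exists_comp_incl_eq_iff.symm⟩

variable [S.IsAdmissible M]

theorem combMonos_comp {a b c : S.Comb} (m : a ⟶ b) (n : b ⟶ c) (hm : S.combMonos M m)
    (hn : S.combMonos M n) : S.combMonos M (m ≫ n) := by
  rcases a with a | _ <;> rcases b with b | _ <;> rcases c with c | _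
  · obtain ⟨m, hm, rfl⟩ := hm
    obtain ⟨n, hn, rfl⟩ := hn
    exact S.incl.map_comp m n ▸ combMonos_incl_iff.2 (StableMonos.comp _ _ hm hn)
  · have hb := (nonempty_isInitial_iff (S := S) M).1 hn
    exact (nonempty_isInitial_iff (S := S) M).2 ⟨fun x => hb.false (m.1 x)⟩
  · exact hn.elim
  · exact hm
  · exact hm.elim
  · exact hm.elim
  · exact hn.elim
  · obtain ⟨k, rfl⟩ := combMonos_vert_iff.1 hm
    obtain ⟨l, rfl⟩ := combMonos_vert_iff.1 hn
    refine combMonos_vert_iff.2 ⟨k + l, Comb.hom_ext fun x => congrArg ULift.up ?_⟩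
    exact (add_assoc x.down (k : ℕ∞) l).trans (by rw [Nat.cast_add])

theorem combMonos_injective {a b : S.Comb} (m : a ⟶ b) (hm : S.combMonos M m) :
    Function.Injective fun x : S.comb.Pts a => x ≫ m := by
  rcases a with c | _ <;> rcases b with d | _
  · obtain ⟨m, hm, rfl⟩ := hm
    have := StableMonos.mono m hm
    refine (ofPts c).surjective.forall₂.2 fun x y h => congrArg _ ((cancel_mono m).1 ?_)
    exact (ofPts d).injective ((ofPts_comp_incl x m).symm.trans (h.trans (ofPts_comp_incl y m)))
  · have := (nonempty_isInitial_iff (S := S) M).1 hm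
    exact (ofPts c).surjective.forall.2 fun x => this.elim x
  · exact hm.elim
  · obtain ⟨n, rfl⟩ := combMonos_vert_iff.1 hm
    refine S.vertPts.surjective.forall₂.2 fun x y h => congrArg _ ?_
    exact ENat.add_left_injective_of_ne_top (ENat.natCast_ne_top n) (S.vertPts.injective h)

theorem exists_comp_vertAdd_eq (n : ℕ) (g : (Comb.vert : S.Comb) ⟶ .vert)
    (h : ∀ x : S.comb.Pts .vert, ∃ y : S.comb.Pts .vert, y ≫ vertAdd n = x ≫ g) :
    ∃ k, k ≫ vertAdd n = g := by
  obtain ⟨g, hg, rfl⟩ := exists_eq_vertMap g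
  refine ⟨vertMap _ ((ωScottContinuous_enat_sub n).comp hg), Comb.hom_ext fun x =>
    congrArg ULift.up (tsub_add_cancel_of_le ?_)⟩
  obtain ⟨y, hy⟩ := h (S.vertPts x.down)
  obtain ⟨y, rfl⟩ := S.vertPts.surjective y
  exact le_add_self.trans_eq (S.vertPts.injective hy)

theorem combMonos_isEmbedding {a b : S.Comb} (m : a ⟶ b) (hm : S.combMonos M m) :
    S.comb.IsEmbedding m := by
  intro e g h
  have factors_const (hg : S.comb.IsConst g) (he : Nonempty (S.comb.Pts e)) : ∃ k, k ≫ m = g := by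
    obtain ⟨y, rfl⟩ := hg
    obtain ⟨x⟩ := he
    obtain ⟨z, hz⟩ := h x
    exact ⟨S.comb.isTerminal.from e ≫ z, by rw [Category.assoc, hz, pts_comp_from]⟩
  rcases e with e | _
  · rcases isEmpty_or_nonempty (S.Pts e) with he | he
    · obtain ⟨k⟩ := nonempty_hom_zero M he
      exact ⟨S.incl.map k ≫ S.comb.isInitial.to a, Comb.hom_ext fun x => he.elim x⟩
    rcases b with b | _
    · rcases a with a | _
      · obtain ⟨m, hm, rfl⟩ := hm
        obtain ⟨g, rfl⟩ := S.incl.map_surjective g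
        obtain ⟨k, rfl⟩ := IsAdmissible.isEmbedding (S := S) hm g fun x => by
          obtain ⟨y, hy⟩ := h (ofPts e x)
          obtain ⟨y, rfl⟩ := (ofPts a).surjective y
          exact ⟨y, (ofPts b).injective
            ((ofPts_comp_incl y m).symm.trans (hy.trans (ofPts_comp_incl x g)))⟩
        exact ⟨S.incl.map k, (S.incl.map_comp k m).symm⟩
      · exact hm.elim
    · exact factors_const (isConst_of_vert g) (he.map (ofPts e))
  · rcases b with b | _
    · exact factors_const (isConst_vert_of g) ⟨S.vertPts 0⟩
    · rcases a with a | _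
      · have ha := (nonempty_isInitial_iff (S := S) M).1 hm
        obtain ⟨y, -⟩ := h (S.vertPts 0)
        exact (ha.false ((ofPts a).symm y)).elim
      · obtain ⟨n, rfl⟩ := combMonos_vert_iff.1 hm
        exact exists_comp_vertAdd_eq n g h

theorem isOpenPts_vert_iff {U : Set (S.comb.Pts .vert)} :
    S.comb.IsOpenPts (S.combMonos M) U ↔ ωScottContinuous fun n => S.vertPts n ∈ U := by
  refine Iff.trans ⟨?_, ?_⟩ (ωScottContinuous_mem_enat_iff (U := S.vertPts ⁻¹' U)).symm
  · rintro ⟨a | _, m, hm, h⟩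
    · have ha := (nonempty_isInitial_iff (S := S) M).1 hm
      refine .inl (Set.eq_empty_of_forall_notMem fun n hn => ?_)
      obtain ⟨y, -⟩ := (h _).1 hn
      exact ha.false ((ofPts a).symm y)
    · obtain ⟨n, rfl⟩ := combMonos_vert_iff.1 hm
      refine .inr ⟨n, Set.ext fun x => (h _).trans (S.vertPts.surjective.exists.trans ?_)⟩
      rw [Set.mem_Ici, le_iff_exists_add']
      exact exists_congr fun _ => vertPts_comp_vertAdd_eq_iff
  · rintro (hU | ⟨n, hU⟩)
    · refine ⟨.of S.zero, S.comb.isInitial.to _, ⟨S.isInitial⟩, S.vertPts.surjective.forall.2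
        fun x => iff_of_false (Set.eq_empty_iff_forall_notMem.1 hU x) fun ⟨y, _⟩ => ?_⟩
      exact S.isEmpty_pts_zero.false ((ofPts _).symm y)
    · refine ⟨_, vertAdd n, combMonos_vert_iff.2 ⟨n, rfl⟩, S.vertPts.surjective.forall.2 fun x =>
        (Set.ext_iff.1 hU x).trans (Iff.trans ?_ S.vertPts.surjective.exists.symm)⟩
      rw [Set.mem_Ici, le_iff_exists_add']
      exact exists_congr fun _ => vertPts_comp_vertAdd_eq_iff.symm

theorem combMonos_initial_to (a : S.Comb) : S.combMonos M (S.comb.isInitial.to a) := by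
  cases a with
  | of c => exact combMonos_incl_iff.2 (IsAdmissible.zero_mem (S := S) c)
  | vert => exact ⟨S.isInitial⟩

theorem combMonos_preimage {a b : S.Comb} (U : Set (S.comb.Pts a))
    (hU : S.comb.IsOpenPts (S.combMonos M) U) (f : b ⟶ a) :
    S.comb.IsOpenPts (S.combMonos M) {x | x ≫ f ∈ U} := by
  have const (hf : S.comb.IsConst f) : S.comb.IsOpenPts (S.combMonos M) {x | x ≫ f ∈ U} := by
    obtain ⟨y, rfl⟩ := hf
    simp only [pts_comp_from]
    by_cases hy : y ∈ U
    · exact ⟨b, 𝟙 b, combMonos_iso (fun _ _ => StableMonos.iso) _, fun x =>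
        iff_of_true hy ⟨x, Category.comp_id x⟩⟩
    · exact ⟨_, _, combMonos_initial_to b, fun x => iff_of_false hy fun ⟨z, _⟩ =>
        S.comb.isEmpty_pts_zero.false z⟩
  rcases a with a | _ <;> rcases b with b | _
  · obtain ⟨f, rfl⟩ := S.incl.map_surjective f
    exact isOpenPts_of_iff.2
      (preimage_ofPts_comp_incl f U ▸ (isOpenPts_of_iff.1 hU).preimage f)
  · exact const (isConst_vert_of f)
  · exact const (isConst_of_vert f)
  · obtain ⟨f, hf, rfl⟩ := exists_eq_vertMap f
    exact isOpenPts_vert_iff.2 ((isOpenPts_vert_iff.1 hU).comp hf)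

instance combMonos_stable : StableMonos (S.combMonos M) :=
  stableMonos_of_points (fun _ _ m _ => combMonos_iso (fun _ _ => StableMonos.iso) m)
    (fun _ _ _ => combMonos_comp) (fun _ _ => combMonos_injective)
    (fun _ _ => combMonos_isEmbedding) fun _ _ => combMonos_preimage

instance combMonos_preAdmissible : PreAdmissible S.comb.topology (S.combMonos M) :=
  preAdmissible_of_points (fun _ _ => combMonos_isEmbedding) fun a U T hT hU => by
    cases a with
    | of c =>
      obtain ⟨R, hR, rfl⟩ := hT
      refine isOpenPts_of_iff.2 (isOpenPts_of_cover R hR fun d f hf => ?_)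
      exact preimage_ofPts_comp_incl f U ▸ isOpenPts_of_iff.1 (hU (Presieve.map_map hf))
    | vert =>
      obtain rfl := hT
      have hU' := hU (Presieve.singleton_self (𝟙 _))
      simp only [Category.comp_id] at hU'
      exact hU'

theorem combMonos_iUnion {a : S.Comb} (U : ℕ → Set (S.comb.Pts a)) (hmono : Monotone U)
    (hU : ∀ n, S.comb.IsOpenPts (S.combMonos M) (U n)) :
    S.comb.IsOpenPts (S.combMonos M) (⋃ n, U n) := by
  cases a with
  | of c =>
    refine isOpenPts_of_iff.2 ?_
    rw [Set.preimage_iUnion]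
    exact isOpenPts_iUnion (fun _ _ h => Set.preimage_mono (hmono h)) fun n =>
      isOpenPts_of_iff.1 (hU n)
  | vert =>
    simp only [isOpenPts_vert_iff, Set.mem_iUnion] at hU ⊢
    refine (ωScottContinuous_enat_iff fun x y h => Exists.imp fun n => (hU n).monotone h).2 ?_
    rintro ⟨n, hn⟩
    obtain ⟨k, hk⟩ :=
      (ωSup_prop_iff _).1 ((ωScottContinuous_enat_iff (hU n).monotone).1 (hU n) hn)
    exact (ωSup_prop_iff _).2 ⟨k, n, hk⟩

theorem combMonos_exists_cover {a b : S.Comb} (m : b ⟶ a) (hm : S.combMonos M m)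
    (U : ℕ → Set (S.comb.Pts a)) (hmono : Monotone U)
    (hU : ∀ n, S.comb.IsOpenPts (S.combMonos M) (U n))
    (h : ∀ x, x ∈ ⋃ n, U n ↔ ∃ y, y ≫ m = x) :
    ∃ T ∈ S.comb.J b, ∀ ⦃d : S.Comb⦄ ⦃f : d ⟶ b⦄, T f → ∃ n, ∀ x, (x ≫ f) ≫ m ∈ U n := by
  have cover_id (hn : ∃ n, ∀ x, x ≫ m ∈ U n) :
      ∃ T ∈ S.comb.J b, ∀ ⦃d : S.Comb⦄ ⦃f : d ⟶ b⦄, T f → ∃ n, ∀ x, (x ≫ f) ≫ m ∈ U n := by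
    refine ⟨_, S.comb.id_mem b, ?_⟩
    rintro _ _ ⟨⟩
    simpa only [Category.comp_id] using hn
  rcases a with c | _ <;> rcases b with d | _
  · obtain ⟨m, hm, rfl⟩ := hm
    obtain ⟨R, hR, hR'⟩ := exists_cover_of_iUnion (S := S) hm (U := fun n => ofPts c ⁻¹' U n)
      (fun _ _ h => Set.preimage_mono (hmono h)) (fun n => isOpenPts_of_iff.1 (hU n)) fun x => by
        rw [← Set.preimage_iUnion, Set.mem_preimage, h]
        exact exists_comp_incl_eq_iff
    refine ⟨R.map S.incl, ⟨R, hR, rfl⟩, ?_⟩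
    rintro _ _ @⟨_, f, hf⟩
    obtain ⟨n, hn⟩ := hR' hf
    refine ⟨n, (ofPts _).surjective.forall.2 fun x => ?_⟩
    have hx := (congrArg (· ≫ S.incl.map m) (ofPts_comp_incl x f)).trans (ofPts_comp_incl _ m)
    exact hx ▸ hn x
  · exact hm.elim
  · have hd := (nonempty_isInitial_iff (S := S) M).1 hm
    exact cover_id ⟨0, fun x => hd.elim ((ofPts d).symm x)⟩
  · obtain ⟨n, hn⟩ := Set.mem_iUnion.1 ((h _).2 ⟨S.vertPts 0, rfl⟩)
    refine cover_id ⟨n, S.vertPts.surjective.forall.2 fun x => ?_⟩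
    have hmem := isOpenPts_vert_iff.1 (combMonos_preimage (U n) (hU n) m)
    exact hmem.monotone (zero_le (a := x)) hn

instance combMonos_admissible : S.comb.IsAdmissible (S.combMonos M) :=
  isAdmissible_of_points (fun _ _ => combMonos_isEmbedding) combMonos_initial_to
    (fun _ => combMonos_iUnion) fun _ _ => combMonos_exists_cover

end Comb

end ConcreteSite

/-! ### Sheaves of concrete sheaves -/

namespace ConcreteSite

section Points

variable {C : Type u} [SmallCategory C] {S : ConcreteSite C} {Z W : S.Sh}

/-- The global elements of a sheaf: its elements over the terminal object. -/
abbrev Global (Z : S.Sh) : Type u := Z.obj.obj (op S.star)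

/-- The restriction of an element of a sheaf along a point. -/
def atPt {c : C} (z : Z.obj.obj (op c)) (x : S.Pts c) : Global Z := Z.obj.map x.op z

theorem atPt_map {c d : C} (f : d ⟶ c) (z : Z.obj.obj (op c)) (x : S.Pts d) :
    atPt (Z.obj.map f.op z) x = atPt z (x ≫ f) :=
  (Functor.map_comp_apply Z.obj f.op x.op z).symm

theorem atPt_app (α : Z ⟶ W) {c : C} (z : Z.obj.obj (op c)) (x : S.Pts c) :
    atPt (α.hom.app (op c) z) x = α.hom.app _ (atPt z x) :=
  (NatTrans.naturality_apply α.hom x.op z).symm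

theorem atPt_global (z : Global Z) (x : S.Pts S.star) : atPt z x = z := by
  rw [atPt, S.isTerminal.hom_ext x (𝟙 _), op_id, Functor.map_id_apply]

/-- The constant element over `c` with a given global element as its value. -/
def constAt (c : C) (z : Global Z) : Z.obj.obj (op c) := Z.obj.map (S.isTerminal.from c).op z

theorem atPt_constAt (c : C) (z : Global Z) (x : S.Pts c) : atPt (constAt c z) x = z :=
  (atPt_map _ _ _).trans (atPt_global _ _)

end Points

end ConcreteSite

open ConcreteSite

namespace ConcreteSheaf

variable {C : Type u} [SmallCategory C] {S : ConcreteSite C}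

section ToSheaf

variable (Y : ConcreteSheaf S)

/-- The presheaf of a concrete sheaf, whose elements over `c` are the functions in `R c`. -/
def presheaf : Cᵒᵖ ⥤ Type u where
  obj c := Y.R c.unop
  map f := TypeCat.ofHom fun g => ⟨fun x => g.1 (x ≫ f.unop), Y.comp_mem f.unop g.2⟩
  map_id c := by
    ext g x
    exact congrArg g.1 (Category.comp_id x)
  map_comp f f' := by
    ext g x
    exact congrArg g.1 (Category.assoc x f'.unop f.unop).symm

theorem isSheaf_presheaf : Presieve.IsSheaf S.topology Y.presheaf := by
  refine (Presieve.isSheaf_coverage S.J _).2 fun {c} T hT s hs => ?_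
  change ∀ ⦃d : C⦄ (f : d ⟶ c), T f → Y.R d at s
  have val_eq {d d' : C} (f : d ⟶ c) (f' : d' ⟶ c) (hf : T f) (hf' : T f') (y : S.Pts d)
      (y' : S.Pts d') (e : y ≫ f = y' ≫ f') : (s f hf).1 y = (s f' hf').1 y' := by
    have h := congrFun (congrArg Subtype.val (hs y y' hf hf' e)) (𝟙 S.star)
    change (s f hf).1 (𝟙 _ ≫ y) = (s f' hf').1 (𝟙 _ ≫ y') at h
    rwa [Category.id_comp, Category.id_comp] at h
  choose d f y hf hy using S.covers_points T hT
  have val_comp {d' : C} (f' : d' ⟶ c) (hf' : T f') :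
      (fun x => (s (f (x ≫ f')) (hf _)).1 (y (x ≫ f'))) = (s f' hf').1 :=
    funext fun x => val_eq _ _ _ _ _ _ (hy _)
  refine ⟨(⟨fun x => (s (f x) (hf x)).1 (y x), Y.glue_mem T hT _ fun d' f' hf' => ?_⟩ : Y.R c),
    fun d' f' hf' => Subtype.ext (val_comp f' hf'), fun t ht => Subtype.ext (funext fun x => ?_)⟩
  · exact val_comp f' hf' ▸ (s f' hf').2
  · change Y.R c at t
    have h := congrFun (congrArg Subtype.val (ht (f x) (hf x))) (y x)
    exact (congrArg t.1 (hy x)).symm.trans h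

/-- The sheaf of a concrete sheaf. -/
def toSheaf : S.Sh := ⟨Y.presheaf, (isSheaf_iff_isSheaf_of_type _ _).2 Y.isSheaf_presheaf⟩

variable {Y}

/-- The element of the sheaf of `Y` given by a function in a relation of `Y`. -/
def secOf {c : C} (g : S.Pts c → Y.carrier) (hg : g ∈ Y.R c) : Y.toSheaf.obj.obj (op c) := ⟨g, hg⟩

/-- The function on points underlying an element of the sheaf of `Y`. -/
def valAt {c : C} (s : Y.toSheaf.obj.obj (op c)) : S.Pts c → Y.carrier :=
  Subtype.val (p := (· ∈ Y.R c)) s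

theorem valAt_mem {c : C} (s : Y.toSheaf.obj.obj (op c)) : valAt s ∈ Y.R c :=
  Subtype.prop (p := (· ∈ Y.R c)) s

theorem section_ext {c : C} {s t : Y.toSheaf.obj.obj (op c)} (h : ∀ x, valAt s x = valAt t x) :
    s = t :=
  Subtype.ext (funext h)

/-- The global element of the sheaf of `Y` given by an element of `|Y|`. -/
def globalOf (y : Y.carrier) : Global Y.toSheaf := secOf _ (Y.const_mem S.star y)

theorem globalOf_valAt {c : C} (s : Y.toSheaf.obj.obj (op c)) (x : S.Pts c) :
    globalOf (valAt s x) = atPt s x :=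
  section_ext fun x' => by
    rw [S.isTerminal.hom_ext x' (𝟙 _)]
    exact congrArg (valAt s) (Category.id_comp x).symm

theorem globalOf_injective : Function.Injective (globalOf (Y := Y)) := fun _ _ h =>
  congrFun (congrArg valAt h) (𝟙 S.star)

variable (Y) in
theorem isConcrete_toSheaf : S.IsConcrete Y.toSheaf := fun _ s t h => section_ext fun x =>
  globalOf_injective ((globalOf_valAt s x).trans ((congrFun h x).trans (globalOf_valAt t x).symm))

end ToSheaf

section Value

variable {Y : ConcreteSheaf S} {Z : S.Sh}

/-- The function on global elements given by a map to the sheaf of a concrete sheaf. -/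
def value (α : Z ⟶ Y.toSheaf) (z : Global Z) : Y.carrier := valAt (α.hom.app _ z) (𝟙 S.star)

theorem globalOf_value (α : Z ⟶ Y.toSheaf) (z : Global Z) :
    globalOf (value α z) = α.hom.app _ z :=
  (globalOf_valAt _ _).trans (atPt_global _ _)

theorem valAt_app (α : Z ⟶ Y.toSheaf) {c : C} (z : Z.obj.obj (op c)) (x : S.Pts c) :
    valAt (α.hom.app _ z) x = value α (atPt z x) :=
  globalOf_injective ((globalOf_valAt _ x).trans
    ((atPt_app α z x).trans (globalOf_value α _).symm))

theorem value_mem (α : Z ⟶ Y.toSheaf) {c : C} (z : Z.obj.obj (op c)) :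
    (fun x => value α (atPt z x)) ∈ Y.R c := by
  simp only [← valAt_app]
  exact valAt_mem _

theorem toSheaf_hom_ext {α β : Z ⟶ Y.toSheaf} (h : ∀ z, value α z = value β z) : α = β := by
  ext c z
  exact section_ext fun x => (valAt_app α z x).trans ((h _).trans (valAt_app β z x).symm)

/-- The map to the sheaf of a concrete sheaf given by a function on global elements. -/
def homOfValue (v : Global Z → Y.carrier)
    (hv : ∀ (c : C) (z : Z.obj.obj (op c)), (fun x => v (atPt z x)) ∈ Y.R c) : Z ⟶ Y.toSheaf :=
  ⟨{ app c := TypeCat.ofHom fun z => secOf (fun x => v (atPt z x)) (hv c.unop z)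
     naturality c d f := by
      ext z
      exact section_ext fun x => congrArg v (atPt_map f.unop z x) }⟩

theorem value_homOfValue (v : Global Z → Y.carrier)
    (hv : ∀ (c : C) (z : Z.obj.obj (op c)), (fun x => v (atPt z x)) ∈ Y.R c) (z : Global Z) :
    value (homOfValue v hv) z = v z :=
  congrArg v (atPt_global z _)

variable {Y' : ConcreteSheaf S}

/-- The map of sheaves given by a function that preserves the relations. -/
def mapSheaf (f : Y.carrier → Y'.carrier)
    (hf : ∀ ⦃c : C⦄ ⦃g : S.Pts c → Y.carrier⦄, g ∈ Y.R c → (fun x => f (g x)) ∈ Y'.R c) :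
    Y.toSheaf ⟶ Y'.toSheaf :=
  ⟨{ app _ := TypeCat.ofHom fun g => secOf (fun x => f (valAt g x)) (hf (valAt_mem g)) }⟩

theorem value_globalOf_mem (α : Y.toSheaf ⟶ Y'.toSheaf) {c : C} {g : S.Pts c → Y.carrier}
    (hg : g ∈ Y.R c) : (fun x => value α (globalOf (g x))) ∈ Y'.R c := by
  have h := value_mem α (secOf g hg)
  simp only [← globalOf_valAt] at h
  exact h

theorem mapSheaf_value (α : Y.toSheaf ⟶ Y'.toSheaf) :
    mapSheaf (fun y => value α (globalOf y)) (fun _ _ => value_globalOf_mem α) = α :=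
  toSheaf_hom_ext fun z => congrArg (value α)
    ((globalOf_valAt (Y := Y) z (𝟙 _)).trans (atPt_global z _))

/-- The isomorphism of sheaves given by a bijection that preserves and reflects the relations. -/
def mapSheafIso (e : Y.carrier ≃ Y'.carrier)
    (he : ∀ {c : C} {g : S.Pts c → Y.carrier}, g ∈ Y.R c ↔ (fun x => e (g x)) ∈ Y'.R c) :
    Y.toSheaf ≅ Y'.toSheaf where
  hom := mapSheaf e fun _ _ => he.1
  inv := mapSheaf e.symm fun _ _ hg => he.2 (by simpa only [e.apply_symm_apply] using hg)
  hom_inv_id := toSheaf_hom_ext fun _ => e.symm_apply_apply _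
  inv_hom_id := toSheaf_hom_ext fun _ => e.apply_symm_apply _

end Value

end ConcreteSheaf

/-! ### The functor to sheaves on the combined site -/

open ConcreteSheaf

namespace OmegaConc

variable {C : Type u} [SmallCategory C] {S : ConcreteSite C}

section Vertical

variable (X : OmegaConc S)

/-- The relations of `X` on the combined site: those of `X` on the objects of `C`, and the
continuous functions on `V`. -/
def verticalR : ∀ a : S.Comb, Set (S.comb.Pts a → X.carrier)
  | .of c => {g | (fun x => g (ofPts c x)) ∈ X.R c}
  | .vert => {g | ωScottContinuous fun n => g (S.vertPts n)}

variable {X}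

theorem verticalR_const (a : S.Comb) (x : X.carrier) : (fun _ => x) ∈ X.verticalR a := by
  cases a with
  | of c => exact X.const_mem c x
  | vert => exact ωScottContinuous.const

theorem verticalR_comp {a b : S.Comb} (f : b ⟶ a) {g : S.comb.Pts a → X.carrier}
    (hg : g ∈ X.verticalR a) : (fun x => g (x ≫ f)) ∈ X.verticalR b := by
  have const (hf : S.comb.IsConst f) : (fun x => g (x ≫ f)) ∈ X.verticalR b := by
    obtain ⟨y, rfl⟩ := hf
    simp only [pts_comp_from]
    exact verticalR_const b _
  rcases a with a | _ <;> rcases b with b | _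
  · obtain ⟨f, rfl⟩ := S.incl.map_surjective f
    have h := X.comp_mem f hg
    simp only [← ofPts_comp_incl] at h
    exact h
  · exact const (isConst_vert_of f)
  · exact const (isConst_of_vert f)
  · obtain ⟨f, hf, rfl⟩ := exists_eq_vertMap f
    exact ωScottContinuous.comp (g := fun n => g (S.vertPts n)) hg hf

theorem verticalR_glue {a : S.Comb} (T : Presieve a) (hT : T ∈ S.comb.J a)
    (g : S.comb.Pts a → X.carrier)
    (h : ∀ ⦃b : S.Comb⦄ ⦃f : b ⟶ a⦄, T f → (fun x => g (x ≫ f)) ∈ X.verticalR b) :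
    g ∈ X.verticalR a := by
  cases a with
  | of c =>
    obtain ⟨R, hR, rfl⟩ := hT
    refine X.glue_mem R hR _ fun d f hf => ?_
    have hgf : (fun x => g (ofPts d x ≫ S.incl.map f)) ∈ X.R d := h (Presieve.map_map hf)
    convert hgf using 2 with x
    exact congrArg g (ofPts_comp_incl x f).symm
  | vert =>
    obtain rfl := hT
    have hg := h (Presieve.singleton_self (𝟙 _))
    simp only [Category.comp_id] at hg
    exact hg

variable (X) in
/-- The concrete sheaf on the combined site given by an `ω`-concrete sheaf. -/
def vertical : ConcreteSheaf S.comb where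
  carrier := X.carrier
  R := X.verticalR
  const_mem := verticalR_const
  comp_mem := verticalR_comp
  glue_mem := verticalR_glue

instance : OmegaCompletePartialOrder X.vertical.carrier :=
  inferInstanceAs (OmegaCompletePartialOrder X.carrier)

theorem ωSup_mem_vertical {a : S.Comb} (s : Chain (S.comb.Pts a → X.carrier))
    (hs : ∀ n, s n ∈ X.vertical.R a) : ωSup s ∈ X.vertical.R a := by
  cases a with
  | of c =>
    exact X.sup_mem (s.map ⟨fun g x => g (ofPts c x), fun _ _ h x => h (ofPts c x)⟩) hs
  | vert =>
    change ∀ n, ωScottContinuous fun k => s n (S.vertPts k) at hs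
    have hmono : Monotone fun k => (ωSup s : S.comb.Pts .vert → X.carrier) (S.vertPts k) :=
      fun _ _ h => ωSup_le_ωSup_of_le fun n => ⟨n, (hs n).monotone h⟩
    refine (ωScottContinuous_enat_iff hmono).2 (ωSup_le _ _ fun n => ?_)
    refine ((ωScottContinuous_enat_iff (hs n).monotone).1 (hs n)).trans
      (ωSup_le_ωSup_of_le fun k => ⟨k, ?_⟩)
    exact le_ωSup s n (S.vertPts k)

theorem mem_vertical_comp_symm {c : C} {g : S.Pts c → X.carrier} (hg : g ∈ X.R c) :
    (fun x => g ((ofPts c).symm x)) ∈ X.vertical.R (.of c) := by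
  change (fun x => g ((ofPts c).symm (ofPts c x))) ∈ X.R c
  simpa only [Equiv.symm_apply_apply] using hg

theorem mem_vertical_vert_comp_symm {f : ℕ∞ → X.carrier} (hf : ωScottContinuous f) :
    (fun x => f (S.vertPts.symm x)) ∈ X.vertical.R .vert :=
  hf

end Vertical

variable {X Y : OmegaConc S}

theorem Hom.map_mem_vertical (f : Hom X Y) {a : S.Comb} {g : S.comb.Pts a → X.carrier}
    (hg : g ∈ X.vertical.R a) : (fun x => f.toFun (g x)) ∈ Y.vertical.R a := by
  cases a with
  | of c => exact f.map_mem hg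
  | vert => exact f.continuous.comp hg

/-- A function that preserves the relations on the combined site is a morphism of `ω`-concrete
sheaves: it is continuous because it preserves the relation on `V`. -/
def Hom.ofVertical (f : X.carrier → Y.carrier)
    (hf : ∀ ⦃a : S.Comb⦄ ⦃g : S.comb.Pts a → X.carrier⦄, g ∈ X.vertical.R a →
      (fun x => f (g x)) ∈ Y.vertical.R a) : Hom X Y where
  toFun := f
  continuous := ωScottContinuous_of_comp_enat fun _ hs => hf (mem_vertical_vert_comp_symm hs)
  map_mem {c g} hg := by
    have h : (fun x => f (g ((ofPts c).symm (ofPts c x)))) ∈ Y.R c :=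
      hf (mem_vertical_comp_symm hg)
    simpa only [Equiv.symm_apply_apply] using h

variable (S) in
/-- The functor from `ω`-concrete sheaves on `(C, J)` to sheaves on `(C + V₀, J ∪ J_V)`. -/
def realize : OmegaConc S ⥤ S.comb.Sh where
  obj X := X.vertical.toSheaf
  map f := mapSheaf f.toFun fun _ _ => Hom.map_mem_vertical f

theorem value_comp_realize_map {Z : S.comb.Sh} (α : Z ⟶ X.vertical.toSheaf) (f : X ⟶ Y)
    (z : Global Z) :
    value (Y := Y.vertical) (α ≫ (realize S).map f) z = f.toFun (value (Y := X.vertical) α z) :=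
  rfl

instance : (realize S).Faithful where
  map_injective {X Y _ _} h := hom_ext fun x =>
    congrArg (fun α : X.vertical.toSheaf ⟶ Y.vertical.toSheaf => value α (globalOf x)) h

instance : (realize S).Full where
  map_surjective {X Y} α :=
    ⟨.ofVertical (fun x => value (Y := Y.vertical) α (globalOf (Y := X.vertical) x))
      fun _ _ => value_globalOf_mem (Y := X.vertical) (Y' := Y.vertical) α,
      mapSheaf_value (Y := X.vertical) (Y' := Y.vertical) α⟩

end OmegaConc

/-! ### Products -/

namespace OmegaConc

variable {C : Type u} [SmallCategory C] {S : ConcreteSite C} {ι : Type u}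

section Products

variable (X : ι → OmegaConc S)

/-- The product of a family of `ω`-concrete sheaves. -/
def piObj : OmegaConc S where
  carrier := ∀ i, (X i).carrier
  R c := {g | ∀ i, (fun x => g x i) ∈ (X i).R c}
  const_mem c x i := (X i).const_mem c (x i)
  comp_mem h _ hg i := (X i).comp_mem h (hg i)
  glue_mem T hT _ h i := (X i).glue_mem T hT _ fun _ _ hf => h hf i
  sup_mem s hs i := (X i).sup_mem (s.map ⟨fun g x => g x i, fun _ _ h x => h x i⟩)
    fun n => hs n i

/-- The projections of a product. -/
def piProj (i : ι) : piObj X ⟶ X i where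
  toFun x := x i
  continuous := ωScottContinuous_iff_apply₂.1 ωScottContinuous.id i
  map_mem hg := hg i

/-- The universal property of the product of `ω`-concrete sheaves. -/
def isLimitPiFan : IsLimit (Fan.mk (piObj X) (piProj X)) :=
  Fan.IsLimit.mk _
    (fun s => ⟨fun x i => (s.proj i).toFun x,
      ωScottContinuous.of_apply₂ fun i => (s.proj i).continuous,
      fun hg i => (s.proj i).map_mem hg⟩)
    (fun _ _ => rfl)
    (fun s _ h => hom_ext fun x => funext fun i =>
      congrArg (fun f : s.pt ⟶ X i => f.toFun x) (h i))

instance : HasProducts.{u} (OmegaConc S) :=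
  hasProducts_of_limit_fans (fun X => Fan.mk (piObj X) (piProj X)) isLimitPiFan

variable {X}

theorem mem_vertical_piObj {a : S.Comb} {g : S.comb.Pts a → (piObj X).carrier} :
    g ∈ (piObj X).vertical.R a ↔ ∀ i, (fun x => g x i) ∈ (X i).vertical.R a := by
  cases a with
  | of c => exact Iff.rfl
  | vert => exact ωScottContinuous_iff_apply₂

/-- The map to the sheaf of a product given by maps to the sheaves of the factors. -/
def realizePiLift {Z : S.comb.Sh} (α : ∀ i, Z ⟶ (X i).vertical.toSheaf) :
    Z ⟶ (piObj X).vertical.toSheaf :=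
  homOfValue (Z := Z) (Y := (piObj X).vertical) (fun z i => value (Y := (X i).vertical) (α i) z)
    fun _ z => mem_vertical_piObj.2 fun i => value_mem (Y := (X i).vertical) (α i) z

theorem value_realizePiLift {Z : S.comb.Sh} (α : ∀ i, Z ⟶ (X i).vertical.toSheaf) (z : Global Z) :
    value (Y := (piObj X).vertical) (realizePiLift α) z =
      fun i => value (Y := (X i).vertical) (α i) z :=
  value_homOfValue (Y := (piObj X).vertical) _ _ z

variable (X) in
/-- The functor to sheaves maps the product of `ω`-concrete sheaves to a product. -/
def isLimitRealizePiFan :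
    IsLimit (Fan.mk ((realize S).obj (piObj X)) fun i => (realize S).map (piProj X i)) :=
  Fan.IsLimit.mk _ (fun s => realizePiLift (Z := s.pt) s.proj)
    (fun s i => toSheaf_hom_ext fun z =>
      (value_comp_realize_map _ (piProj X i) z).trans
        (congrFun (value_realizePiLift (Z := s.pt) s.proj z) i))
    (fun s _ h => toSheaf_hom_ext (Y := (piObj X).vertical) (Z := s.pt) fun z => Eq.trans
      (funext fun i => congrArg (value (Y := (X i).vertical) · z) (h i))
      (value_realizePiLift (Z := s.pt) s.proj z).symm)

instance preservesProducts_realize : PreservesLimitsOfShape (Discrete ι) (realize S) where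
  preservesLimit {K} :=
    have : PreservesLimit (Discrete.functor (K.obj ∘ Discrete.mk)) (realize S) :=
      preservesLimit_of_preserves_limit_cone (isLimitPiFan _)
        ((isLimitMapConeFanMkEquiv _ _ _).symm (isLimitRealizePiFan _))
    preservesLimit_of_iso_diagram (realize S) Discrete.natIsoFunctor.symm

instance preservesBinaryProducts_realize :
    PreservesLimitsOfShape (Discrete WalkingPair) (realize S) :=
  preservesLimitsOfShape_of_equiv
    (Discrete.equivalence (Equiv.ulift.{u} : ULift WalkingPair ≃ WalkingPair)) (realize S)

end Products

end OmegaConc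

/-! ### Coproducts -/

section Sigma

variable {ι : Type*} {α : ι → Type*} [∀ i, OmegaCompletePartialOrder (α i)]

theorem exists_eq_mk_of_le {i : ι} {x : α i} {y : Σ i, α i} (h : ⟨i, x⟩ ≤ y) :
    ∃ z : α i, y = ⟨i, z⟩ := by
  obtain ⟨j, y⟩ := y
  obtain ⟨rfl : i = j, -⟩ := Sigma.le_def.1 h
  exact ⟨y, rfl⟩

theorem exists_chain_eq_mk (c : Chain (Σ i, α i)) {i : ι} {x : α i} (h : c 0 = ⟨i, x⟩) :
    ∃ d : Chain (α i), ∀ n, c n = ⟨i, d n⟩ := by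
  choose d hd using fun n => exists_eq_mk_of_le (h ▸ c.monotone (Nat.zero_le n))
  refine ⟨⟨d, fun m n hmn => ?_⟩, hd⟩
  rw [← Sigma.mk_le_mk_iff, ← hd, ← hd]
  exact c.monotone hmn

theorem isLUB_range_mk {i : ι} {c : Chain (Σ i, α i)} (d : Chain (α i)) (h : ∀ n, c n = ⟨i, d n⟩) :
    IsLUB (Set.range c) (⟨i, ωSup d⟩ : Σ i, α i) := by
  refine ⟨?_, fun y hy => ?_⟩
  · rintro _ ⟨n, rfl⟩
    exact (h n).le.trans (Sigma.mk_le_mk_iff.2 (le_ωSup d n))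
  · have hd n : ⟨i, d n⟩ ≤ y := (h n).ge.trans (hy ⟨n, rfl⟩)
    obtain ⟨y, rfl⟩ := exists_eq_mk_of_le (hd 0)
    exact Sigma.mk_le_mk_iff.2 (ωSup_le d y fun n => Sigma.mk_le_mk_iff.1 (hd n))

/-- The disjoint union of `ω`cpos. -/
instance sigmaOmegaCompletePartialOrder : OmegaCompletePartialOrder (Σ i, α i) where
  ωSup c := ⟨(c 0).1, ωSup (exists_chain_eq_mk c (x := (c 0).2) rfl).choose⟩
  le_ωSup c n := (isLUB_range_mk _ (exists_chain_eq_mk c rfl).choose_spec).1 ⟨n, rfl⟩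
  ωSup_le c _ hx := (isLUB_range_mk _ (exists_chain_eq_mk c rfl).choose_spec).2
    (Set.forall_mem_range.2 hx)

theorem ωSup_eq_mk (c : Chain (Σ i, α i)) {i : ι} (d : Chain (α i)) (h : ∀ n, c n = ⟨i, d n⟩) :
    ωSup c = ⟨i, ωSup d⟩ :=
  (isLUB_range_ωSup c).unique (isLUB_range_mk d h)

theorem ωScottContinuous_sigma_mk (i : ι) :
    ωScottContinuous fun x : α i => (⟨i, x⟩ : Σ i, α i) :=
  ωScottContinuous.of_monotone_map_ωSup ⟨fun _ _ h => Sigma.mk_le_mk_iff.2 h, fun d =>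
    (ωSup_eq_mk (d.map ⟨_, fun _ _ h => Sigma.mk_le_mk_iff.2 h⟩) d fun _ => rfl).symm⟩

theorem ωScottContinuous_sigma_desc {β : Type*} [OmegaCompletePartialOrder β] {f : (Σ i, α i) → β}
    (hf : ∀ i, ωScottContinuous fun x : α i => f ⟨i, x⟩) : ωScottContinuous f := by
  have hm : Monotone f := by
    rintro ⟨i, x⟩ y h
    obtain ⟨z, rfl⟩ := exists_eq_mk_of_le h
    exact (hf i).monotone (Sigma.mk_le_mk_iff.1 h)
  refine ωScottContinuous.of_monotone_map_ωSup ⟨hm, fun c => ?_⟩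
  obtain ⟨d, hd⟩ := exists_chain_eq_mk c (x := (c 0).2) rfl
  rw [ωSup_eq_mk c d hd]
  refine ((hf _).map_ωSup d).trans (congrArg ωSup ?_)
  ext n
  exact congrArg f (hd n).symm

theorem exists_eq_mk_of_ωScottContinuous_enat {f : ℕ∞ → Σ i, α i} (hf : ωScottContinuous f) :
    ∃ (i : ι) (g : ℕ∞ → α i), ωScottContinuous g ∧ ∀ n, f n = ⟨i, g n⟩ := by
  choose g hg using fun n => exists_eq_mk_of_le (x := (f 0).2) (hf.monotone (zero_le (a := n)))
  have hm : Monotone g := fun m n h => by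
    rw [← Sigma.mk_le_mk_iff, ← hg, ← hg]
    exact hf.monotone h
  refine ⟨_, g, (ωScottContinuous_enat_iff hm).2 ?_, hg⟩
  rw [← Sigma.mk_le_mk_iff, ← hg]
  exact ((ωScottContinuous_enat_iff hf.monotone).1 hf).trans
    (ωSup_eq_mk _ (finiteValues g hm) fun n => hg n).le

end Sigma

namespace ConcreteSite

variable {C : Type u} [SmallCategory C]

/-- The condition that the empty family covers every object without points, under which coproducts
of concrete sheaves are disjoint unions. -/
def CoversEmpty (S : ConcreteSite C) : Prop :=
  ∀ c : C, IsEmpty (S.Pts c) → (⊥ : Presieve c) ∈ S.J c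

variable {S : ConcreteSite C}

theorem coversEmpty_of_isAdmissible (M : MorphismProperty C) [S.IsAdmissible M] :
    S.CoversEmpty := fun c hc => by
  obtain ⟨k⟩ := nonempty_hom_zero M hc
  obtain ⟨R, hR, hR'⟩ := S.J.pullback k ⊥ S.empty_mem
  convert hR
  refine le_antisymm bot_le fun d f hf => ?_
  obtain ⟨_, _, _, h, _⟩ := hR' hf
  exact h

theorem CoversEmpty.comb (hS : S.CoversEmpty) : S.comb.CoversEmpty := by
  rintro (c | _) hc
  · refine ⟨⊥, hS c ((ofPts c).isEmpty_congr.2 hc), le_antisymm bot_le ?_⟩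
    rintro _ _ ⟨h⟩
    exact h
  · exact hc.elim (S.vertPts 0)

theorem CoversEmpty.subsingleton (hS : S.CoversEmpty) (Z : S.Sh) {c : C}
    (hc : IsEmpty (S.Pts c)) : Subsingleton (Z.obj.obj (op c)) := by
  have h : (⊥ : Sieve c) ∈ S.topology c :=
    Sieve.generate_bot (X := c) ▸ Coverage.Saturate.of (K := S.J) c ⊥ (hS c hc)
  obtain ⟨_, -, hu⟩ := existsUnique_of_empty_cover
    ((isSheaf_iff_isSheaf_of_type _ _).1 Z.property) h
  exact ⟨fun y z => (hu y trivial).trans (hu z trivial).symm⟩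

end ConcreteSite

namespace ConcreteSheaf

variable {C : Type u} [SmallCategory C] {S : ConcreteSite C} {ι : Type u}

section Coproducts

/-- The maps along which a function to a disjoint union is an element of one of the summands. -/
def summandSieve {Y : ι → ConcreteSheaf S} {c : C} (g : S.Pts c → Σ i, (Y i).carrier) :
    Sieve c where
  arrows d f := ∃ i, ∃ h ∈ (Y i).R d, ∀ x, g (x ≫ f) = ⟨i, h x⟩
  downward_closed {_ _ f} := by
    rintro ⟨i, h, hh, e⟩ k
    exact ⟨i, _, (Y i).comp_mem k hh, fun x => by rw [← e, Category.assoc]⟩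

theorem exists_le_summandSieve_mk {Y : ι → ConcreteSheaf S} {c : C} {i : ι}
    {g : S.Pts c → (Y i).carrier} (hg : g ∈ (Y i).R c) :
    ∃ T ∈ S.J c, T ≤ (summandSieve (Y := Y) fun x => ⟨i, g x⟩).arrows := by
  refine ⟨_, S.id_mem c, ?_⟩
  rintro _ _ ⟨⟩
  exact ⟨i, g, hg, fun x => by rw [Category.comp_id]⟩

variable (Y : ι → ConcreteSheaf S)

/-- The coproduct of concrete sheaves: the functions that are locally in one of the summands. -/
def sigma : ConcreteSheaf S where
  carrier := Σ i, (Y i).carrier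
  R c := {g | ∃ T ∈ S.J c, T ≤ (summandSieve g).arrows}
  const_mem c y := exists_le_summandSieve_mk ((Y y.1).const_mem c y.2)
  comp_mem {c d} h g := by
    rintro ⟨T, hT, hg⟩
    obtain ⟨Q, hQ, hQT⟩ := S.J.pullback h T hT
    refine ⟨Q, hQ, fun e k hk => ?_⟩
    obtain ⟨b, i, l, hl, hil⟩ := hQT hk
    obtain ⟨j, r, hr, hrl⟩ := hg _ _ hl
    refine ⟨j, _, (Y j).comp_mem i hr, fun x => (congrArg g ?_).trans (hrl (x ≫ i))⟩
    rw [Category.assoc, Category.assoc, hil]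
  glue_mem {c} T hT g h := by
    choose R hR hR' using h
    refine ⟨_, S.bind_mem T R hT hR, ?_⟩
    rintro d _ ⟨e, k, f, hf, hk, rfl⟩
    obtain ⟨i, r, hr, hrk⟩ := hR' hf _ _ hk
    exact ⟨i, r, hr, fun x => (congrArg g (Category.assoc x k f).symm).trans (hrk x)⟩

variable {Y}

theorem mem_of_mk_mem_sigma (hS : S.CoversEmpty) {c : C} {i : ι} {g : S.Pts c → (Y i).carrier}
    (hg : (fun x => ⟨i, g x⟩) ∈ (sigma Y).R c) : g ∈ (Y i).R c := by
  obtain ⟨T, hT, h⟩ := hg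
  refine (Y i).glue_mem T hT g fun d f hf => ?_
  obtain ⟨j, r, hr, e⟩ := h _ _ hf
  rcases isEmpty_or_nonempty (S.Pts d) with hd | ⟨⟨x⟩⟩
  · exact (Y i).glue_mem ⊥ (hS d hd) _ fun _ _ h => h.elim
  · obtain rfl : i = j := congrArg Sigma.fst (e x)
    convert hr using 2 with x
    exact eq_of_heq (Sigma.mk.inj (e x)).2

theorem summandSieve_mem {c : C} {g : S.Pts c → (sigma Y).carrier} (hg : g ∈ (sigma Y).R c) :
    summandSieve g ∈ S.topology c := by
  obtain ⟨T, hT, h⟩ := hg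
  exact S.topology.superset_covering ((Sieve.generate_le_iff T _).2 h)
    (Coverage.Saturate.of (K := S.J) c T hT)

variable (Y) in
/-- The inclusions of the summands of a coproduct of concrete sheaves. -/
def sigmaIncl (i : ι) : (Y i).toSheaf ⟶ (sigma Y).toSheaf :=
  mapSheaf (fun y => (⟨i, y⟩ : Σ i, (Y i).carrier)) fun _ _ => exists_le_summandSieve_mk

variable {Z : S.Sh} (β : ∀ i, (Y i).toSheaf ⟶ Z)

theorem app_eq_of_mk_eq (hS : S.CoversEmpty) {c : C} {i j : ι} {g : S.Pts c → (Y i).carrier}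
    {h : S.Pts c → (Y j).carrier} (hg : g ∈ (Y i).R c) (hh : h ∈ (Y j).R c)
    (e : ∀ x, (⟨i, g x⟩ : Σ i, (Y i).carrier) = ⟨j, h x⟩) :
    (β i).hom.app (op c) (secOf g hg) = (β j).hom.app (op c) (secOf h hh) := by
  rcases isEmpty_or_nonempty (S.Pts c) with hc | ⟨⟨x⟩⟩
  · exact (hS.subsingleton Z hc).elim _ _
  · obtain rfl : i = j := congrArg Sigma.fst (e x)
    obtain rfl : g = h := funext fun x => eq_of_heq (Sigma.mk.inj (e x)).2
    rfl

/-- The condition that the restriction of `z` along every map that carries `g` to an element of a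
summand is the image of that element. -/
def IsSigmaDesc {c : C} (g : S.Pts c → Σ i, (Y i).carrier) (z : Z.obj.obj (op c)) : Prop :=
  ∀ ⦃d : C⦄ (f : d ⟶ c) (i : ι) (h : S.Pts d → (Y i).carrier) (hh : h ∈ (Y i).R d),
    (∀ x, g (x ≫ f) = ⟨i, h x⟩) → Z.obj.map f.op z = (β i).hom.app (op d) (secOf h hh)

theorem existsUnique_isSigmaDesc (hS : S.CoversEmpty) {c : C} {g : S.Pts c → (sigma Y).carrier}
    (hg : g ∈ (sigma Y).R c) : ∃! z, IsSigmaDesc β g z := by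
  have hZ := (isSheaf_iff_isSheaf_of_type _ _).1 Z.property _ (summandSieve_mem hg)
  choose i h hh e using fun (d : C) (f : d ⟶ c) (hf : summandSieve g f) => hf
  obtain ⟨z, hz, hzu⟩ := hZ (fun d f hf => (β (i d f hf)).hom.app (op d)
      (secOf (h d f hf) (hh d f hf))) ((Presieve.compatible_iff_sieveCompatible _).2
    fun b d f k hf => Eq.trans
      (app_eq_of_mk_eq β hS _ ((Y _).comp_mem k (hh b f hf)) fun x => by
        rw [← e, ← e, Category.assoc])
      (NatTrans.naturality_apply (β (i b f hf)).hom k.op (secOf _ (hh b f hf))))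
  refine ⟨z, fun d f j r hr er => ?_, fun z' hz' => hzu z' fun d f hf => hz' f _ _ _ (e d f hf)⟩
  exact (hz f ⟨j, r, hr, er⟩).trans
    (app_eq_of_mk_eq β hS _ hr fun x => (e d f _ x).symm.trans (er x))

theorem IsSigmaDesc.map {c d : C} {g : S.Pts c → Σ i, (Y i).carrier} {z : Z.obj.obj (op c)}
    (hz : IsSigmaDesc β g z) (k : d ⟶ c) :
    IsSigmaDesc β (fun x => g (x ≫ k)) (Z.obj.map k.op z) := fun e f i h hh hfh => by
  rw [← hz (f ≫ k) i h hh fun x =>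
    (congrArg g (Category.assoc x f k).symm).trans (hfh x)]
  exact (Functor.map_comp_apply Z.obj k.op f.op _).symm

/-- The map from the sheaf of a coproduct given by maps from the sheaves of the summands. -/
def sigmaDesc (hS : S.CoversEmpty) : (sigma Y).toSheaf ⟶ Z :=
  ⟨{ app _ := TypeCat.ofHom fun g => (existsUnique_isSigmaDesc β hS (valAt_mem g)).choose
     naturality c d k := by
      ext g
      exact ((existsUnique_isSigmaDesc β hS ((sigma Y).comp_mem k.unop
        (valAt_mem g))).choose_spec.2 _
        (IsSigmaDesc.map β (existsUnique_isSigmaDesc β hS (valAt_mem g)).choose_spec.1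
          k.unop)).symm }⟩

variable (Y) in
/-- The sheaf of a coproduct of concrete sheaves is a coproduct of their sheaves. -/
def isColimitSigmaCofan (hS : S.CoversEmpty) :
    IsColimit (Cofan.mk (sigma Y).toSheaf (sigmaIncl Y)) :=
  Cofan.IsColimit.mk _ (fun s => sigmaDesc (Z := s.pt) s.inj hS)
    (fun s i => by
      ext c g
      have h := (existsUnique_isSigmaDesc (Z := s.pt) s.inj hS
        (exists_le_summandSieve_mk (valAt_mem g))).choose_spec.1 (𝟙 _) i (valAt g) (valAt_mem g)
          fun x => by rw [Category.comp_id]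
      rw [op_id, Functor.map_id_apply] at h
      exact h)
    (fun s m h => by
      ext c g
      refine (existsUnique_isSigmaDesc (Z := s.pt) s.inj hS (valAt_mem g)).choose_spec.2 _
        fun d f i r hr e => ?_
      rw [← h i]
      refine (NatTrans.naturality_apply m.hom f.op g).symm.trans ?_
      exact congrArg (m.hom.app (op d)) (section_ext e))

end Coproducts

end ConcreteSheaf

namespace OmegaConc

variable {C : Type u} [SmallCategory C] {S : ConcreteSite C} {ι : Type u}

section Coproducts

variable {X : ι → OmegaConc S}

theorem ωSup_mem_sigma (hS : S.CoversEmpty) {c : C} (s : Chain (S.Pts c → Σ i, (X i).carrier))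
    (hs : ∀ n, s n ∈ (sigma fun i => (X i).toConcreteSheaf).R c) :
    ωSup s ∈ (sigma fun i => (X i).toConcreteSheaf).R c := by
  obtain ⟨T, hT, h⟩ := hs 0
  refine ⟨T, hT, fun d f hf => ?_⟩
  obtain ⟨i, r, -, h0⟩ := h _ _ hf
  choose t ht using fun x => exists_chain_eq_mk (s.map (Pi.evalOrderHom (x ≫ f))) (h0 x)
  let t' : Chain (S.Pts d → (X i).carrier) := ⟨fun n x => t x n, fun _ _ h x => (t x).monotone h⟩
  refine ⟨i, ωSup t', (X i).sup_mem t' fun n =>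
    mem_of_mk_mem_sigma (Y := fun i => (X i).toConcreteSheaf) hS ?_, fun x =>
    ωSup_eq_mk (s.map (Pi.evalOrderHom (x ≫ f))) (t x) (ht x)⟩
  rw [show (fun x => ⟨i, t' n x⟩) = fun x => s n (x ≫ f) from funext fun x => (ht x n).symm]
  exact ConcreteSheaf.comp_mem _ f (hs n)

variable (X) in
/-- The coproduct of a family of `ω`-concrete sheaves. -/
def sigmaObj (hS : S.CoversEmpty) : OmegaConc S where
  toConcreteSheaf := sigma fun i => (X i).toConcreteSheaf
  cpo := inferInstanceAs (OmegaCompletePartialOrder (Σ i, (X i).carrier))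
  sup_mem := ωSup_mem_sigma hS

variable (X) in
/-- The inclusions of the summands of a coproduct. -/
def sigmaInj (hS : S.CoversEmpty) (i : ι) : X i ⟶ sigmaObj X hS where
  toFun x := (⟨i, x⟩ : Σ i, (X i).carrier)
  continuous := ωScottContinuous_sigma_mk (α := fun i => (X i).carrier) i
  map_mem hg := exists_le_summandSieve_mk hg

/-- The map from a coproduct given by maps from the summands. -/
def sigmaElim (hS : S.CoversEmpty) {Z : OmegaConc S} (f : ∀ i, X i ⟶ Z) : sigmaObj X hS ⟶ Z where
  toFun := fun x : Σ i, (X i).carrier => (f x.1).toFun x.2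
  continuous := ωScottContinuous_sigma_desc (α := fun i => (X i).carrier) fun i => (f i).continuous
  map_mem {c g} := by
    rintro ⟨T, hT, h⟩
    refine Z.glue_mem T hT _ fun d k hk => ?_
    obtain ⟨i, r, hr, e⟩ := h _ _ hk
    convert (f i).map_mem hr using 2 with x
    rw [e x]

variable (X) in
/-- The universal property of the coproduct of `ω`-concrete sheaves. -/
def isColimitSigmaCofan (hS : S.CoversEmpty) :
    IsColimit (Cofan.mk (sigmaObj X hS) (sigmaInj X hS)) :=
  Cofan.IsColimit.mk _ (fun s => sigmaElim hS s.inj) (fun _ _ => rfl)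
    (fun s _ h => hom_ext fun (x : Σ i, (X i).carrier) =>
      congrArg (fun f : X x.1 ⟶ s.pt => f.toFun x.2) (h x.1))

theorem hasCoproducts (hS : S.CoversEmpty) : HasCoproducts.{u} (OmegaConc S) :=
  hasCoproducts_of_colimit_cofans (fun X => Cofan.mk (sigmaObj X hS) (sigmaInj X hS))
    fun X => isColimitSigmaCofan X hS

theorem mem_vertical_sigmaObj {hS : S.CoversEmpty} {a : S.Comb}
    {g : S.comb.Pts a → Σ i, (X i).carrier} :
    g ∈ (sigmaObj X hS).vertical.R a ↔ g ∈ (sigma fun i => (X i).vertical).R a := by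
  refine ⟨fun hg => ?_, ?_⟩
  · cases a with
    | of c =>
      obtain ⟨T, hT, h⟩ := hg
      refine ⟨T.map S.incl, ⟨T, hT, rfl⟩, ?_⟩
      rintro _ _ ⟨hf⟩
      obtain ⟨i, r, hr, e⟩ := h _ _ hf
      refine ⟨i, _, mem_vertical_comp_symm hr, (ofPts _).surjective.forall.2 fun x => ?_⟩
      exact ((congrArg g (ofPts_comp_incl x _)).trans (e x)).trans
        (congrArg (fun x => (⟨i, r x⟩ : Σ i, (X i).carrier)) ((ofPts _).symm_apply_apply x).symm)
    | vert =>
      obtain ⟨i, r, hr, e⟩ := exists_eq_mk_of_ωScottContinuous_enat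
        (α := fun i => (X i).carrier) hg
      rw [show g = fun x => ⟨i, r (S.vertPts.symm x)⟩ from
        funext (S.vertPts.surjective.forall.2 e)]
      exact exists_le_summandSieve_mk (Y := fun i => (X i).vertical)
        (mem_vertical_vert_comp_symm hr)
  · rintro ⟨T, hT, h⟩
    refine (sigmaObj X hS).vertical.glue_mem T hT _ fun b f hf => ?_
    obtain ⟨i, r, hr, e⟩ := h _ _ hf
    rw [show (fun x => g (x ≫ f)) = fun x => ⟨i, r x⟩ from funext e]
    exact Hom.map_mem_vertical (sigmaInj X hS i) hr

variable (X) in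
/-- The sheaf of a coproduct is the sheaf of the coproduct of the concrete sheaves on the combined
site. -/
def realizeSigmaIso (hS : S.CoversEmpty) :
    (sigma fun i => (X i).vertical).toSheaf ≅ (realize S).obj (sigmaObj X hS) :=
  mapSheafIso (Equiv.refl _) mem_vertical_sigmaObj.symm

variable (X) in
/-- The functor to sheaves maps coproducts to coproducts. -/
def isColimitRealizeSigmaCofan (hS : S.CoversEmpty) : IsColimit
    (Cofan.mk ((realize S).obj (sigmaObj X hS)) fun i => (realize S).map (sigmaInj X hS i)) :=
  (ConcreteSheaf.isColimitSigmaCofan (fun i => (X i).vertical) hS.comb).ofIsoColimit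
    (Cofan.ext (realizeSigmaIso X hS) fun _ => rfl)

theorem preservesCoproducts_realize (hS : S.CoversEmpty) :
    PreservesColimitsOfShape (Discrete ι) (realize S) where
  preservesColimit {K} :=
    have : PreservesColimit (Discrete.functor (K.obj ∘ Discrete.mk)) (realize S) :=
      preservesColimit_of_preserves_colimit_cocone (isColimitSigmaCofan _ hS)
        ((isColimitMapCoconeCofanMkEquiv _ _ _).symm (isColimitRealizeSigmaCofan _ hS))
    preservesColimit_of_iso_diagram (realize S) Discrete.natIsoFunctor.symm

end Coproducts

end OmegaConc

/-! ### Exponentials -/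

open OmegaConc MonoidalCategory CartesianMonoidalCategory

section Exponentials

variable {C : Type u} [SmallCategory C] {S : ConcreteSite C} {X Y : OmegaConc S} {Z W : S.comb.Sh}

/-- The element of a product of sheaves given by a pair of elements. -/
def pairAt {a : S.Comb} (w : W.obj.obj (op a)) (z : Z.obj.obj (op a)) :
    (W ⊗ Z).obj.obj (op a) := (w, z)

/-- The global element of `FX × Z` given by an element of `|X|` and a global element of `Z`. -/
def globalPair (x : X.carrier) (z : Global Z) : Global ((realize S).obj X ⊗ Z) :=
  pairAt (a := S.comb.star) (globalOf (Y := X.vertical) x) z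

theorem surjective_globalPair (w : Global ((realize S).obj X ⊗ Z)) :
    ∃ (x : X.carrier) (z : Global Z), globalPair x z = w := by
  obtain ⟨p, z⟩ := w
  exact ⟨_, z, congrArg (pairAt (a := S.comb.star) · z)
    ((globalOf_valAt (Y := X.vertical) p (𝟙 _)).trans (atPt_global _ _))⟩

theorem value_globalPair_mem (φ : (realize S).obj X ⊗ Z ⟶ (realize S).obj Y) {a : S.Comb}
    {k : S.comb.Pts a → X.carrier} (hk : k ∈ X.vertical.R a) (z : Z.obj.obj (op a)) :
    (fun x => value (Y := Y.vertical) φ (globalPair (k x) (atPt z x))) ∈ Y.vertical.R a := by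
  have h := value_mem (Y := Y.vertical) φ
    (pairAt (W := (realize S).obj X) (secOf (Y := X.vertical) k hk) z)
  convert h using 3 with x
  exact congrArg (pairAt (a := S.comb.star) · _) (globalOf_valAt (Y := X.vertical) (secOf k hk) x)

/-- The evaluation `FX × F(Y ^ X) ⟶ FY`. -/
def realizeEv (X Y : OmegaConc S) :
    (realize S).obj X ⊗ (realize S).obj ((ihom X).obj Y) ⟶ (realize S).obj Y :=
  inv (CartesianMonoidalCategory.prodComparison (realize S) X ((ihom X).obj Y)) ≫
    (realize S).map ((ihom.ev X).app Y)

theorem value_realizeEv (x : X.carrier) (f : Hom X Y) :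
    value (Y := Y.vertical) (realizeEv X Y)
      (globalPair x (globalOf (Y := ((ihom X).obj Y).vertical) f)) = f.toFun x := by
  let comparison := CartesianMonoidalCategory.prodComparison (realize S) X ((ihom X).obj Y)
  let pair : (X ⊗ (ihom X).obj Y).carrier := (x, f)
  have h : comparison.hom.app _ (globalOf (Y := (X ⊗ (ihom X).obj Y).vertical) pair) =
      globalPair x (globalOf (Y := ((ihom X).obj Y).vertical) f) := rfl
  exact (congrArg (value (Y := Y.vertical) (realizeEv X Y)) h.symm).trans
    (congrArg (value (Y := Y.vertical) · (globalOf (Y := (X ⊗ (ihom X).obj Y).vertical) pair))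
      (IsIso.hom_inv_id_assoc comparison ((realize S).map ((ihom.ev X).app Y))))

theorem value_whiskerLeft_comp_realizeEv (h : Z ⟶ (realize S).obj ((ihom X).obj Y))
    (x : X.carrier) (z : Global Z) :
    value (Y := Y.vertical) ((realize S).obj X ◁ h ≫ realizeEv X Y) (globalPair x z) =
      Hom.toFun (X := X) (Y := Y) (value (Y := ((ihom X).obj Y).vertical) h z) x :=
  (congrArg (fun p => value (Y := Y.vertical) (realizeEv X Y) (globalPair x p))
    (globalOf_value (Y := ((ihom X).obj Y).vertical) h z).symm).trans (value_realizeEv x _)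

theorem mem_vertical_ihom {a : S.Comb} {g : S.comb.Pts a → Hom X Y}
    (h : ∀ {b : S.Comb} (f : b ⟶ a) {k : S.comb.Pts b → X.carrier}, k ∈ X.vertical.R b →
      (fun x => (g (x ≫ f)).toFun (k x)) ∈ Y.vertical.R b) :
    g ∈ ((ihom X).obj Y).vertical.R a := by
  cases a with
  | of c =>
    intro d f k hk
    have hgk : (fun x => (g (ofPts d x ≫ S.incl.map f)).toFun
        (k ((ofPts d).symm (ofPts d x)))) ∈ Y.R d :=
      h (b := .of d) (S.incl.map f) (mem_vertical_comp_symm hk)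
    simp only [Equiv.symm_apply_apply] at hgk
    rwa [show (fun x => (g (ofPts d x ≫ S.incl.map f)).toFun (k x)) =
      fun x => (g (ofPts c (x ≫ f))).toFun (k x) from
        funext fun x => congrArg (fun y => (g y).toFun (k x)) (ofPts_comp_incl x f)] at hgk
  | vert =>
    have hx x : ωScottContinuous fun n => (g (S.vertPts n)).toFun x := by
      have := h (𝟙 _) (X.vertical.const_mem .vert x)
      simp only [Category.comp_id] at this
      exact this
    have hg : Monotone fun n => (g (S.vertPts n) : Hom X Y) := fun _ _ hmn x =>
      (hx x).monotone hmn
    exact (ωScottContinuous_enat_iff (α := Hom X Y) hg).2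
      fun x => (ωScottContinuous_enat_iff (hx x).monotone).1 (hx x)

/-- The map `X ⟶ Y` obtained by fixing the second argument of a map on sheaves. -/
def fixSecond (φ : (realize S).obj X ⊗ Z ⟶ (realize S).obj Y) (z : Global Z) : Hom X Y :=
  .ofVertical (fun x => value (Y := Y.vertical) φ (globalPair x z)) fun a g hg => by
    have h := value_globalPair_mem φ hg (constAt a z)
    simp only [atPt_constAt] at h
    exact h

/-- Currying for maps between sheaves of `ω`-concrete sheaves. -/
def realizeCurry (φ : (realize S).obj X ⊗ Z ⟶ (realize S).obj Y) :
    Z ⟶ (realize S).obj ((ihom X).obj Y) :=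
  homOfValue (Y := ((ihom X).obj Y).vertical) (fixSecond φ) fun _ z =>
    mem_vertical_ihom fun f k hk => by
      have h := value_globalPair_mem φ hk (Z.obj.map f.op z)
      simp only [atPt_map] at h
      exact h

theorem bijective_whiskerLeft_comp_realizeEv (X Y : OmegaConc S) (Z : S.comb.Sh) :
    Function.Bijective fun h : Z ⟶ (realize S).obj ((ihom X).obj Y) =>
      (realize S).obj X ◁ h ≫ realizeEv X Y := by
  constructor
  · intro h h' e
    refine toSheaf_hom_ext fun z => hom_ext (X := X) (Y := Y) fun x => ?_
    exact (value_whiskerLeft_comp_realizeEv h x z).symm.trans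
      ((congrArg (value (Y := Y.vertical) · (globalPair x z)) e).trans
        (value_whiskerLeft_comp_realizeEv h' x z))
  · refine fun φ => ⟨realizeCurry φ, toSheaf_hom_ext (Y := Y.vertical) fun w => ?_⟩
    obtain ⟨x, z, rfl⟩ := surjective_globalPair w
    refine (value_whiskerLeft_comp_realizeEv (realizeCurry φ) x z).trans ?_
    exact congrArg (fun f : Hom X Y => f.toFun x)
      (value_homOfValue (Y := ((ihom X).obj Y).vertical) (fixSecond φ) _ z)

instance monoidalClosedFunctor_realize : MonoidalClosedFunctor (realize S) where
  comparison_iso X := by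
    refine @NatIso.isIso_of_isIso_app _ _ _ _ _ _ _ fun Y => ?_
    rw [isIso_iff_yoneda_map_bijective]
    intro Z
    refine (Function.Bijective.of_comp_iff'
      ((ihom.adjunction ((realize S).obj X)).homEquiv Z ((realize S).obj Y)).symm.bijective _).1 ?_
    convert bijective_whiskerLeft_comp_realizeEv X Y Z using 2 with h
    refine (MonoidalClosed.uncurry_natural_left h _).trans ?_
    exact congrArg ((realize S).obj X ◁ h ≫ ·) (uncurry_expComparison (realize S) X Y)

end Exponentials

/-! ### Lifting -/

section WithBot

variable {α : Type u} {β : Type*} [OmegaCompletePartialOrder α] [OmegaCompletePartialOrder β]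

theorem ωScottContinuous_ne_bot : ωScottContinuous fun x : WithBot α => x ≠ ⊥ :=
  .of_monotone_map_ωSup ⟨fun _ _ hxy hx => ne_bot_of_le_ne_bot hx hxy, fun s =>
    propext ((withBot_ωSup_ne_bot s).trans (ωSup_prop_iff (s.map ⟨(· ≠ ⊥), _⟩)).symm)⟩

theorem ωScottContinuous_coe_withBot_iff {f : β → α} :
    (ωScottContinuous fun x => (f x : WithBot α)) ↔ ωScottContinuous f := by
  refine ⟨fun hf => .of_monotone_map_ωSup ⟨fun x y hxy => WithBot.coe_le_coe.1 (hf.monotone hxy),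
    fun s => WithBot.coe_injective ?_⟩, withBot_coe_continuous.comp⟩
  rw [hf.map_ωSup]
  exact withBot_ωSup_coe _ 0 _ fun n => congrArg _ (by rw [Nat.zero_add])

theorem ωScottContinuous_enat_withBot_iff {g : ℕ∞ → WithBot α} :
    ωScottContinuous g ↔ g = ⊥ ∨ ∃ (n : ℕ) (g' : ℕ∞ → α), ωScottContinuous g' ∧
      (∀ x, g x ≠ ⊥ ↔ n ≤ x) ∧ ∀ x, g (x + n) = g' x := by
  constructor
  · intro hg
    have hne : ωScottContinuous fun x => x ∈ {x | g x ≠ ⊥} := ωScottContinuous_ne_bot.comp hg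
    rcases ωScottContinuous_mem_enat_iff.1 hne with h | ⟨n, h⟩
    · exact .inl (funext fun x => not_not.1 (Set.eq_empty_iff_forall_notMem.1 h x))
    · have hx (x : ℕ∞) : g x ≠ ⊥ ↔ n ≤ x := Set.ext_iff.1 h x
      refine .inr ⟨n, fun x => (g (x + n)).unbot ((hx _).2 le_add_self), ?_, hx,
        fun x => (WithBot.coe_unbot _ _).symm⟩
      refine ωScottContinuous_coe_withBot_iff.1 ?_
      simp only [WithBot.coe_unbot]
      exact hg.comp (ωScottContinuous_enat_add n)
  · rintro (rfl | ⟨n, g', hg', hne, h⟩)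
    · exact ωScottContinuous.const
    have hmono : Monotone g := fun x y hxy => by
      by_cases hx : g x = ⊥
      · exact hx ▸ bot_le
      obtain ⟨x, rfl⟩ := le_iff_exists_add'.1 ((hne x).1 hx)
      obtain ⟨y, rfl⟩ := le_iff_exists_add'.1 (le_add_self.trans hxy)
      rw [h, h]
      exact WithBot.coe_le_coe.2
        (hg'.monotone ((ENat.addLECancellable_natCast n).add_le_add_iff_right.1 hxy))
    refine (ωScottContinuous_enat_iff hmono).2 ?_
    have hcoe := ωScottContinuous_coe_withBot_iff.2 hg'
    calc g ⊤ = g' ⊤ := by rw [← h, top_add]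
      _ ≤ ωSup (finiteValues _ hcoe.monotone) := (ωScottContinuous_enat_iff _).1 hcoe
      _ ≤ ωSup (finiteValues g hmono) := ωSup_le _ _ fun k =>
        (le_ωSup (finiteValues g hmono) (k + n)).trans' (by
          change (g' k : WithBot α) ≤ g ((k + n : ℕ) : ℕ∞)
          rw [Nat.cast_add, h])

end WithBot

section PartialValue

variable {C : Type u} [SmallCategory C] {S : ConcreteSite C} {M : MorphismProperty C}
  {Z W : Cᵒᵖ ⥤ Type u} {α : Type*}

open Classical in
/-- The values of a partial element at the points of `c`, where `v` assigns values to the global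
elements; the value is `⊥` at the points outside the domain. -/
def partialValue (v : Z.obj (op S.star) → α) {c : C} (s : LiftElt M Z c) (x : S.Pts c) :
    WithBot α :=
  if h : s.dom.Factors x then v (s.ev x h) else ⊥

variable (v : Z.obj (op S.star) → α) {c d : C}

theorem partialValue_of_factors {s : LiftElt M Z c} {x : S.Pts c} (h : s.dom.Factors x) :
    partialValue v s x = v (s.ev x h) :=
  dif_pos h

theorem partialValue_of_not_factors {s : LiftElt M Z c} {x : S.Pts c} (h : ¬ s.dom.Factors x) :
    partialValue v s x = ⊥ :=
  dif_neg h

theorem partialValue_ne_bot_iff {s : LiftElt M Z c} {x : S.Pts c} :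
    partialValue v s x ≠ ⊥ ↔ s.dom.Factors x := by
  by_cases h : s.dom.Factors x
  · simp only [partialValue_of_factors v h, ne_eq, WithBot.coe_ne_bot, not_false_eq_true, h]
  · simp only [partialValue_of_not_factors v h, ne_eq, not_true_eq_false, h]

theorem partialValue_map (f : W ⟶ Z) (s : LiftElt M W c) (x : S.Pts c) :
    partialValue v (s.map f) x = partialValue (fun w => v (f.app _ w)) s x := by
  by_cases h : s.dom.Factors x
  · rw [partialValue_of_factors _ h]
    exact (partialValue_of_factors v (s := s.map f) h).trans
      (congrArg (fun z => (v z : WithBot α)) (s.map_ev f x h h))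
  · rw [partialValue_of_not_factors _ h]
    exact partialValue_of_not_factors v (s := s.map f) h

theorem partialValue_comp {β : Type*} (f : α → β) (s : LiftElt M Z c) (x : S.Pts c) :
    partialValue (fun z => f (v z)) s x = WithBot.map f (partialValue v s x) := by
  by_cases h : s.dom.Factors x
  · rw [partialValue_of_factors _ h, partialValue_of_factors _ h, WithBot.map_coe]
  · rw [partialValue_of_not_factors _ h, partialValue_of_not_factors _ h, WithBot.map_bot]

variable [StableMonos M]

theorem partialValue_res (f : d ⟶ c) (s : LiftElt M Z c) (x : S.Pts d) :
    partialValue v (s.res f) x = partialValue v s (x ≫ f) := by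
  by_cases h : s.dom.Factors (x ≫ f)
  · have h' : (s.res f).dom.Factors x := (MSub.pull_factors _ _ _).2 h
    rw [partialValue_of_factors v h, partialValue_of_factors v h', LiftElt.res_ev]
  · rw [partialValue_of_not_factors v h, partialValue_of_not_factors v fun h' =>
      h ((MSub.pull_factors _ _ _).1 h')]

theorem partialValue_unit (z : Z.obj (op c)) (x : S.Pts c) :
    partialValue v (LiftElt.unit (M := M) z) x = v (Z.map x.op z) := by
  rw [partialValue_of_factors v (LiftElt.unit_factors _ _), LiftElt.unit_ev]

theorem partialValue_join {α : Type u} (v : Z.obj (op S.star) → α)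
    (s : LiftElt M (liftPresheaf M Z) c) (x : S.Pts c) :
    partialValue v s.join x =
      OmegaConc.joinFun α (partialValue (fun t : LiftElt M Z S.star =>
        partialValue v t (𝟙 S.star)) s x) := by
  by_cases h : s.dom.Factors x
  · refine Eq.trans ?_ (congrArg (OmegaConc.joinFun α) (partialValue_of_factors _ h)).symm
    change _ = partialValue v (s.evLift x h) (𝟙 _)
    by_cases h' : (s.evLift x h).dom.Factors (𝟙 _)
    · rw [partialValue_of_factors v h', partialValue_of_factors v
        ((LiftElt.join_factors _ _).2 ⟨h, h'⟩), LiftElt.join_ev _ _ h h']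
    · rw [partialValue_of_not_factors v h', partialValue_of_not_factors v fun hj =>
        h' ((LiftElt.join_factors _ _).1 hj).2]
  · exact (partialValue_of_not_factors v fun hj => h ((LiftElt.join_factors _ _).1 hj).1).trans
      (congrArg (OmegaConc.joinFun α) (partialValue_of_not_factors _ h)).symm

theorem partialValue_mk' (m : d ⟶ c) (hm : M m) (z : Z.obj (op d)) (x : S.Pts d) :
    partialValue v (LiftElt.mk' m hm z) (x ≫ m) = v (Z.map x.op z) := by
  rw [partialValue_of_factors v ((LiftElt.mk'_factors _ _ _ _).2 ⟨x, rfl⟩), LiftElt.mk'_ev]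

end PartialValue

namespace ConcreteSheaf

variable {C : Type u} [SmallCategory C] {S : ConcreteSite C} {M : MorphismProperty C}
  {Y : ConcreteSheaf S} {c : C}

/-- The value in `|Y|` of a global element of the sheaf of `Y`. -/
def pointValue (y : Global Y.toSheaf) : Y.carrier := valAt y (𝟙 S.star)

variable (M Y) in
/-- The functions from the points of `c` to `|Y| ⊎ {⊥}` that are the values of a partial element
over `c` of the sheaf of `Y`. -/
def partialR (c : C) : Set (S.Pts c → WithBot Y.carrier) :=
  {g | ∃ (d : C) (m : d ⟶ c), M m ∧ (∀ x, g x ≠ ⊥ ↔ ∃ y : S.Pts d, y ≫ m = x) ∧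
    ∃ g' ∈ Y.R d, ∀ y, g (y ≫ m) = (g' y : WithBot Y.carrier)}

theorem pointValue_map {c : C} (s : Y.toSheaf.obj.obj (op c)) (x : S.Pts c) :
    pointValue (Y.toSheaf.obj.map x.op s) = valAt s x :=
  globalOf_injective ((globalOf_valAt _ _).trans
    ((atPt_global (atPt s x) _).trans (globalOf_valAt s x).symm))

theorem partialValue_comp_eq_valAt_ev (s : LiftElt M Y.toSheaf.obj c) {d : C} (f : d ⟶ c)
    (h : s.dom.Factors f) (x : S.Pts d) :
    partialValue pointValue s (x ≫ f) = (valAt (s.ev f h) x : WithBot Y.carrier) := by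
  have h' : s.dom.Factors (x ≫ f) := Subobject.factors_of_factors_right x h
  rw [partialValue_of_factors _ h', s.ev_comp f x h h', pointValue_map]

theorem partialValue_mem_partialR (s : LiftElt M Y.toSheaf.obj c) :
    partialValue pointValue s ∈ partialR M Y c :=
  ⟨s.dom.obj, s.dom.arrow, s.dom.mem,
    fun x => (partialValue_ne_bot_iff _).trans (s.dom.mem_points_iff x), _, valAt_mem _,
    partialValue_comp_eq_valAt_ev s s.dom.arrow (Subobject.factors_self _)⟩

variable [S.IsAdmissible M]

theorem partialValue_injective :
    Function.Injective fun s : LiftElt M Y.toSheaf.obj c => partialValue pointValue s := by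
  intro s t h
  have hst (x : S.Pts c) : partialValue pointValue s x = partialValue pointValue t x := congrFun h x
  have hiff (x : S.Pts c) : s.dom.Factors x ↔ t.dom.Factors x := by
    rw [← partialValue_ne_bot_iff pointValue, hst, partialValue_ne_bot_iff]
  have hdom : s.dom = t.dom :=
    points_injective (S := S) (fun _ _ _ => IsAdmissible.isEmbedding) (Set.ext hiff)
  refine LiftElt.ext' (fun g => by rw [hdom]) fun {d} g hs ht => section_ext fun x => ?_
  rw [← WithBot.coe_inj, ← partialValue_comp_eq_valAt_ev, ← partialValue_comp_eq_valAt_ev, hst]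

theorem exists_partialValue_eq {g : S.Pts c → WithBot Y.carrier} (hg : g ∈ partialR M Y c) :
    ∃ s : LiftElt M Y.toSheaf.obj c, partialValue pointValue s = g := by
  obtain ⟨d, m, hm, h, g', hg', h'⟩ := hg
  refine ⟨.mk' m hm (secOf g' hg'), funext fun x => ?_⟩
  by_cases hx : ∃ y, y ≫ m = x
  · obtain ⟨y, rfl⟩ := hx
    rw [partialValue_mk', h', pointValue_map]
    rfl
  · rw [partialValue_of_not_factors _ fun hf => hx ((LiftElt.mk'_factors _ _ _ _).1 hf)]
    exact (not_not.1 (hx ∘ (h x).1)).symm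

end ConcreteSheaf

namespace OmegaConc

variable {C : Type u} [SmallCategory C] {S : ConcreteSite C} {M : MorphismProperty C}
  [S.IsAdmissible M] {X Y : OmegaConc S}

theorem mem_vertical_liftObj_of {c : C} {g : S.comb.Pts (.of c) → WithBot X.carrier} :
    g ∈ (liftObj M X).vertical.R (.of c) ↔ g ∈ partialR (S.combMonos M) X.vertical (.of c) := by
  constructor
  · rintro ⟨d, m, hm, h, g', hg', h'⟩
    refine ⟨.of d, S.incl.map m, combMonos_incl_iff.2 hm, (ofPts c).surjective.forall.2 fun x =>
      (h x).trans exists_comp_incl_eq_iff.symm, _, mem_vertical_comp_symm hg',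
      (ofPts d).surjective.forall.2 fun y => ?_⟩
    exact (congrArg g (ofPts_comp_incl y m)).trans ((h' y).trans
      (congrArg (fun z => (g' z : WithBot X.carrier)) ((ofPts d).symm_apply_apply y).symm))
  · rintro ⟨d | _, m, hm, h, g', hg', h'⟩
    · obtain ⟨m, hm, rfl⟩ := hm
      exact ⟨d, m, hm, fun x => (h _).trans exists_comp_incl_eq_iff, _, hg', fun y =>
        (congrArg g (ofPts_comp_incl y m)).symm.trans (h' _)⟩
    · exact hm.elim

theorem mem_vertical_liftObj_vert {g : S.comb.Pts .vert → WithBot X.carrier} :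
    g ∈ (liftObj M X).vertical.R .vert ↔ g ∈ partialR (S.combMonos M) X.vertical .vert := by
  refine ωScottContinuous_enat_withBot_iff.trans ⟨?_, ?_⟩
  · rintro (hg | ⟨n, g', hg', h, h'⟩)
    · have hg : ∀ x, g x = ⊥ := S.vertPts.surjective.forall.2 (congrFun hg)
      have := S.comb.isEmpty_pts_zero
      exact ⟨S.comb.zero, S.comb.isInitial.to _, combMonos_initial_to _, fun x =>
        iff_of_false (· (hg x)) fun ⟨y, _⟩ => isEmptyElim y, isEmptyElim,
        X.vertical.glue_mem _ S.comb.empty_mem _ fun _ _ h => h.elim, isEmptyElim⟩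
    · refine ⟨.vert, vertAdd n, combMonos_vert_iff.2 ⟨n, rfl⟩, S.vertPts.surjective.forall.2
        fun x => (h x).trans ?_, _, mem_vertical_vert_comp_symm hg',
        S.vertPts.surjective.forall.2 h'⟩
      simp only [S.vertPts.surjective.exists, vertPts_comp_vertAdd_eq_iff, le_iff_exists_add']
  · rintro ⟨a | _, m, hm, h, g', hg', h'⟩
    · have := (nonempty_isInitial_iff (S := S) M).1 hm
      refine .inl (funext fun x => not_not.1 fun hx => ?_)
      obtain ⟨y, -⟩ := (h _).1 hx
      exact isEmptyElim ((ofPts a).symm y)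
    · obtain ⟨n, rfl⟩ := combMonos_vert_iff.1 hm
      refine .inr ⟨n, _, hg', fun x => (h _).trans ?_, fun x => h' (S.vertPts x)⟩
      simp only [S.vertPts.surjective.exists, vertPts_comp_vertAdd_eq_iff, le_iff_exists_add']

theorem mem_vertical_liftObj {a : S.Comb} {g : S.comb.Pts a → WithBot X.carrier} :
    g ∈ (liftObj M X).vertical.R a ↔ g ∈ partialR (S.combMonos M) X.vertical a := by
  cases a with
  | of c => exact mem_vertical_liftObj_of
  | vert => exact mem_vertical_liftObj_vert

variable (M) in
/-- The value in `|X| ⊎ {⊥}` of a global partial element of the sheaf of `X`. -/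
def liftValue (s : LiftElt (S.combMonos M) X.vertical.presheaf S.comb.star) :
    WithBot X.carrier :=
  partialValue (Z := X.vertical.toSheaf.obj) pointValue s (𝟙 _)

theorem liftValue_res {a : S.Comb} (s : LiftElt (S.combMonos M) X.vertical.presheaf a)
    (x : S.comb.Pts a) :
    liftValue M (s.res x) = partialValue (Z := X.vertical.toSheaf.obj) pointValue s x :=
  (partialValue_res _ _ _ _).trans (congrArg _ (Category.id_comp x))

variable (M X) in
/-- The comparison map between the two lifting monads. -/
def liftComparison :
    (S.comb.lift (S.combMonos M)).obj ((realize S).obj X) ⟶ (realize S).obj (liftObj M X) :=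
  homOfValue (Y := (liftObj M X).vertical)
    (Z := (S.comb.lift (S.combMonos M)).obj ((realize S).obj X)) (liftValue M) fun _ s =>
      (funext (liftValue_res s) : (fun x => liftValue M (s.res x)) = _) ▸
        mem_vertical_liftObj.2 (partialValue_mem_partialR (Y := X.vertical) s)

theorem value_liftComparison (s : LiftElt (S.combMonos M) X.vertical.presheaf S.comb.star) :
    value (Y := (liftObj M X).vertical) (liftComparison M X) s = liftValue M s :=
  value_homOfValue (Y := (liftObj M X).vertical) _ _ _

instance : IsIso (liftComparison M X) := by
  have h : IsIso ((sheafToPresheaf _ _).map (liftComparison M X)) := by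
    refine @NatIso.isIso_of_isIso_app _ _ _ _ _ _ _ fun a => (isIso_iff_bijective _).2 ⟨?_, ?_⟩
    · intro s t h
      exact partialValue_injective (Y := X.vertical) (funext fun x =>
        (liftValue_res s x).symm.trans ((congrFun (congrArg Subtype.val h) x).trans
          (liftValue_res t x)))
    · rintro ⟨g, hg⟩
      obtain ⟨s, hs⟩ := exists_partialValue_eq (Y := X.vertical) (mem_vertical_liftObj.1 hg)
      exact ⟨s, Subtype.ext (funext fun x => (liftValue_res s x).trans (congrFun hs x))⟩
  exact isIso_of_reflects_iso _ (sheafToPresheaf _ _)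

theorem liftComparison_natural (f : X ⟶ Y) :
    (S.comb.lift (S.combMonos M)).map ((realize S).map f) ≫ liftComparison M Y =
      liftComparison M X ≫ (realize S).map ((OmegaConc.lift S M).map f) := by
  refine toSheaf_hom_ext (Y := (liftObj M Y).vertical) fun s => ?_
  refine (value_liftComparison (LiftElt.map ((realize S).map f).hom s)).trans ?_
  calc liftValue M (X := Y) (LiftElt.map ((realize S).map f).hom s)
      = WithBot.map f.toFun (liftValue M (X := X) s) :=
      (partialValue_map _ _ _ _).trans
        (partialValue_comp (Z := X.vertical.toSheaf.obj) pointValue f.toFun s _)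
    _ = WithBot.map f.toFun (value (Y := (liftObj M X).vertical) (liftComparison M X) s) :=
      congrArg _ (value_liftComparison s).symm

theorem liftComparison_unit (X : OmegaConc S) :
    (S.comb.lift (S.combMonos M)).η.app ((realize S).obj X) ≫ liftComparison M X =
      (realize S).map ((OmegaConc.lift S M).η.app X) :=
  toSheaf_hom_ext (Y := (liftObj M X).vertical) fun s =>
    (value_liftComparison (LiftElt.unit s)).trans ((partialValue_unit _ _ _).trans
      (congrArg WithBot.some (pointValue_map (Y := X.vertical) s (𝟙 S.comb.star))))

theorem liftComparison_mul (X : OmegaConc S) :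
    (S.comb.lift (S.combMonos M)).μ.app ((realize S).obj X) ≫ liftComparison M X =
      (S.comb.lift (S.combMonos M)).map (liftComparison M X) ≫ liftComparison M (liftObj M X) ≫
        (realize S).map ((OmegaConc.lift S M).μ.app X) := by
  refine toSheaf_hom_ext (Y := (liftObj M X).vertical) fun (s : LiftElt (S.combMonos M)
    (liftPresheaf (S.combMonos M) X.vertical.presheaf) S.comb.star) => ?_
  have value_map : liftValue M (X := liftObj M X) (LiftElt.map (liftComparison M X).hom s) =
      partialValue (liftValue M (X := X)) s (𝟙 _) :=
    (partialValue_map _ _ _ _).trans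
      (congrArg (fun v => partialValue v s (𝟙 _)) (funext value_liftComparison))
  refine (value_liftComparison (LiftElt.join s)).trans ?_
  calc liftValue M (X := X) (LiftElt.join s)
      = joinFun X.carrier (partialValue (liftValue M (X := X)) s (𝟙 _)) :=
      partialValue_join (Z := X.vertical.toSheaf.obj) pointValue s (𝟙 _)
    _ = joinFun X.carrier (value (Y := (liftObj M (liftObj M X)).vertical)
          (liftComparison M (liftObj M X)) (LiftElt.map (liftComparison M X).hom s)) :=
      congrArg _ (value_map.symm.trans (value_liftComparison (X := liftObj M X) _).symm)

variable (S M) in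
theorem realize_commutesWithMonads :
    CommutesWithMonads (realize S) (OmegaConc.lift S M) (S.comb.lift (S.combMonos M)) := by
  let k (X : OmegaConc S) : (S.comb.lift (S.combMonos M)).obj ((realize S).obj X) ≅
      (realize S).obj (liftObj M X) := asIso (liftComparison M X)
  let e : realize S ⋙ (S.comb.lift (S.combMonos M)).toFunctor ≅
      (OmegaConc.lift S M).toFunctor ⋙ realize S :=
    NatIso.ofComponents k fun f => liftComparison_natural f
  refine ⟨e.symm, fun X => ((Iso.eq_comp_inv (k X)).2 (liftComparison_unit X)).symm, fun X => ?_⟩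
  have h : (realize S).map ((OmegaConc.lift S M).μ.app X) = (k (liftObj M X)).inv ≫
      (S.comb.lift (S.combMonos M)).map (k X).inv ≫
        (S.comb.lift (S.combMonos M)).μ.app ((realize S).obj X) ≫ (k X).hom :=
    (Iso.eq_inv_comp _).2 ((Iso.eq_inv_comp ((S.comb.lift (S.combMonos M)).mapIso (k X))).2
      (liftComparison_mul X).symm)
  refine (Iso.comp_inv_eq (k X)).2 (h.trans ?_)
  simp only [Category.assoc]
  rfl

end OmegaConc

/-! ### Completeness -/

namespace LiftElt

variable {C : Type u} [SmallCategory C] {M : MorphismProperty C} [StableMonos M]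
  {X Y : Cᵒᵖ ⥤ Type u} {c d e : C}

theorem map_mk' (α : X ⟶ Y) (m : d ⟶ c) (hm : M m) (x : X.obj (op d)) :
    map α (mk' m hm x) = mk' m hm (α.app _ x) :=
  congrArg (LiftElt.mk _) (NatTrans.naturality_apply α (MSub.mk'Iso m hm).hom.op x)

theorem res_comp_mk' (f : e ⟶ d) (m : d ⟶ c) (hm : M m) (x : X.obj (op d)) :
    res (f ≫ m) (mk' m hm x) = unit (X.map f.op x) := by
  refine ext' (fun g => iff_of_true ?_ (unit_factors _ g)) fun g _ _ => ?_
  · rw [res_dom, MSub.pull_factors, mk'_factors]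
    exact ⟨g ≫ f, Category.assoc _ _ _⟩
  · rw [res_ev, ev_congr _ (Category.assoc g f m).symm, mk'_ev, unit_ev, op_comp,
      Functor.map_comp_apply]

theorem eq_unit (s : LiftElt M X c) (h : s.dom.Factors (𝟙 c)) : s = unit (s.ev (𝟙 c) h) := by
  have factors {d : C} (g : d ⟶ c) : s.dom.Factors (g ≫ 𝟙 c) :=
    Subobject.factors_of_factors_right g h
  refine ext' (fun g => iff_of_true (Category.comp_id g ▸ factors g) (unit_factors _ g))
    fun g _ _ => ?_
  rw [unit_ev, ← ev_comp s (𝟙 c) g h (factors g)]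
  exact ev_congr _ (Category.comp_id g).symm _

theorem unit_injective : Function.Injective (unit (M := M) : X.obj (op c) → LiftElt M X c) := by
  have ev_unit_id (x : X.obj (op c)) (h : (unit (M := M) x).dom.Factors (𝟙 c)) :
      (unit (M := M) x).ev (𝟙 c) h = x := by
    rw [unit_ev, op_id, Functor.map_id_apply]
  intro x y h
  rw [← ev_unit_id x (unit_factors _ _), ← ev_unit_id y (unit_factors _ _)]
  congr 1

end LiftElt

namespace ConcreteSite

variable {C : Type u} [SmallCategory C] {S : ConcreteSite C} {M : MorphismProperty C}
  [S.IsAdmissible M] {Z : S.Sh}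

variable (M Z) in
/-- The undefined global partial element of a sheaf. -/
def botPt : LiftElt M Z.obj S.star :=
  botElt S.isInitial S.empty_mem_topology IsAdmissible.zero_mem Z S.star

theorem eq_botPt {s : LiftElt M Z.obj S.star} (h : ¬ s.dom.Factors (𝟙 S.star)) :
    s = botPt M Z := by
  refine botElt_unique _ _ _ _ _ fun {d} g => ⟨fun hg => ?_, fun ⟨k⟩ => ?_⟩
  · refine nonempty_hom_zero M ⟨fun x => h ?_⟩
    rw [← S.isTerminal.hom_ext (x ≫ g) (𝟙 _)]
    exact Subobject.factors_of_factors_right x hg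
  · exact (factors_iff_of_isEmbedding (IsAdmissible.isEmbedding s.dom.mem) g).2 fun x =>
      (S.isEmpty_pts_zero.false (x ≫ k)).elim

theorem eq_botPt_or_exists_eq_unit (s : LiftElt M Z.obj S.star) :
    s = botPt M Z ∨ ∃ z : Global Z, s = LiftElt.unit z :=
  (em (s.dom.Factors (𝟙 S.star))).symm.imp eq_botPt fun h => ⟨_, s.eq_unit h⟩

theorem botPt_ne_unit (z : Global Z) : botPt M Z ≠ LiftElt.unit z := fun h => by
  obtain ⟨k⟩ := (botElt_factors S.isInitial S.empty_mem_topology IsAdmissible.zero_mem Z _).1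
    (h ▸ LiftElt.unit_factors z (𝟙 S.star) : (botPt M Z).dom.Factors (𝟙 S.star))
  exact S.isEmpty_pts_zero.false k

theorem map_botPt {W : S.Sh} (α : Z ⟶ W) :
    LiftElt.map α.hom (botPt M Z) = botPt M W := by
  refine eq_botPt fun h => ?_
  rw [LiftElt.map_dom, botPt, botElt_factors] at h
  exact h.elim fun k => S.isEmpty_pts_zero.false k

end ConcreteSite

section Stages

variable {D : Type*} [Category* D] [CartesianMonoidalCategory D] {L : D ⥤ D}
  (bot : (Functor.const D).obj (𝟙_ D) ⟶ L)

theorem stageMap_self : ∀ n, stageMap bot n n = 𝟙 _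
  | 0 => rfl
  | n + 1 => (congrArg L.map (stageMap_self n)).trans (L.map_id _)

/-- The inclusion of `L^n 1` in the colimit `ω`. -/
def omegaι [HasColimitsOfShape ℕ D] (n : ℕ) : stage L n ⟶ omegaObj bot :=
  colimit.ι (Functor.ofSequence (stageUp bot)) n

theorem stageUp_omegaι [HasColimitsOfShape ℕ D] (n : ℕ) :
    stageUp bot n ≫ omegaι bot (n + 1) = omegaι bot n := by
  have := colimit.w (Functor.ofSequence (stageUp bot)) (homOfLE (Nat.le_succ n))
  rwa [Functor.ofSequence_map_homOfLE_succ] at this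

theorem stageMap_omegaι [HasColimitsOfShape ℕ D] {n m : ℕ} (h : n ≤ m) :
    stageMap bot n m ≫ omegaι bot m = omegaι bot n := by
  induction h using Nat.decreasingInduction with
  | self => rw [stageMap_self, Category.id_comp]
  | of_succ n _ ih => rw [← stageUp_stageMap, Category.assoc, ih, stageUp_omegaι]

variable (L) in
/-- The projection from the limit `ω̄` to `L^n 1`. -/
def omegaBarπ [HasLimitsOfShape ℕᵒᵖ D] (n : ℕ) : omegaBarObj L ⟶ stage L n :=
  limit.π (Functor.ofOpSequence (stageDown L)) (op n)

theorem omegaBarπ_stageDown [HasLimitsOfShape ℕᵒᵖ D] (n : ℕ) :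
    omegaBarπ L (n + 1) ≫ stageDown L n = omegaBarπ L n := by
  have := limit.w (Functor.ofOpSequence (stageDown L)) (homOfLE (Nat.le_succ n)).op
  rwa [Functor.ofOpSequence_map_homOfLE_succ] at this

theorem omegaι_omegaComparison_omegaBarπ [HasColimitsOfShape ℕ D] [HasLimitsOfShape ℕᵒᵖ D]
    (n m : ℕ) : omegaι bot n ≫ omegaComparison bot ≫ omegaBarπ L m = stageMap bot n m := by
  have ι_comparison : omegaι bot n ≫ omegaComparison bot = stageToOmegaBar bot n :=
    colimit.ι_desc _ _
  rw [← Category.assoc, ι_comparison]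
  exact limit.lift_π _ _

theorem omegaι_omegaComparison_omegaBarπ_omegaι [HasColimitsOfShape ℕ D]
    [HasLimitsOfShape ℕᵒᵖ D] {n m : ℕ} (h : n ≤ m) :
    omegaι bot n ≫ omegaComparison bot ≫ omegaBarπ L m ≫ omegaι bot m = omegaι bot n := by
  simpa only [Category.assoc, stageMap_omegaι bot h] using
    congrArg (· ≫ omegaι bot m) (omegaι_omegaComparison_omegaBarπ bot n m)

end Stages

section LimitsAndColimits

theorem colimit_whiskerRight_hom_ext {D : Type*} [Category* D] [MonoidalCategory D]
    [BraidedCategory D] [MonoidalClosed D] {K : Type*} [Category* K] (F : K ⥤ D) [HasColimit F]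
    {A X : D} {f g : colimit F ⊗ A ⟶ X}
    (h : ∀ k, colimit.ι F k ▷ A ≫ f = colimit.ι F k ▷ A ≫ g) : f = g := by
  rw [← cancel_epi (β_ A (colimit F)).hom]
  refine (isColimitOfPreserves (tensorLeft A) (colimit.isColimit F)).hom_ext
    fun k => ?_
  have := congrArg ((β_ A (F.obj k)).hom ≫ ·) (h k)
  simpa using this

variable {C : Type u} [SmallCategory C] {J : GrothendieckTopology C} {F : ℕ → Sheaf J (Type u)}
  (down : ∀ n, F (n + 1) ⟶ F n) {a : Cᵒᵖ}

theorem limit_ofOpSequence_ext {x y : (limit (Functor.ofOpSequence down)).obj.obj a}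
    (h : ∀ n, (limit.π (Functor.ofOpSequence down) (op n)).hom.app a x =
      (limit.π (Functor.ofOpSequence down) (op n)).hom.app a y) : x = y :=
  (Types.isLimitEquivSections (isLimitOfPreserves (sheafToPresheaf J (Type u) ⋙
    (evaluation _ _).obj a) (limit.isLimit _))).injective (Subtype.ext (funext fun n => h n.unop))

theorem exists_limit_ofOpSequence_app_eq (x : ∀ n, (F n).obj.obj a)
    (h : ∀ n, (down n).hom.app a (x (n + 1)) = x n) :
    ∃ y : (limit (Functor.ofOpSequence down)).obj.obj a,
      ∀ n, (limit.π (Functor.ofOpSequence down) (op n)).hom.app a y = x n := by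
  let G := sheafToPresheaf J (Type u) ⋙ (evaluation _ _).obj a
  let sections : (Functor.const ℕᵒᵖ).obj PUnit.{u + 1} ⟶ Functor.ofOpSequence down ⋙ G :=
    NatTrans.ofOpSequence (fun n => TypeCat.ofHom fun _ => x n) fun n => by
      ext
      refine (h n).symm.trans ?_
      exact (congrArg (fun k : F (n + 1) ⟶ F n => k.hom.app a (x (n + 1)))
        (Functor.ofOpSequence_map_homOfLE_succ down n)).symm
  obtain ⟨y, hy⟩ := (Types.isLimitEquivSections
    (isLimitOfPreserves G (limit.isLimit (Functor.ofOpSequence down)))).surjective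
    ⟨fun n => x n.unop, fun f => (NatTrans.naturality_apply sections f PUnit.unit).symm⟩
  exact ⟨y, fun n => congrFun (congrArg Subtype.val hy) (op n)⟩

end LimitsAndColimits

section GenericElements

variable {C : Type u} [SmallCategory C] (S : ConcreteSite C) (M : MorphismProperty C)
  [S.IsAdmissible M]

/-- The sheaves `1, L1, LL1, …` on the combined site. -/
abbrev combStage (n : ℕ) : S.comb.Sh := stage (S.comb.lift (S.combMonos M)).toFunctor n

/-- The generic element of `L^n 1` over `V`, the `n`-fold partial element whose domain shrinks by
the first point of `V` at each level. -/
def generic : ∀ n, (combStage S M n).obj.obj (op .vert)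
  | 0 => PUnit.unit
  | n + 1 => LiftElt.mk' (X := (combStage S M n).obj) (vertAdd 1)
      (combMonos_vert_iff.2 ⟨1, rfl⟩) (generic n)

/-- The global element of `L^n 1` that is the value of the generic element at the point `k` of
`V`. -/
def stagePoint (n : ℕ) (k : ℕ∞) : Global (combStage S M n) :=
  atPt (S := S.comb) (generic S M n) (S.vertPts k)

variable {S M}

theorem stageDown_generic : ∀ n,
    (stageDown (S.comb.lift (S.combMonos M)).toFunctor n).hom.app _ (generic S M (n + 1)) =
      generic S M n
  | 0 => rfl
  | n + 1 => (LiftElt.map_mk' _ _ _ _).trans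
      (congrArg (LiftElt.mk' (X := (combStage S M n).obj) (vertAdd 1)
        (combMonos_vert_iff.2 ⟨1, rfl⟩)) (stageDown_generic n))

theorem stagePoint_succ_zero (n : ℕ) :
    stagePoint S M (n + 1) 0 = botPt (S.combMonos M) (combStage S M n) := by
  refine eq_botPt fun h => ?_
  obtain ⟨x, hx⟩ := (LiftElt.mk'_factors _ _ _ _).1 ((MSub.pull_factors _ _ _).1 h)
  obtain ⟨x, rfl⟩ := S.vertPts.surjective x
  exact absurd (vertPts_comp_vertAdd_eq_iff.1 (hx.trans (Category.id_comp _))).symm (by simp)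

theorem stagePoint_succ_add_one (n : ℕ) (k : ℕ∞) :
    stagePoint S M (n + 1) (k + 1) =
      LiftElt.unit (M := S.combMonos M) (X := (combStage S M n).obj) (stagePoint S M n k) := by
  have : S.vertPts (k + 1) = S.vertPts k ≫ vertAdd 1 := (vertPts_comp_vertAdd_eq_iff.2 rfl).symm
  rw [stagePoint, this]
  exact LiftElt.res_comp_mk' _ _ _ _

theorem exists_eq_stagePoint : ∀ (n : ℕ) (s : Global (combStage S M n)), ∃ k, stagePoint S M n k = s
  | 0, _ => ⟨0, rfl⟩
  | n + 1, s => by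
    obtain h | ⟨t, h⟩ := eq_botPt_or_exists_eq_unit (M := S.combMonos M) (Z := combStage S M n) s
    · exact ⟨0, (stagePoint_succ_zero n).trans h.symm⟩
    · obtain ⟨k, rfl⟩ := exists_eq_stagePoint n t
      exact ⟨k + 1, (stagePoint_succ_add_one n k).trans h.symm⟩

theorem stagePoint_eq_iff (n : ℕ) {j k : ℕ∞} :
    stagePoint S M n j = stagePoint S M n k ↔ min j n = min k n := by
  induction n generalizing j k with
  | zero => exact iff_of_true rfl (by simp)
  | succ n ih =>
    rcases enat_eq_zero_or_exists_eq_add_one j with rfl | ⟨j, rfl⟩ <;>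
      rcases enat_eq_zero_or_exists_eq_add_one k with rfl | ⟨k, rfl⟩
    · exact iff_of_true rfl rfl
    · rw [stagePoint_succ_zero, stagePoint_succ_add_one]
      refine iff_of_false (botPt_ne_unit _) ?_
      simp [min_add_add_right, eq_comm (a := (0 : ℕ∞))]
    · rw [stagePoint_succ_zero, stagePoint_succ_add_one]
      refine iff_of_false (botPt_ne_unit _).symm ?_
      simp [min_add_add_right]
    · rw [stagePoint_succ_add_one, stagePoint_succ_add_one, Nat.cast_succ, min_add_add_right,
        min_add_add_right, (ENat.add_left_injective_of_ne_top ENat.one_ne_top).eq_iff]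
      exact LiftElt.unit_injective.eq_iff.trans ih

theorem stageMap_stagePoint : ∀ (n m : ℕ) (k : ℕ∞),
    (stageMap (S.comb.bot (S.combMonos M)) n m).hom.app _ (stagePoint S M n k) =
      stagePoint S M m (min k n)
  | 0, 0, _ => rfl
  | _ + 1, 0, _ => rfl
  | 0, m + 1, k => by
    rw [Nat.cast_zero, min_eq_right zero_le, stagePoint_succ_zero]
    rfl
  | n + 1, m + 1, k => by
    rcases enat_eq_zero_or_exists_eq_add_one k with rfl | ⟨k, rfl⟩
    · rw [min_eq_left zero_le, stagePoint_succ_zero, stagePoint_succ_zero]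
      exact map_botPt _
    · rw [stagePoint_succ_add_one, Nat.cast_succ, min_add_add_right, stagePoint_succ_add_one,
        ← stageMap_stagePoint n m k]
      exact LiftElt.map_unit _ _

end GenericElements

section Completeness

variable {C : Type u} [SmallCategory C] (S : ConcreteSite C) (M : MorphismProperty C)
  [S.IsAdmissible M]

/-- The sheaf `ω` on the combined site. -/
abbrev combOmega : S.comb.Sh := omegaObj (S.comb.bot (S.combMonos M))

/-- The sheaf `ω̄` on the combined site. -/
abbrev combOmegaBar : S.comb.Sh := omegaBarObj (S.comb.lift (S.combMonos M)).toFunctor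

/-- The comparison map `i : ω ⟶ ω̄` on the combined site. -/
abbrev combComparison : combOmega S M ⟶ combOmegaBar S M :=
  omegaComparison (S.comb.bot (S.combMonos M))

/-- The inclusion of `L^n 1` in `ω` on the combined site. -/
abbrev combι (n : ℕ) : combStage S M n ⟶ combOmega S M := omegaι (S.comb.bot (S.combMonos M)) n

/-- The projection from `ω̄` to `L^n 1` on the combined site. -/
abbrev combπ (n : ℕ) : combOmegaBar S M ⟶ combStage S M n :=
  omegaBarπ (S.comb.lift (S.combMonos M)).toFunctor n

theorem exists_combπ_eq_generic : ∃ w : (combOmegaBar S M).obj.obj (op .vert),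
    ∀ n, (combπ S M n).hom.app _ w = generic S M n :=
  exists_limit_ofOpSequence_app_eq _ _ stageDown_generic

/-- The generic element of `ω̄` over `V`, the limit of the generic elements of the `L^n 1`. -/
def genericBar : (combOmegaBar S M).obj.obj (op .vert) := (exists_combπ_eq_generic S M).choose

/-- The global element of `ω̄` that is the value of the generic element at the point `k` of `V`. -/
def omegaBarPoint (k : ℕ∞) : Global (combOmegaBar S M) :=
  atPt (S := S.comb) (genericBar S M) (S.vertPts k)

variable {S M}

theorem combπ_omegaBarPoint (n : ℕ) (k : ℕ∞) :
    (combπ S M n).hom.app _ (omegaBarPoint S M k) = stagePoint S M n k := by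
  rw [omegaBarPoint, ← atPt_app, genericBar, (exists_combπ_eq_generic S M).choose_spec n,
    stagePoint]

theorem combOmegaBar_ext {x y : Global (combOmegaBar S M)}
    (h : ∀ n, (combπ S M n).hom.app _ x = (combπ S M n).hom.app _ y) : x = y :=
  limit_ofOpSequence_ext _ h

theorem stageDown_stagePoint (n : ℕ) (k : ℕ∞) :
    (stageDown (S.comb.lift (S.combMonos M)).toFunctor n).hom.app _ (stagePoint S M (n + 1) k) =
      stagePoint S M n k := by
  rw [stagePoint, ← atPt_app, stageDown_generic, stagePoint]

theorem combπ_eq_stagePoint_of_le (f : Global (combOmegaBar S M)) {n m : ℕ} (h : n ≤ m) {k : ℕ∞}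
    (hm : (combπ S M m).hom.app _ f = stagePoint S M m k) :
    (combπ S M n).hom.app _ f = stagePoint S M n k := by
  induction h using Nat.decreasingInduction with
  | self => exact hm
  | of_succ n _ ih =>
    rw [← stageDown_stagePoint, ← ih]
    exact congrArg (fun k : combOmegaBar S M ⟶ combStage S M n => k.hom.app _ f)
      (omegaBarπ_stageDown n).symm

theorem exists_eq_omegaBarPoint (f : Global (combOmegaBar S M)) :
    ∃ k, omegaBarPoint S M k = f := by
  choose k hk using fun n => exists_eq_stagePoint n ((combπ S M n).hom.app _ f)
  by_cases htop : ∀ n, stagePoint S M n ⊤ = (combπ S M n).hom.app _ f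
  · exact ⟨⊤, combOmegaBar_ext fun n => (combπ_omegaBarPoint n ⊤).trans (htop n)⟩
  · obtain ⟨n, hn⟩ := not_forall.1 htop
    have k_lt : k n < n := not_le.1 fun h => hn <| by
      rw [← hk, stagePoint_eq_iff, min_eq_right h, min_eq_right le_top]
    refine ⟨k n, combOmegaBar_ext fun m => (combπ_omegaBarPoint m _).trans ?_⟩
    rcases le_total m n with h | h
    · exact (combπ_eq_stagePoint_of_le f h (hk n).symm).symm
    · have at_n : stagePoint S M n (k m) = stagePoint S M n (k n) :=
        (combπ_eq_stagePoint_of_le f h (hk m).symm).symm.trans (hk n).symm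
      have k_eq : k m = k n := by
        rw [stagePoint_eq_iff, min_eq_left k_lt.le] at at_n
        exact (min_eq_left ((min_lt_iff.1 (at_n.trans_lt k_lt)).resolve_right
          (lt_irrefl _)).le).symm.trans at_n
      rw [← k_eq, hk]

theorem omegaBarPoint_natCast (n : ℕ) :
    omegaBarPoint S M n =
      (combComparison S M).hom.app _ ((combι S M n).hom.app _ (stagePoint S M n n)) := by
  refine combOmegaBar_ext fun m => (combπ_omegaBarPoint m n).trans ?_
  refine .trans ?_ (congrArg (fun k => k.hom.app _ (stagePoint S M n n))
    (omegaι_omegaComparison_omegaBarπ (S.comb.bot (S.combMonos M)) n m)).symm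
  exact (congrArg _ (min_self _).symm).trans (stageMap_stagePoint n m n).symm

theorem combι_stagePoint {n m : ℕ} (h : n ≤ m) (k : ℕ∞) :
    (combι S M n).hom.app _ (stagePoint S M n k) =
      (combι S M m).hom.app _ (stagePoint S M m (min k n)) := by
  rw [← stageMap_stagePoint, combι, ← stageMap_omegaι _ h]
  rfl

variable {X : OmegaConc S} {A Y : S.comb.Sh}

theorem value_atPt_continuous (φ : Y ⊗ A ⟶ (realize S).obj X) (y : Y.obj.obj (op .vert))
    (s : Global A) : ωScottContinuous fun k : ℕ∞ =>
      value (Y := X.vertical) φ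
        (pairAt (a := S.comb.star) (atPt (S := S.comb) y (S.vertPts k)) s) := by
  have := value_mem (Y := X.vertical) φ (pairAt y (constAt (S := S.comb) .vert s))
  have atPt_pair (x : S.comb.Pts .vert) :
      atPt (S := S.comb) (pairAt y (constAt (S := S.comb) .vert s)) x =
        pairAt (a := S.comb.star) (atPt (S := S.comb) y x) s :=
    congrArg (pairAt (a := S.comb.star) _) (atPt_constAt (S := S.comb) _ s x)
  simp only [atPt_pair] at this
  exact this

/-- The approximations to an extension of `φ` to `ω̄ × A`. -/
def approx (φ : combOmega S M ⊗ A ⟶ (realize S).obj X) (n : ℕ) :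
    combOmegaBar S M ⊗ A ⟶ (realize S).obj X :=
  (combπ S M n ≫ combι S M n) ▷ A ≫ φ

theorem value_approx (φ : combOmega S M ⊗ A ⟶ (realize S).obj X) (n : ℕ)
    (k : ℕ∞) (s : Global A) :
    value (Y := X.vertical) (approx φ n) (pairAt (a := S.comb.star) (omegaBarPoint S M k) s) =
      value (Y := X.vertical) φ (pairAt (a := S.comb.star)
        ((combι S M n).hom.app _ (stagePoint S M n k)) s) :=
  congrArg (fun z => value (Y := X.vertical) φ (pairAt (a := S.comb.star)
    ((combι S M n).hom.app _ z) s)) (combπ_omegaBarPoint n k)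

theorem approx_monotone (φ : combOmega S M ⊗ A ⟶ (realize S).obj X)
    (z : Global (combOmegaBar S M ⊗ A)) :
    Monotone fun n => value (Y := X.vertical) (approx φ n) z := by
  obtain ⟨f, s⟩ := z
  obtain ⟨k, rfl⟩ := exists_eq_omegaBarPoint f
  intro n m h
  refine (value_approx φ n k s).trans_le (le_of_le_of_eq ?_ (value_approx φ m k s).symm)
  rw [combι_stagePoint h]
  have := (value_atPt_continuous φ ((combι S M m).hom.app _ (generic S M m)) s).monotone
    (min_le_left k n)
  simp only [atPt_app] at this
  exact this

/-- The extension of `φ` from `ω × A` to `ω̄ × A`, the supremum of its approximations. -/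
def extendBar (φ : combOmega S M ⊗ A ⟶ (realize S).obj X) :
    combOmegaBar S M ⊗ A ⟶ (realize S).obj X :=
  homOfValue (Y := X.vertical)
    (fun z => ωSup ⟨fun n => value (Y := X.vertical) (approx φ n) z, approx_monotone φ z⟩)
    fun _ z => ωSup_mem_vertical
      ⟨fun n x => value (Y := X.vertical) (approx φ n) (atPt z x),
        fun _ _ h _ => approx_monotone φ _ h⟩
      fun n => value_mem (Y := X.vertical) (approx φ n) z

theorem value_extendBar (φ : combOmega S M ⊗ A ⟶ (realize S).obj X)
    (z : Global (combOmegaBar S M ⊗ A)) :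
    value (Y := X.vertical) (extendBar φ) z =
      ωSup ⟨fun n => value (Y := X.vertical) (approx φ n) z, approx_monotone φ z⟩ :=
  value_homOfValue (Y := X.vertical) _ _ z

theorem value_approx_of_le (φ : combOmega S M ⊗ A ⟶ (realize S).obj X) {n m : ℕ} (h : n ≤ m)
    (g : Global (combStage S M n)) (s : Global A) :
    value (Y := X.vertical) (approx φ m) (pairAt (a := S.comb.star)
      ((combComparison S M).hom.app _ ((combι S M n).hom.app _ g)) s) =
      value (Y := X.vertical) φ (pairAt (a := S.comb.star) ((combι S M n).hom.app _ g) s) :=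
  congrArg (fun k : combStage S M n ⟶ combOmega S M =>
      value (Y := X.vertical) φ (pairAt (a := S.comb.star) (k.hom.app _ g) s))
    (omegaι_omegaComparison_omegaBarπ_omegaι (S.comb.bot (S.combMonos M)) h)

theorem comparison_extendBar (φ : combOmega S M ⊗ A ⟶ (realize S).obj X) :
    combComparison S M ▷ A ≫ extendBar φ = φ := by
  refine colimit_whiskerRight_hom_ext _ fun n => toSheaf_hom_ext (Y := X.vertical) ?_
  rintro ⟨g, s⟩
  refine (value_extendBar φ (pairAt (a := S.comb.star) ((combComparison S M).hom.app _
    ((combι S M n).hom.app _ g)) s)).trans (le_antisymm (ωSup_le _ _ fun m => ?_) ?_)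
  · exact (approx_monotone φ _ (le_max_right n m)).trans
      (value_approx_of_le φ (le_max_left n m) g s).le
  · exact (value_approx_of_le φ le_rfl g s).ge.trans
      (le_ωSup ⟨fun n => value (Y := X.vertical) (approx φ n) _, approx_monotone φ _⟩ n)

theorem comparison_hom_ext {g h : combOmegaBar S M ⊗ A ⟶ (realize S).obj X}
    (e : combComparison S M ▷ A ≫ g = combComparison S M ▷ A ≫ h) : g = h := by
  refine toSheaf_hom_ext (Y := X.vertical) ?_
  rintro ⟨f, s⟩
  obtain ⟨k, rfl⟩ := exists_eq_omegaBarPoint f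
  have hg := value_atPt_continuous g (genericBar S M) s
  have hh := value_atPt_continuous h (genericBar S M) s
  refine congrFun (ωScottContinuous_enat_ext (α := X.vertical.carrier) hg hh fun n => ?_) k
  change value (Y := X.vertical) g (pairAt (a := S.comb.star) (omegaBarPoint S M n) s) =
    value (Y := X.vertical) h (pairAt (a := S.comb.star) (omegaBarPoint S M n) s)
  rw [omegaBarPoint_natCast]
  exact congrArg (fun k => value (Y := X.vertical) k (pairAt (a := S.comb.star)
    ((combι S M n).hom.app _ (stagePoint S M n n)) s)) e

variable (M) in
theorem realize_isLComplete (X : OmegaConc S) :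
    S.comb.IsLComplete (S.combMonos M) ((realize S).obj X) := fun _ φ =>
  ⟨extendBar φ, comparison_extendBar φ, fun _ h =>
    comparison_hom_ext (h.trans (comparison_extendBar φ).symm)⟩

end Completeness

end OmegaSheaf

end

theorem mainTheorem5 {C : Type u} [SmallCategory C] (S : OmegaSheaf.ConcreteSite C)
    (M : MorphismProperty C) [S.IsAdmissible M] :
    HasProducts.{u} (OmegaSheaf.OmegaConc S) ∧ HasCoproducts.{u} (OmegaSheaf.OmegaConc S) ∧
    ∃ _ : S.comb.IsAdmissible (S.combMonos M),
    ∃ F : OmegaSheaf.OmegaConc S ⥤ S.comb.Sh,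
      F.Full ∧ F.Faithful ∧
      (∀ ι : Type u, PreservesLimitsOfShape (Discrete ι) F) ∧
      (∀ ι : Type u, PreservesColimitsOfShape (Discrete ι) F) ∧
      (∃ _ : PreservesLimitsOfShape (Discrete WalkingPair) F, MonoidalClosedFunctor F) ∧
      OmegaSheaf.CommutesWithMonads F (OmegaSheaf.OmegaConc.lift S M)
        (S.comb.lift (S.combMonos M)) ∧
      ∀ X : OmegaSheaf.OmegaConc S,
        S.comb.IsConcrete (F.obj X) ∧ S.comb.IsLComplete (S.combMonos M) (F.obj X) :=
  have hS := OmegaSheaf.ConcreteSite.coversEmpty_of_isAdmissible (S := S) M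
  ⟨inferInstance, OmegaSheaf.OmegaConc.hasCoproducts hS, inferInstance,
    OmegaSheaf.OmegaConc.realize S, inferInstance, inferInstance, fun _ => inferInstance,
    fun _ => OmegaSheaf.OmegaConc.preservesCoproducts_realize hS, ⟨inferInstance, inferInstance⟩,
    OmegaSheaf.OmegaConc.realize_commutesWithMonads S M,
    fun X => ⟨OmegaSheaf.ConcreteSheaf.isConcrete_toSheaf X.vertical,
      OmegaSheaf.realize_isLComplete M X⟩⟩
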